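/- Conventions. Manifolds are smooth, Hausdorff and second countable, not necessarily connected. $M$ and $N$ have pure dimensions $\dim M$, $\dim N$; the connected components of $W$ (and of $V$ below) may have different dimensions. A \emph{singular foliation} $\mathcal F$ on $M$ is a subsheaf of modules over smooth functions of the sheaf $\mathfrak X$ of vector fields that is stable under the Lie bracket and locally finitely generated. For $x\in M$ let $\mathrm{rk}_x(\mathcal F)$ be the minimal number of vector fields generating $\mathcal F$ on a neighbourhood of $x$, and $\mathrm{rk}(\mathcal F)=\sup_{x\in M}\mathrm{rk}_x(\mathcal F)\in\mathbb N\cup\{\infty\}$; $\mathcal F$ has \emph{finite global rank} if $\mathrm{rk}(\mathcal F)<\infty$. An \emph{anchored bundle} over $\mathcal F$ is a vector bundle $E\to M$ of rank $\mathrm{rk}(E)$ with a vector bundle morphism $\rho\colon E\to TM$ over the identity such that $\rho(\Gamma(E))=\mathcal F$ as sheaves. For a submersion $p\colon W\to M$, $p^{-1}(\mathcal F)$ is the sheaf of vector fields $Z$ on $W$ such that $Tp(Z)$ is locally of the form $\sum_i f_i\,(X_i\circ p)$ with finitely many smooth functions $f_i$ and $X_i\in\mathcal F$. A \emph{bi-submersion}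 $(M,\mathcal F_M)\stackrel{p}{\leftarrow}W\stackrel{q}{\rightarrow}(N,\mathcal F_N)$ is a manifold $W$ with two (not necessarily surjective) submersions $p,q$ such that $p^{-1}(\mathcal F_M)=q^{-1}(\mathcal F_N)=\Gamma(\ker Tp)+\Gamma(\ker Tq)$. Two bi-submersions $(W,p,q)$, $(W',p',q')$ between the same singular foliations are \emph{equivalent} if there are a manifold $V$ and surjective submersions $\delta\colon V\to W$, $\eta\colon V\to W'$ with $p\circ\delta=p'\circ\eta$ and $q\circ\delta=q'\circ\eta$. \textbf{Theorem.} Let $(M,\mathcal F_M)\stackrel{p}{\leftarrow}W\stackrel{q}{\rightarrow}(N,\mathcal F_N)$ be a bi-submersion between singular foliations of finite global rank, and put $$\kappa=\tfrac12\bigl(\mathrm{rk}(\mathcal F_M)+\mathrm{rk}(\mathcal F_N)+\dim M+\dim N\bigr).$$ \begin{enumerate} \item If $W\neq\emptyset$ and $p$ and $q$ are surjective, then $\kappa$ is an integer and some connected component of $W$ has dimension at least $\kappa$ (so that all of them do if $W$ has pure dimension). \item Suppose that $\kappa$ is an integer and that every connected component of $W$ has dimension at least $\kappa$. Then there is a (possibly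 non-connected) embedded submanifold $W'\subset W$ such that every connected component of $W'$ has dimension $\kappa$; $W'$, with the restrictions of $p$ and $q$, is a bi-submersion between $(M,\mathcal F_M)$ and $(N,\mathcal F_N)$; and the bi-submersions $W'$ and $W$ are equivalent. \item Let $E$ be an anchored bundle over $\mathcal F_M$ and suppose that every connected component of $W$ has dimension at least $\mathrm{rk}(E)+\dim N$. Then there is a submanifold $W'\subset W$ as in 2., with $\kappa$ replaced by $\mathrm{rk}(E)+\dim N$. \end{enumerate} -/

import Mathlib

open scoped Manifold ContDiff Topology
open TopologicalSpace

universe u v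

/-! ### Vector fields

All `m`-dimensional manifolds are modelled on `EuclideanSpace ℝ (Fin m)`. A vector field on an open
subset `U` of `M` is represented by a function on all of `M` whose values outside `U` are irrelevant. -/

section Pure

/-- Vector fields on `M`, without regularity assumption. -/
abbrev VField (m : ℕ) (M : Type*) [TopologicalSpace M] [ChartedSpace (EuclideanSpace ℝ (Fin m)) M] :=
  ∀ x : M, TangentSpace (𝓡 m) x

variable {m n d : ℕ}
  {M : Type*} [TopologicalSpace M] [ChartedSpace (EuclideanSpace ℝ (Fin m)) M]
  [IsManifold (𝓡 m) ∞ M]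
  {N : Type*} [TopologicalSpace N] [ChartedSpace (EuclideanSpace ℝ (Fin n)) N]
  [IsManifold (𝓡 n) ∞ N]
  {W : Type*} [TopologicalSpace W] [ChartedSpace (EuclideanSpace ℝ (Fin d)) W]
  [IsManifold (𝓡 d) ∞ W]

/-- The vector field `X` is smooth on `U`. -/
def VField.SmoothOn (X : VField m M) (U : Opens M) : Prop :=
  ContMDiffOn (𝓡 m) (𝓡 m).tangent ∞ (fun x => (⟨x, X x⟩ : TangentBundle (𝓡 m) M)) (U : Set M)

/-- The real function `f` is smooth on `U`. -/
def SmoothFunOn (m : ℕ) {M : Type*} [TopologicalSpace M]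
    [ChartedSpace (EuclideanSpace ℝ (Fin m)) M] (f : M → ℝ) (U : Opens M) : Prop :=
  ContMDiffOn (𝓡 m) 𝓘(ℝ, ℝ) ∞ f (U : Set M)

/-- Finitely many vector fields `X₁, …, X_r ∈ S(U)` generate `S` on `U`: on every open `V ⊆ U`, each
element of `S(V)` is a combination of them with coefficients that are smooth on `V`. -/
def GeneratesOn (S : Opens M → Set (VField m M)) (U : Opens M) {r : ℕ}
    (X : Fin r → VField m M) : Prop :=
  (∀ i, X i ∈ S U) ∧
    ∀ V : Opens M, V ≤ U → ∀ Y ∈ S V, ∃ f : Fin r → M → ℝ,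
      (∀ i, SmoothFunOn m (f i) V) ∧ ∀ x ∈ V, Y x = ∑ i, f i x • X i x

/-- A singular foliation on `M`: a subsheaf of modules of the sheaf of smooth vector fields, stable
under the Lie bracket and locally finitely generated. -/
structure SingularFoliation (m : ℕ) (M : Type*) [TopologicalSpace M]
    [ChartedSpace (EuclideanSpace ℝ (Fin m)) M] [IsManifold (𝓡 m) ∞ M] where
  /-- the sections over an open subset -/
  sec : Opens M → Set (VField m M)
  smooth : ∀ U, ∀ X ∈ sec U, X.SmoothOn U
  /-- membership in `sec U` depends only on the restriction to `U` -/
  congr : ∀ U, ∀ X ∈ sec U, ∀ Y : VField m M, (∀ x ∈ U, Y x = X x) → Y ∈ sec U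
  restrict : ∀ U V : Opens M, V ≤ U → sec U ⊆ sec V
  glue : ∀ (U : Opens M) (X : VField m M),
    (∀ x ∈ U, ∃ V : Opens M, x ∈ V ∧ V ≤ U ∧ X ∈ sec V) → X ∈ sec U
  zero_mem : ∀ U, (fun _ => 0) ∈ sec U
  add_mem : ∀ U, ∀ X ∈ sec U, ∀ Y ∈ sec U, (fun x => X x + Y x) ∈ sec U
  smul_mem : ∀ U (f : M → ℝ), SmoothFunOn m f U → ∀ X ∈ sec U, (fun x => f x • X x) ∈ sec U
  lie_mem : ∀ U, ∀ X ∈ sec U, ∀ Y ∈ sec U, VectorField.mlieBracket (𝓡 m) X Y ∈ sec U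
  locally_fg : ∀ x : M, ∃ U : Opens M, x ∈ U ∧ ∃ (r : ℕ) (X : Fin r → VField m M),
    GeneratesOn sec U X

/-- `rk_x(F)`: the minimal number of local generators of `F` near `x`. -/
noncomputable def SingularFoliation.rkAt (F : SingularFoliation m M) (x : M) : ℕ :=
  sInf {r | ∃ U : Opens M, x ∈ U ∧ ∃ X : Fin r → VField m M, GeneratesOn F.sec U X}

/-- `rk(F)`: the supremum of the numbers `rk_x(F)`, possibly infinite. -/
noncomputable def SingularFoliation.rk (F : SingularFoliation m M) : ℕ∞ :=
  ⨆ x : M, (F.rkAt x : ℕ∞)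

/-- The sections over `O` of the pull-back `p⁻¹(F)`: the smooth vector fields `Z` on `O` such that
`Tp(Z)` is locally a combination `∑ fᵢ · (Xᵢ ∘ p)`, with `fᵢ` smooth on `W` and `Xᵢ` in `F`. -/
def pullbackSec (F : SingularFoliation m M) (p : W → M) (O : Opens W) : Set (VField d W) :=
  {Z | Z.SmoothOn O ∧ ∀ w ∈ O, ∃ O' : Opens W, w ∈ O' ∧ O' ≤ O ∧
    ∃ U : Opens M, (∀ y ∈ O', p y ∈ U) ∧
    ∃ (r : ℕ) (X : Fin r → VField m M) (f : Fin r → W → ℝ),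
      (∀ i, X i ∈ F.sec U) ∧ (∀ i, SmoothFunOn d (f i) O') ∧
      ∀ y ∈ O', mfderiv (𝓡 d) (𝓡 m) p y (Z y) = ∑ i, f i y • X i (p y)}

/-- The sections over `O` of `Γ(ker Tp) + Γ(ker Tq)`. -/
def kerSumSec (m n : ℕ) {M N : Type*} [TopologicalSpace M]
    [ChartedSpace (EuclideanSpace ℝ (Fin m)) M] [TopologicalSpace N]
    [ChartedSpace (EuclideanSpace ℝ (Fin n)) N]
    (p : W → M) (q : W → N) (O : Opens W) : Set (VField d W) :=
  {Z | ∃ ξ ζ : VField d W, ξ.SmoothOn O ∧ ζ.SmoothOn O ∧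
    (∀ y ∈ O, mfderiv (𝓡 d) (𝓡 m) p y (ξ y) = 0) ∧
    (∀ y ∈ O, mfderiv (𝓡 d) (𝓡 n) q y (ζ y) = 0) ∧
    ∀ y ∈ O, Z y = ξ y + ζ y}

/-- Bi-submersions `(M, F_M) ← W → (N, F_N)` for `W` of pure dimension `d`. -/
structure IsPureBiSubmersion (FM : SingularFoliation m M) (FN : SingularFoliation n N)
    (p : W → M) (q : W → N) : Prop where
  smooth_left : ContMDiff (𝓡 d) (𝓡 m) ∞ p
  smooth_right : ContMDiff (𝓡 d) (𝓡 n) ∞ q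
  submersion_left : ∀ w, Function.Surjective (mfderiv (𝓡 d) (𝓡 m) p w)
  submersion_right : ∀ w, Function.Surjective (mfderiv (𝓡 d) (𝓡 n) q w)
  pullback_eq : ∀ O : Opens W, pullbackSec (d := d) FM p O = pullbackSec (d := d) FN q O
  pullback_eq_kerSum : ∀ O : Opens W, pullbackSec (d := d) FM p O = kerSumSec (d := d) m n p q O

/-- An anchored bundle of rank `r` over `F`: a smooth vector bundle `E → M` of rank `r` with a smooth
vector bundle morphism `ρ : E → TM` over the identity such that `ρ(Γ(E)) = F` (as sheaves). -/
structure AnchoredBundle (F : SingularFoliation m M) (r : ℕ) where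
  E : M → Type v
  [topTotal : TopologicalSpace (Bundle.TotalSpace (EuclideanSpace ℝ (Fin r)) E)]
  [addCommGroup : ∀ x, AddCommGroup (E x)]
  [module : ∀ x, Module ℝ (E x)]
  [top : ∀ x, TopologicalSpace (E x)]
  [fiberBundle : FiberBundle (EuclideanSpace ℝ (Fin r)) E]
  [vectorBundle : VectorBundle ℝ (EuclideanSpace ℝ (Fin r)) E]
  [smoothBundle : ContMDiffVectorBundle ∞ (EuclideanSpace ℝ (Fin r)) E (𝓡 m)]
  ρ : ∀ x, E x →ₗ[ℝ] TangentSpace (𝓡 m) x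
  smooth_anchor : ContMDiff ((𝓡 m).prod 𝓘(ℝ, EuclideanSpace ℝ (Fin r))) (𝓡 m).tangent ∞
    (fun e : Bundle.TotalSpace (EuclideanSpace ℝ (Fin r)) E =>
      (⟨e.1, ρ e.1 e.2⟩ : TangentBundle (𝓡 m) M))
  image_eq : ∀ (U : Opens M) (X : VField m M), X ∈ F.sec U ↔
    ∃ e : ∀ x, E x,
      ContMDiffOn (𝓡 m) ((𝓡 m).prod 𝓘(ℝ, EuclideanSpace ℝ (Fin r))) ∞
        (fun x => (⟨x, e x⟩ : Bundle.TotalSpace (EuclideanSpace ℝ (Fin r)) E)) (U : Set M) ∧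
      ∀ x ∈ U, X x = ρ x (e x)

end Pure

/-! ### Manifolds whose connected components may have different dimensions -/

/-- A smooth (Hausdorff, second countable) manifold, not necessarily connected, whose connected
components need not have the same dimension: it is the disjoint union of its parts of pure dimension
`0, 1, 2, …`, each of which may be empty. -/
structure MixedManifold : Type (u + 1) where
  /-- the union of the connected components of dimension `d` -/
  part : ℕ → Type u
  [top : ∀ d, TopologicalSpace (part d)]
  [charted : ∀ d, ChartedSpace (EuclideanSpace ℝ (Fin d)) (part d)]
  [smooth : ∀ d, IsManifold (𝓡 d) ∞ (part d)]
  [t2 : ∀ d, T2Space (part d)]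
  [secondCountable : ∀ d, SecondCountableTopology (part d)]

namespace MixedManifold

attribute [instance] top charted smooth t2 secondCountable

/-- The points of the manifold, with the topology of the disjoint union. -/
abbrev Pt (W : MixedManifold.{u}) : Type u := Σ d, W.part d

/-- Near the point `x`, the map `f` is given by `g`, which is smooth at `x`. -/
def IsLocalRep {V W : MixedManifold.{u}} (f : V.Pt → W.Pt) {e d : ℕ} (x : V.part e)
    (g : V.part e → W.part d) : Prop :=
  ContMDiffAt (𝓡 e) (𝓡 d) ∞ g x ∧ ∀ᶠ y in 𝓝 x, f ⟨e, y⟩ = ⟨d, g y⟩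

/-- Smooth maps with surjective differential at every point. -/
def IsSubmersion {V W : MixedManifold.{u}} (f : V.Pt → W.Pt) : Prop :=
  ∀ (e : ℕ) (x : V.part e), ∃ (d : ℕ) (g : V.part e → W.part d),
    IsLocalRep f x g ∧ Function.Surjective (mfderiv (𝓡 e) (𝓡 d) g x)

/-- Smooth maps with injective differential at every point that are homeomorphisms onto their image;
their images are the (embedded) submanifolds. -/
def IsSmoothEmbedding {V W : MixedManifold.{u}} (f : V.Pt → W.Pt) : Prop :=
  Topology.IsEmbedding f ∧ ∀ (e : ℕ) (x : V.part e), ∃ (d : ℕ) (g : V.part e → W.part d),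
    IsLocalRep f x g ∧ Function.Injective (mfderiv (𝓡 e) (𝓡 d) g x)

/-- All connected components of `W` have dimension `k`. -/
def IsPureOfDim (W : MixedManifold.{u}) (k : ℕ) : Prop :=
  ∀ d, d ≠ k → IsEmpty (W.part d)

/-- All connected components of `W` have dimension at least `k`. -/
def DimAtLeast (W : MixedManifold.{u}) (k : ℕ) : Prop :=
  ∀ d, d < k → IsEmpty (W.part d)

end MixedManifold

section Mixed

variable {m n : ℕ}
  {M : Type*} [TopologicalSpace M] [ChartedSpace (EuclideanSpace ℝ (Fin m)) M]
  [IsManifold (𝓡 m) ∞ M]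
  {N : Type*} [TopologicalSpace N] [ChartedSpace (EuclideanSpace ℝ (Fin n)) N]
  [IsManifold (𝓡 n) ∞ N]

/-- Bi-submersions between `(M, F_M)` and `(N, F_N)`. All conditions are local on `W`, so they are
required on each part of pure dimension. -/
def IsBiSubmersion (FM : SingularFoliation m M) (FN : SingularFoliation n N)
    (W : MixedManifold.{u}) (p : W.Pt → M) (q : W.Pt → N) : Prop :=
  ∀ d, IsPureBiSubmersion (d := d) FM FN (fun w : W.part d => p ⟨d, w⟩) (fun w => q ⟨d, w⟩)

/-- `W` and `W'`, with their maps to `M` and `N`, are equivalent: there are a manifold `V` and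
surjective submersions `δ : V → W`, `η : V → W'` with `p ∘ δ = p' ∘ η` and `q ∘ δ = q' ∘ η`. -/
def AreEquivalent {M N : Type*} (W : MixedManifold.{u}) (p : W.Pt → M) (q : W.Pt → N)
    (W' : MixedManifold.{u}) (p' : W'.Pt → M) (q' : W'.Pt → N) : Prop :=
  ∃ (V : MixedManifold.{u}) (δ : V.Pt → W.Pt) (η : V.Pt → W'.Pt),
    MixedManifold.IsSubmersion δ ∧ Function.Surjective δ ∧
    MixedManifold.IsSubmersion η ∧ Function.Surjective η ∧
    p ∘ δ = p' ∘ η ∧ q ∘ δ = q' ∘ η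

/-- `W` contains a submanifold all of whose connected components have dimension `k` and which, with
the restrictions of `p` and `q`, is a bi-submersion equivalent to `W`. -/
def ReducesToDim (FM : SingularFoliation m M) (FN : SingularFoliation n N)
    (W : MixedManifold.{u}) (p : W.Pt → M) (q : W.Pt → N) (k : ℕ) : Prop :=
  ∃ (W' : MixedManifold.{u}) (ι : W'.Pt → W.Pt),
    MixedManifold.IsSmoothEmbedding ι ∧ W'.IsPureOfDim k ∧
    IsBiSubmersion FM FN W' (p ∘ ι) (q ∘ ι) ∧
    AreEquivalent W' (p ∘ ι) (q ∘ ι) W p q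

end Mixed

/-! Let w be a point of a component of W of dimension d, and let K_w be the space of values at w of
vector fields near w that are tangent both to the fibres of p and to those of q. The equation
p⁻¹(F_M) = Γ(ker Tp) + Γ(ker Tq) says that Tp maps the fields tangent to the fibres of q onto the
module generated along p by F_M. On values, this identifies ker T_w q / K_w with the fibre of F_M at
p(w), whose dimension is the minimal number of generators. Hence d - dim N - dim K_w is the rank of
F_M at p(w), and symmetrically d - dim M - dim K_w is the rank of F_N at q(w). So rk_{p(w)} F_M +
dim N = rk_{q(w)} F_N + dim M ≤ d (`rkAt_add_eq`, `rkAt_add_le`). If p and q are onto, comparison at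
points where the two global ranks are attained gives κ = rk F_M + dim N = rk F_N + dim M, hence
statement 1. In general the local number rk_{p(w)} F_M + dim N is at most κ, and it is at most rk E
+ dim N because a local frame of E generates F_M.

Statements 2 and 3 thus become one: if the local number is at most k everywhere and all components
have dimension at least k, then W reduces to dimension k (`IsBiSubmersion.reducesToDim`). Where d >
k there are d - k independent fields tangent to both families of fibres. Flowing along them gives
charts A × B, with A = ℝᵏ, in which p and q depend on A alone (`exists_isSliced`). An open piece of
a slice A × {b} is a retract of an open set by a submersion compatible with p and q, so it is again
a bi-submersion, and two points of one fibre {s} × B are linked by a correspondence. Therefore W'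
can be a union of open discs in slices, together with the components of dimension k, provided that
each point of W can be moved along a chart fibre into the tube over some disc.

The difficulty is global: the closed discs must be disjoint and locally finite, so that the union is
embedded, and still numerous enough. A locally finite family of boxes is well-ordered, and each box
receives finitely many discs that avoid all earlier ones (`exists_disjoint_cells`). This works if
each relevant fibre of a box meets an earlier tube or has a point off the earlier closed discs, near
which a new disc fits. Otherwise, by Baire, some segment of the fibre lies in the boundary sphere of
one disc (`exists_mem_tube_or_notMem`). But a curve on a sphere of radius ρ satisfies ‖v‖² ≤ ρ ‖u‖
for its velocity v and acceleration u, which compactness excludes for small radii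
(`exists_radius_of_thin`). -/

section Superposition

/-! ### Smoothness of superposition operators on spaces of continuous maps -/

variable {K : Type*} [TopologicalSpace K] [CompactSpace K]
  {E F : Type v} [NormedAddCommGroup E] [NormedSpace ℝ E] [NormedAddCommGroup F] [NormedSpace ℝ F]

/-- Pointwise application of a continuous family of continuous linear maps. -/
noncomputable def ContinuousMap.pointwiseApply :
    C(K, E →L[ℝ] F) →L[ℝ] C(K, E) →L[ℝ] C(K, F) :=
  LinearMap.mkContinuous₂
    (LinearMap.mk₂ ℝ (fun (L : C(K, E →L[ℝ] F)) (h : C(K, E)) =>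
        (⟨fun t => L t (h t), by fun_prop⟩ : C(K, F)))
      (fun _ _ _ => by ext; simp) (fun _ _ _ => by ext; simp)
      (fun _ _ _ => by ext; simp) (fun _ _ _ => by ext; simp)) 1
    (fun L h => by
      rw [one_mul]
      refine (ContinuousMap.norm_le _ (by positivity)).2 fun t => ?_
      exact (L t).le_of_opNorm_le_of_le (L.norm_coe_le_norm t) (h.norm_coe_le_norm t))

@[simp] theorem ContinuousMap.pointwiseApply_apply (L : C(K, E →L[ℝ] F)) (h : C(K, E)) (t : K) :
    ContinuousMap.pointwiseApply L h t = L t (h t) := rfl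

/-- The mean value inequality is applied at each point of K. The estimate is uniform over K because
`γ ↦ f'.comp γ` is continuous for the sup norm. -/
theorem ContinuousMap.hasFDerivAt_comp_left (f : C(E, F)) (f' : C(E, E →L[ℝ] F))
    (hf : ∀ x, HasFDerivAt f (f' x) x) (γ : C(K, E)) :
    HasFDerivAt (fun γ : C(K, E) => f.comp γ) (ContinuousMap.pointwiseApply (f'.comp γ)) γ := by
  rw [hasFDerivAt_iff_isLittleO_nhds_zero, Asymptotics.isLittleO_iff]
  intro ε hε
  have hc : Continuous fun γ : C(K, E) => f'.comp γ := ContinuousMap.continuous_postcomp f'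
  obtain ⟨δ, hδ, h⟩ := (Metric.continuous_iff (f := fun γ : C(K, E) => f'.comp γ)).1 hc γ ε hε
  filter_upwards [Metric.ball_mem_nhds (0 : C(K, E)) hδ] with g hg
  refine (ContinuousMap.norm_le _ (by positivity)).2 fun t => ?_
  have hg' : ‖g‖ < δ := by simpa using hg
  have key := (convex_ball (γ t) δ).norm_image_sub_le_of_norm_hasFDerivWithin_le'
    (f := f) (f' := f') (φ := f' (γ t)) (C := ε) (x := γ t) (y := γ t + g t)
    (fun x _ => (hf x).hasFDerivWithinAt) (fun x hx => ?_) (by simpa using hδ) (by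
      simpa using (g.norm_coe_le_norm t).trans_lt hg')
  · rw [add_sub_cancel_left] at key
    exact key.trans (by gcongr; exact g.norm_coe_le_norm t)
  -- The translate of γ by the constant x - γ t takes the value x at t, so the single δ obtained for
  -- paths bounds the oscillation of `f'` around every γ t.
  · have h2 := h (γ + ContinuousMap.const K (x - γ t)) (by
      rw [dist_eq_norm, add_sub_cancel_left]
      refine (ContinuousMap.norm_lt_iff _ hδ).2 fun _ => ?_
      simpa [dist_eq_norm] using hx)
    have h3 := (ContinuousMap.dist_apply_le_dist (f := f'.comp (γ + ContinuousMap.const K (x - γ t)))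
      (g := f'.comp γ) t).trans h2.le
    simpa [dist_eq_norm] using h3

/-- The derivative is a continuous linear map applied to the superposition operator of `fderiv ℝ f`,
so induction on the order applies. The target changes from F to `E →L[ℝ] F` in the induction, which
is why E and F share a universe. -/
theorem ContinuousMap.contDiff_comp_left (f : C(E, F)) (hf : ContDiff ℝ ∞ f) :
    ContDiff ℝ ∞ fun γ : C(K, E) => f.comp γ := by
  refine contDiff_infty.2 fun n => ?_
  induction n generalizing F with
  | zero => exact contDiff_zero.2 (ContinuousMap.continuous_postcomp f)
  | succ n ih =>
    have hd : ContDiff ℝ ∞ (fderiv ℝ f) := hf.fderiv_right (m := ∞) (by simp)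
    let f' : C(E, E →L[ℝ] F) := ⟨fderiv ℝ f, hd.continuous⟩
    have hder : ∀ γ : C(K, E), HasFDerivAt (fun γ : C(K, E) => f.comp γ)
        (ContinuousMap.pointwiseApply (f'.comp γ)) γ := fun γ =>
      ContinuousMap.hasFDerivAt_comp_left f f'
        (fun x => (hf.differentiable (by simp) x).hasFDerivAt) γ
    rw [show ((n + 1 : ℕ) : WithTop ℕ∞) = (n : WithTop ℕ∞) + 1 by norm_cast]
    refine (contDiff_succ_iff_fderiv (n := n)).2 ⟨fun γ => (hder γ).differentiableAt, by simp, ?_⟩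
    have : fderiv ℝ (fun γ : C(K, E) => f.comp γ) =
        fun γ => ContinuousMap.pointwiseApply (f'.comp γ) := funext fun γ => (hder γ).fderiv
    rw [this]
    exact ContinuousMap.pointwiseApply.contDiff.comp (ih f' hd)

theorem ContinuousMap.contDiff_pointwiseApply_comp_left {Λ : Type v} [NormedAddCommGroup Λ]
    [NormedSpace ℝ Λ] (f : C(E, Λ →L[ℝ] F)) (hf : ContDiff ℝ ∞ f) :
    ContDiff ℝ ∞ fun γ : C(K, E) => ContinuousMap.pointwiseApply (f.comp γ) :=
  (ContinuousMap.pointwiseApply (K := K) (E := Λ) (F := F)).contDiff.comp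
    (ContinuousMap.contDiff_comp_left f hf)

end Superposition

/-! ### The inverse function theorem with an inverse that is smooth on its whole domain -/

section InverseFunction

variable {E F : Type*} [NormedAddCommGroup E] [NormedSpace ℝ E] [CompleteSpace E]
  [NormedAddCommGroup F] [NormedSpace ℝ F]

/-- The inverse function theorem for a map that is smooth near a point, with a local inverse that is
smooth on its whole domain. -/
theorem exists_openPartialHomeomorph_of_smooth {f : E → F} {f' : E ≃L[ℝ] F} {a : E}
    (hf : ∀ᶠ x in 𝓝 a, ContDiffAt ℝ ∞ f x) (hf' : HasFDerivAt f (f' : E →L[ℝ] F) a)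
    {s : Set E} (hs : s ∈ 𝓝 a) :
    ∃ Φ : OpenPartialHomeomorph E F, a ∈ Φ.source ∧ Φ.source ⊆ s ∧ (Φ : E → F) = f ∧
      (∀ x ∈ Φ.source, ContDiffAt ℝ ∞ f x) ∧ ∀ y ∈ Φ.target, ContDiffAt ℝ ∞ Φ.symm y := by
  have hfa : ContDiffAt ℝ ∞ f a := hf.self_of_nhds
  set Φ := hfa.toOpenPartialHomeomorph f hf' (by simp) with hΦ
  have hcoe : (Φ : E → F) = f := rfl
  have haΦ : a ∈ Φ.source := hfa.mem_toOpenPartialHomeomorph_source hf' (by simp)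
  -- Invertibility of the derivative is an open condition. After restriction it holds on the whole
  -- source, which makes the inverse smooth at every point of the target and not only at the image
  -- of a.
  have hinv : ∀ᶠ x in 𝓝 a, fderiv ℝ f x ∈ Set.range ((↑) : (E ≃L[ℝ] F) → E →L[ℝ] F) := by
    have hc : ContinuousAt (fderiv ℝ f) a :=
      (hfa.fderiv_right (m := 0) (by simp)).continuousAt
    refine hc.eventually_mem (ContinuousLinearEquiv.isOpen.mem_nhds ?_)
    exact ⟨f', hf'.fderiv.symm⟩
  obtain ⟨U, hU, hUo, haU⟩ := eventually_nhds_iff.1 (hf.and (hinv.and hs))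
  refine ⟨Φ.restrOpen U hUo, by simp [haΦ, haU], ?_, by simp [hcoe], ?_, ?_⟩
  · intro x hx
    simp only [OpenPartialHomeomorph.restrOpen_source] at hx
    exact (hU x hx.2).2.2
  · intro x hx
    simp only [OpenPartialHomeomorph.restrOpen_source] at hx
    exact (hU x hx.2).1
  · intro y hy
    set Φ' := Φ.restrOpen U hUo
    have hx : Φ'.symm y ∈ Φ'.source := Φ'.map_target hy
    have hxU : Φ'.symm y ∈ U := by
      simp only [Φ', OpenPartialHomeomorph.restrOpen_source] at hx
      exact hx.2
    obtain ⟨e, he⟩ := (hU _ hxU).2.1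
    have hd : HasFDerivAt Φ' (e : E →L[ℝ] F) (Φ'.symm y) := by
      rw [he]
      exact ((hU _ hxU).1.differentiableAt (by simp)).hasFDerivAt
    exact Φ'.contDiffAt_symm hy hd (hU _ hxU).1

end InverseFunction

/-! ### Smooth dependence of flows on initial point and parameter -/

section Flow

open Set

variable {E Λ : Type v} [NormedAddCommGroup E] [NormedSpace ℝ E]
  [NormedAddCommGroup Λ] [NormedSpace ℝ Λ]

/-- The primitive vanishing at `0` of a continuous function on `[0, 1]`. -/
noncomputable def ContinuousMap.primitive : C(Icc (0 : ℝ) 1, E) →L[ℝ] C(Icc (0 : ℝ) 1, E) :=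
  LinearMap.mkContinuous
    { toFun := fun g =>
        ⟨fun t => ∫ s in (0 : ℝ)..t, Set.IccExtend zero_le_one g s, by
          have hc : Continuous (Set.IccExtend (zero_le_one (α := ℝ)) g) := g.continuous.Icc_extend'
          have := intervalIntegral.continuous_primitive
            (fun a b => hc.intervalIntegrable (μ := MeasureTheory.volume) a b) 0
          exact this.comp continuous_subtype_val⟩
      map_add' := fun g h => by
        ext t
        have hg : Continuous (Set.IccExtend (zero_le_one (α := ℝ)) g) := g.continuous.Icc_extend'
        have hh : Continuous (Set.IccExtend (zero_le_one (α := ℝ)) h) := h.continuous.Icc_extend'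
        simp only [ContinuousMap.coe_mk, ContinuousMap.add_apply]
        rw [← intervalIntegral.integral_add (hg.intervalIntegrable _ _) (hh.intervalIntegrable _ _)]
        rfl
      map_smul' := fun c g => by
        ext t
        simp only [ContinuousMap.coe_mk, RingHom.id_apply, ContinuousMap.smul_apply]
        rw [← intervalIntegral.integral_smul]
        rfl } 1
    (fun g => by
      rw [one_mul]
      refine (ContinuousMap.norm_le _ (norm_nonneg _)).2 fun t => ?_
      refine (intervalIntegral.norm_integral_le_of_norm_le_const (C := ‖g‖)
        fun s _ => g.norm_coe_le_norm _).trans ?_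
      have h1 : |(t : ℝ) - 0| ≤ 1 := by
        rw [sub_zero, abs_of_nonneg t.2.1]; exact t.2.2
      exact mul_le_of_le_one_right (norm_nonneg _) h1)

theorem ContinuousMap.primitive_apply (g : C(Icc (0 : ℝ) 1, E)) (t : Icc (0 : ℝ) 1) :
    ContinuousMap.primitive g t = ∫ s in (0 : ℝ)..t, Set.IccExtend zero_le_one g s := rfl

theorem ContinuousMap.hasDerivAt_primitive [CompleteSpace E] (g : C(Icc (0 : ℝ) 1, E)) (t : ℝ) :
    HasDerivAt (fun t : ℝ => ∫ s in (0 : ℝ)..t, Set.IccExtend zero_le_one g s)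
      (Set.IccExtend zero_le_one g t) t := by
  have hg : Continuous (Set.IccExtend (zero_le_one (α := ℝ)) g) := g.continuous.Icc_extend'
  exact intervalIntegral.integral_hasDerivAt_right (hg.intervalIntegrable _ _)
    (hg.stronglyMeasurableAtFilter _ _) hg.continuousAt

/-- Constant functions on `[0, 1]`. -/
noncomputable def ContinuousMap.constLin : E →L[ℝ] C(Icc (0 : ℝ) 1, E) :=
  LinearMap.mkContinuous
    { toFun := fun x => ContinuousMap.const _ x
      map_add' := fun _ _ => rfl
      map_smul' := fun _ _ => rfl } 1
    (fun x => by
      rw [one_mul]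
      exact (ContinuousMap.norm_le _ (norm_nonneg _)).2 fun t => le_rfl)

@[simp] theorem ContinuousMap.constLin_apply (x : E) (t : Icc (0 : ℝ) 1) :
    ContinuousMap.constLin x t = x := rfl

/-- Evaluation at the end point of `[0, 1]`. -/
noncomputable def ContinuousMap.evalOne : C(Icc (0 : ℝ) 1, E) →L[ℝ] E :=
  LinearMap.mkContinuous
    { toFun := fun g => g 1
      map_add' := fun _ _ => rfl
      map_smul' := fun _ _ => rfl } 1
    (fun g => by rw [one_mul]; exact g.norm_coe_le_norm 1)

@[simp] theorem ContinuousMap.evalOne_apply (g : C(Icc (0 : ℝ) 1, E)) :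
    ContinuousMap.evalOne g = g 1 := rfl

/-- Smooth dependence of the time-one flow of the vector fields `x ↦ Z x l` on `x` and the
parameter `l`, near `l = 0`. -/
theorem exists_smooth_flow [CompleteSpace E] [CompleteSpace Λ] (Z : E → Λ →L[ℝ] E) (hZ : ContDiff ℝ ∞ Z) (x₀ : E) :
    ∃ Fl : E × Λ → E, (∀ᶠ a in 𝓝 (x₀, (0 : Λ)), ContDiffAt ℝ ∞ Fl a) ∧ Fl (x₀, 0) = x₀ ∧
      HasFDerivAt Fl (ContinuousLinearMap.fst ℝ E Λ + (Z x₀) ∘L ContinuousLinearMap.snd ℝ E Λ)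
        (x₀, 0) ∧
      ∀ U ∈ 𝓝 x₀, ∀ᶠ a in 𝓝 (x₀, (0 : Λ)), ∃ γ : ℝ → E, γ 0 = a.1 ∧ γ 1 = Fl a ∧
        ∀ t ∈ Icc (0 : ℝ) 1, γ t ∈ U ∧ HasDerivAt γ (Z (γ t) a.2) t := by
  let Zc : C(E, Λ →L[ℝ] E) := ⟨Z, hZ.continuous⟩
  let rhs : (E × Λ) × C(Icc (0 : ℝ) 1, E) → C(Icc (0 : ℝ) 1, E) := fun b =>
    ContinuousMap.constLin b.1.1 +
      ContinuousMap.primitive (ContinuousMap.pointwiseApply (Zc.comp b.2) (ContinuousMap.constLin b.1.2))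
  have hB : ContDiff ℝ ∞ fun b : (E × Λ) × C(Icc (0 : ℝ) 1, E) =>
      ContinuousMap.pointwiseApply (Zc.comp b.2) :=
    (ContinuousMap.contDiff_pointwiseApply_comp_left Zc hZ).comp contDiff_snd
  have hrhs : ContDiff ℝ ∞ rhs := by
    have h2 : ContDiff ℝ ∞ fun b : (E × Λ) × C(Icc (0 : ℝ) 1, E) =>
        (ContinuousMap.constLin b.1.2 : C(Icc (0 : ℝ) 1, Λ)) :=
      (ContinuousMap.constLin (E := Λ)).contDiff.comp (contDiff_snd.comp contDiff_fst)
    have h3 : ContDiff ℝ ∞ fun b : (E × Λ) × C(Icc (0 : ℝ) 1, E) =>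
        (ContinuousMap.constLin b.1.1 : C(Icc (0 : ℝ) 1, E)) :=
      (ContinuousMap.constLin (E := E)).contDiff.comp (contDiff_fst.comp contDiff_fst)
    exact h3.add ((ContinuousMap.primitive (E := E)).contDiff.comp (hB.clm_apply h2))
  -- The equation Φ b = (b.1, 0) is the integral equation of the flow on [0, 1]. The time interval
  -- can stay fixed because smallness is imposed on the parameter instead of the time.
  let Φ : (E × Λ) × C(Icc (0 : ℝ) 1, E) → (E × Λ) × C(Icc (0 : ℝ) 1, E) := fun b => (b.1, b.2 - rhs b)
  have hΦ : ContDiff ℝ ∞ Φ := contDiff_fst.prodMk (contDiff_snd.sub hrhs)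
  let b₀ : (E × Λ) × C(Icc (0 : ℝ) 1, E) := ((x₀, 0), ContinuousMap.constLin x₀)
  have hb₀ : Φ b₀ = ((x₀, 0), 0) := by
    refine Prod.ext rfl ?_
    simp [Φ, rhs, b₀]
  -- the derivative of `rhs` at the constant solution
  let D : E × Λ →L[ℝ] C(Icc (0 : ℝ) 1, E) := ContinuousMap.constLin ∘L ContinuousLinearMap.fst ℝ E Λ +
    ContinuousMap.primitive ∘L ContinuousMap.constLin ∘L (Z x₀) ∘L ContinuousLinearMap.snd ℝ E Λ
  have hD : HasFDerivAt rhs (D ∘L ContinuousLinearMap.fst ℝ (E × Λ) C(Icc (0 : ℝ) 1, E)) b₀ := by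
    have h2 : HasFDerivAt (fun b : (E × Λ) × C(Icc (0 : ℝ) 1, E) => (ContinuousMap.constLin b.1.2 : C(Icc (0 : ℝ) 1, Λ)))
        (ContinuousMap.constLin ∘L ContinuousLinearMap.snd ℝ E Λ ∘L
          ContinuousLinearMap.fst ℝ (E × Λ) C(Icc (0 : ℝ) 1, E)) b₀ :=
      ContinuousLinearMap.hasFDerivAt (ContinuousMap.constLin (E := Λ) ∘L ContinuousLinearMap.snd ℝ E Λ ∘L
          ContinuousLinearMap.fst ℝ (E × Λ) C(Icc (0 : ℝ) 1, E))
    have h3 : HasFDerivAt (fun b : (E × Λ) × C(Icc (0 : ℝ) 1, E) => (ContinuousMap.constLin b.1.1 : C(Icc (0 : ℝ) 1, E)))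
        (ContinuousMap.constLin ∘L ContinuousLinearMap.fst ℝ E Λ ∘L
          ContinuousLinearMap.fst ℝ (E × Λ) C(Icc (0 : ℝ) 1, E)) b₀ :=
      ContinuousLinearMap.hasFDerivAt (ContinuousMap.constLin (E := E) ∘L ContinuousLinearMap.fst ℝ E Λ ∘L
          ContinuousLinearMap.fst ℝ (E × Λ) C(Icc (0 : ℝ) 1, E))
    have h4 := h3.add (HasFDerivAt.comp (g := ContinuousMap.primitive (E := E)) b₀
      (ContinuousMap.primitive (E := E)).hasFDerivAt ((hB.differentiable (by simp) b₀).hasFDerivAt.clm_apply h2))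
    refine h4.congr_fderiv ?_
    ext b t <;> simp [D, b₀, Zc, ContinuousMap.primitive_apply]
    rfl
  -- At parameter 0 the integrand vanishes for every path, so the right-hand side does not depend on
  -- the path to first order. The derivative of Φ is therefore unipotent, with inverse obtained by
  -- changing the sign of D.
  let e : ((E × Λ) × C(Icc (0 : ℝ) 1, E)) ≃L[ℝ] ((E × Λ) × C(Icc (0 : ℝ) 1, E)) :=
    ContinuousLinearEquiv.equivOfInverse
      ((ContinuousLinearMap.fst ℝ (E × Λ) C(Icc (0 : ℝ) 1, E)).prod
        (ContinuousLinearMap.snd ℝ (E × Λ) C(Icc (0 : ℝ) 1, E) - D ∘L ContinuousLinearMap.fst ℝ (E × Λ) C(Icc (0 : ℝ) 1, E)))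
      ((ContinuousLinearMap.fst ℝ (E × Λ) C(Icc (0 : ℝ) 1, E)).prod
        (ContinuousLinearMap.snd ℝ (E × Λ) C(Icc (0 : ℝ) 1, E) + D ∘L ContinuousLinearMap.fst ℝ (E × Λ) C(Icc (0 : ℝ) 1, E)))
      (fun b => by simp) (fun b => by simp)
  have he : HasFDerivAt Φ (e : (E × Λ) × C(Icc (0 : ℝ) 1, E) →L[ℝ] (E × Λ) × C(Icc (0 : ℝ) 1, E)) b₀ :=
    hasFDerivAt_fst.prodMk (hasFDerivAt_snd.sub hD)
  obtain ⟨Ψ, hΨb, -, hΨ, -, hΨs⟩ := exists_openPartialHomeomorph_of_smooth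
    (Filter.Eventually.of_forall fun b => hΦ.contDiffAt) he Filter.univ_mem
  let j : E × Λ → (E × Λ) × C(Icc (0 : ℝ) 1, E) := fun a => (a, 0)
  have hjc : Continuous j := by fun_prop
  have hj : ContDiff ℝ ∞ j := contDiff_id.prodMk contDiff_const
  have hj₀ : j (x₀, 0) = Φ b₀ := hb₀.symm
  have htar : Φ b₀ ∈ Ψ.target := by rw [← hΨ]; exact Ψ.map_source hΨb
  have hsymm₀ : Ψ.symm (Φ b₀) = b₀ := by rw [← hΨ]; exact Ψ.left_inv hΨb
  have hev : ∀ᶠ a in 𝓝 (x₀, (0 : Λ)), j a ∈ Ψ.target :=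
    hjc.continuousAt.eventually_mem (by rw [hj₀]; exact Ψ.open_target.mem_nhds htar)
  refine ⟨fun a => ContinuousMap.evalOne (Ψ.symm (j a)).2, ?_, ?_, ?_, ?_⟩
  · filter_upwards [hev] with a ha
    exact ContinuousMap.evalOne.contDiff.contDiffAt.comp a
      (contDiff_snd.contDiffAt.comp a ((hΨs _ ha).comp a hj.contDiffAt))
  · simp only [hj₀, hsymm₀]
    rfl
  · have hsd : HasFDerivAt Ψ.symm (e.symm : (E × Λ) × C(Icc (0 : ℝ) 1, E) →L[ℝ] (E × Λ) × C(Icc (0 : ℝ) 1, E))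
        (j (x₀, 0)) := by
      rw [hj₀]
      refine Ψ.hasFDerivAt_symm htar ?_
      rw [hsymm₀, hΨ]
      exact he
    have hjd : HasFDerivAt j (ContinuousLinearMap.inl ℝ (E × Λ) C(Icc (0 : ℝ) 1, E)) (x₀, 0) :=
      (hasFDerivAt_id _).prodMk (hasFDerivAt_const _ _)
    have h5 := ContinuousMap.evalOne.hasFDerivAt.comp (x₀, (0 : Λ))
      (hasFDerivAt_snd.comp (x₀, (0 : Λ)) (hsd.comp (x₀, (0 : Λ)) hjd))
    refine h5.congr_fderiv ?_
    ext a
    · change (0 + (ContinuousMap.constLin a + ContinuousMap.primitive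
        (ContinuousMap.constLin (Z x₀ (0 : Λ)))) : C(Icc (0 : ℝ) 1, E)) 1 = a + Z x₀ 0
      simp
    · have : ∀ y : E, ContinuousMap.primitive (ContinuousMap.constLin y) 1 = y := fun y => by
        rw [ContinuousMap.primitive_apply]
        have : Set.IccExtend (zero_le_one (α := ℝ)) (ContinuousMap.constLin y) = fun _ => y := rfl
        rw [this]
        simp
      change (0 + (ContinuousMap.constLin (0 : E) + ContinuousMap.primitive
        (ContinuousMap.constLin (Z x₀ a))) : C(Icc (0 : ℝ) 1, E)) 1 = 0 + Z x₀ a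
      simp [this]
  · intro U hU
    obtain ⟨ε, hε, hεU⟩ := Metric.mem_nhds_iff.1 hU
    have hcont : ContinuousAt (fun a => (Ψ.symm (j a)).2) (x₀, (0 : Λ)) :=
      continuousAt_snd.comp (((hΨs _ (by rw [hj₀]; exact htar)).continuousAt).comp
        hjc.continuousAt)
    have hball : ∀ᶠ a in 𝓝 (x₀, (0 : Λ)), (Ψ.symm (j a)).2 ∈
        Metric.ball (ContinuousMap.constLin x₀ : C(Icc (0 : ℝ) 1, E)) ε := by
      refine hcont.eventually_mem ?_
      simp only [hj₀, hsymm₀]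
      exact Metric.ball_mem_nhds _ hε
    filter_upwards [hev, hball] with a ha hab
    set g : C(Icc (0 : ℝ) 1, E) := (Ψ.symm (j a)).2 with hg
    have hsol : Φ (Ψ.symm (j a)) = j a := by rw [← hΨ]; exact Ψ.right_inv ha
    have h1 : (Ψ.symm (j a)).1 = a := congrArg Prod.fst hsol
    have h2 : g = rhs (a, g) := by
      have : g - rhs (Ψ.symm (j a)) = 0 := congrArg Prod.snd hsol
      have h3 : Ψ.symm (j a) = (a, g) := Prod.ext h1 rfl
      rw [h3] at this
      exact sub_eq_zero.1 this
    let G : C(Icc (0 : ℝ) 1, E) := ContinuousMap.pointwiseApply (Zc.comp g) (ContinuousMap.constLin a.2)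
    let γ : ℝ → E := fun t => a.1 + ∫ s in (0 : ℝ)..t, Set.IccExtend zero_le_one G s
    have hγ : ∀ t (ht : t ∈ Icc (0 : ℝ) 1), γ t = g ⟨t, ht⟩ := fun t ht => by
      conv_rhs => rw [h2]
      rfl
    refine ⟨γ, by simp [γ], ?_, fun t ht => ⟨?_, ?_⟩⟩
    · rw [hγ 1 ⟨zero_le_one, le_rfl⟩]
      rfl
    · rw [hγ t ht]
      refine hεU ?_
      have := (ContinuousMap.dist_apply_le_dist (f := g) (g := ContinuousMap.constLin x₀)
        ⟨t, ht⟩).trans_lt hab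
      exact this
    · have h3 := (ContinuousMap.hasDerivAt_primitive G t).const_add a.1
      have h4 : Set.IccExtend (zero_le_one (α := ℝ)) G t = Z (γ t) a.2 := by
        rw [Set.IccExtend_of_mem _ _ ht, hγ t ht]
        rfl
      rw [h4] at h3
      exact h3

end Flow

/-! ### Coordinates adapted to fields along which a map is constant -/

section Straightening

variable {E F : Type} [NormedAddCommGroup E] [NormedSpace ℝ E]
  [NormedAddCommGroup F] [NormedSpace ℝ F]

/-- A family of vector fields that is smooth near a point agrees near that point with a globally
defined smooth one. -/
theorem exists_contDiff_eventuallyEq [FiniteDimensional ℝ E] {G : Type*} [NormedAddCommGroup G] [NormedSpace ℝ G]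
    {g : E → G} {x₀ : E} (hg : ∀ᶠ y in 𝓝 x₀, ContDiffAt ℝ ∞ g y) :
    ∃ g' : E → G, ContDiff ℝ ∞ g' ∧ g' =ᶠ[𝓝 x₀] g := by
  obtain ⟨ε, hε, hball⟩ := Metric.eventually_nhds_iff_ball.1 hg
  let χ : ContDiffBump x₀ := ⟨ε / 4, ε / 2, by positivity, by linarith⟩
  refine ⟨fun y => χ y • g y, contDiff_iff_contDiffAt.2 fun y => ?_, ?_⟩
  · by_cases hy : y ∈ tsupport fun y => χ y • g y
    swap
    · exact contDiffAt_const.congr_of_eventuallyEq (notMem_tsupport_iff_eventuallyEq.1 hy)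
    have hy' : y ∈ tsupport χ := tsupport_smul_subset_left _ _ hy
    rw [χ.tsupport_eq] at hy'
    have : dist y x₀ ≤ ε / 2 := hy'
    exact χ.contDiffAt.smul (hball y (by rw [Metric.mem_ball]; linarith))
  · filter_upwards [χ.eventuallyEq_one] with y hy
    simp [hy]

theorem constant_along_of_fderiv_eq_zero {f : E → F} {γ : ℝ → E} {v : ℝ → E}
    (hγ : ∀ t ∈ Set.Icc (0 : ℝ) 1, HasDerivAt γ (v t) t)
    (hf : ∀ t ∈ Set.Icc (0 : ℝ) 1, DifferentiableAt ℝ f (γ t))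
    (h0 : ∀ t ∈ Set.Icc (0 : ℝ) 1, fderiv ℝ f (γ t) (v t) = 0) : f (γ 1) = f (γ 0) := by
  have hd : ∀ t ∈ Set.Icc (0 : ℝ) 1, HasDerivWithinAt (fun t => f (γ t)) 0 (Set.Icc 0 1) t := by
    intro t ht
    have := (hf t ht).hasFDerivAt.comp_hasDerivAt t (hγ t ht)
    rw [h0 t ht] at this
    exact this.hasDerivWithinAt
  exact constant_of_derivWithin_zero (fun t ht => (hd t ht).differentiableWithinAt)
    (fun t ht => (hd t (Set.Ico_subset_Icc_self ht)).derivWithin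
      (uniqueDiffOn_Icc zero_lt_one t (Set.Ico_subset_Icc_self ht))) 1 ⟨zero_le_one, le_rfl⟩

/-- Coordinates `(s, l)` adapted to pointwise independent vector fields `z c` along which `f` is
constant: in these coordinates, `f` does not depend on `l`. -/
theorem exists_straightening [FiniteDimensional ℝ E] {k l : ℕ} (hkl : Module.finrank ℝ E = k + l) {x₀ : E}
    {z : Fin l → E → E} (hz : ∀ c, ∀ᶠ y in 𝓝 x₀, ContDiffAt ℝ ∞ (z c) y)
    (hli : LinearIndependent ℝ fun c => z c x₀) {f : E → F}
    (hf : ∀ᶠ y in 𝓝 x₀, DifferentiableAt ℝ f y)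
    (hfz : ∀ c, ∀ᶠ y in 𝓝 x₀, fderiv ℝ f y (z c y) = 0) :
    ∃ Φ : OpenPartialHomeomorph (EuclideanSpace ℝ (Fin k) × EuclideanSpace ℝ (Fin l)) E,
      0 ∈ Φ.source ∧ Φ 0 = x₀ ∧ (∀ a ∈ Φ.source, ContDiffAt ℝ ∞ Φ a) ∧
      (∀ y ∈ Φ.target, ContDiffAt ℝ ∞ Φ.symm y) ∧
      ∀ᶠ a in 𝓝 (0 : EuclideanSpace ℝ (Fin k) × EuclideanSpace ℝ (Fin l)),
        f (Φ a) = f (Φ (a.1, 0)) := by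
  choose z' hz' hzz' using fun c => exists_contDiff_eventuallyEq (hz c)
  -- For each parameter v the flow follows the single field ∑ v_c z_c from time 0 to time 1, so the
  -- fields need not commute with each other.
  let Z : E → EuclideanSpace ℝ (Fin l) →L[ℝ] E := fun y =>
    ∑ c, (EuclideanSpace.proj c : EuclideanSpace ℝ (Fin l) →L[ℝ] ℝ).smulRight (z' c y)
  have hZ : ContDiff ℝ ∞ Z := ContDiff.sum fun c _ =>
    (ContinuousLinearMap.smulRightL ℝ (EuclideanSpace ℝ (Fin l)) E
      (EuclideanSpace.proj c)).contDiff.comp (hz' c)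
  have hZa : ∀ y v, Z y v = ∑ c, v c • z' c y := fun y v => by simp [Z]
  obtain ⟨Fl, hFl, hFl₀, hFl', hflow⟩ := exists_smooth_flow Z hZ x₀
  have hzx : ∀ c, z' c x₀ = z c x₀ := fun c => (hzz' c).self_of_nhds
  have hinj : Function.Injective (Z x₀) := by
    refine (injective_iff_map_eq_zero (Z x₀)).2 fun v hv => ?_
    rw [hZa] at hv
    simp only [hzx] at hv
    ext c
    exact Fintype.linearIndependent_iff.1 hli _ hv c
  -- The flow starts from a transversal, the translate to x₀ of a linear complement of the span of
  -- the fields. The derivative of the resulting parametrization at 0 is then an isomorphism.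
  obtain ⟨C, hC⟩ := Submodule.exists_isCompl (LinearMap.range (Z x₀).toLinearMap)
  have hrk : Module.finrank ℝ (LinearMap.range (Z x₀).toLinearMap) = l := by
    rw [LinearMap.finrank_range_of_inj hinj]; simp
  have hCk : Module.finrank ℝ C = k := by
    have := Submodule.finrank_add_eq_of_isCompl hC
    omega
  let ι₀ : EuclideanSpace ℝ (Fin k) ≃ₗ[ℝ] C := LinearEquiv.ofFinrankEq _ _ (by simp [hCk])
  let ι : EuclideanSpace ℝ (Fin k) →L[ℝ] E := LinearMap.toContinuousLinearMap (C.subtype ∘ₗ ι₀)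
  have hιa : ∀ s, ι s = (ι₀ s : E) := fun _ => rfl
  let D : EuclideanSpace ℝ (Fin k) × EuclideanSpace ℝ (Fin l) →L[ℝ] E := ι.coprod (Z x₀)
  have hDinj : Function.Injective D := by
    refine (injective_iff_map_eq_zero D).2 fun a ha => ?_
    have h1 : ι a.1 + Z x₀ a.2 = 0 := ha
    have h2 : ι a.1 = 0 := by
      have hm : ι a.1 ∈ LinearMap.range (Z x₀).toLinearMap :=
        ⟨-a.2, by simpa [eq_neg_iff_add_eq_zero, add_comm] using (eq_neg_of_add_eq_zero_left h1).symm⟩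
      exact Submodule.disjoint_def.1 hC.disjoint _ hm (ι₀ a.1).2
    have h3 : Z x₀ a.2 = 0 := by rw [h2, zero_add] at h1; exact h1
    refine Prod.ext ?_ (hinj (h3.trans (map_zero _).symm))
    have : ι₀ a.1 = 0 := Subtype.ext h2
    simpa using this
  let e : (EuclideanSpace ℝ (Fin k) × EuclideanSpace ℝ (Fin l)) ≃L[ℝ] E :=
    (LinearEquiv.ofInjectiveOfFinrankEq D.toLinearMap hDinj
      (by simp [hkl])).toContinuousLinearEquiv
  have heD : (e : _ →L[ℝ] E) = D := by ext a <;> rfl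
  let j : EuclideanSpace ℝ (Fin k) × EuclideanSpace ℝ (Fin l) → E × EuclideanSpace ℝ (Fin l) :=
    fun a => (x₀ + ι a.1, a.2)
  have hj : ContDiff ℝ ∞ j :=
    (contDiff_const.add (ι.contDiff.comp contDiff_fst)).prodMk contDiff_snd
  have hj₀ : j 0 = (x₀, 0) := by simp [j]
  have hjc : Filter.Tendsto j (𝓝 0) (𝓝 (x₀, 0)) := by
    rw [← hj₀]; exact hj.continuous.continuousAt
  let G : EuclideanSpace ℝ (Fin k) × EuclideanSpace ℝ (Fin l) → E := fun a => Fl (j a)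
  have hG : ∀ᶠ a in 𝓝 0, ContDiffAt ℝ ∞ G a :=
    (hjc.eventually hFl).mono fun a ha => ha.comp a hj.contDiffAt
  have hG' : HasFDerivAt G (e : _ →L[ℝ] E) 0 := by
    have h1 : HasFDerivAt j ((ι ∘L ContinuousLinearMap.fst ℝ _ _).prod
        (ContinuousLinearMap.snd ℝ (EuclideanSpace ℝ (Fin k)) (EuclideanSpace ℝ (Fin l)))) 0 :=
      ((ι ∘L ContinuousLinearMap.fst ℝ (EuclideanSpace ℝ (Fin k))
        (EuclideanSpace ℝ (Fin l))).hasFDerivAt.const_add x₀).prodMk hasFDerivAt_snd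
    rw [← hj₀] at hFl'
    refine (hFl'.comp 0 h1).congr_fderiv ?_
    rw [heD]
    ext a <;> simp [D]
  obtain ⟨Φ, h0, -, hΦ, hΦ1, hΦ2⟩ :=
    exists_openPartialHomeomorph_of_smooth hG hG' Filter.univ_mem
  refine ⟨Φ, h0, ?_, ?_, hΦ2, ?_⟩
  · rw [hΦ]
    simp only [G, hj₀, hFl₀]
  · rw [hΦ]; exact hΦ1
  · have hU : {y | DifferentiableAt ℝ f y ∧ ∀ c, fderiv ℝ f y (z' c y) = 0} ∈ 𝓝 x₀ := by
      refine hf.and (Filter.eventually_all.2 fun c => ?_)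
      filter_upwards [hfz c, hzz' c] with y h1 h2
      rw [h2, h1]
    have hconst : ∀ᶠ b in 𝓝 (x₀, (0 : EuclideanSpace ℝ (Fin l))), f (Fl b) = f b.1 := by
      filter_upwards [hflow _ hU] with b ⟨γ, hγ0, hγ1, hγ⟩
      rw [← hγ0, ← hγ1]
      refine constant_along_of_fderiv_eq_zero (fun t ht => (hγ t ht).2)
        (fun t ht => (hγ t ht).1.1) fun t ht => ?_
      rw [hZa, map_sum]
      exact Finset.sum_eq_zero fun c _ => by rw [map_smul, (hγ t ht).1.2 c, smul_zero]
    have hpr : Filter.Tendsto (fun a : EuclideanSpace ℝ (Fin k) × EuclideanSpace ℝ (Fin l) =>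
        j (a.1, 0)) (𝓝 0) (𝓝 (x₀, 0)) := by
      have : Filter.Tendsto (fun a : EuclideanSpace ℝ (Fin k) × EuclideanSpace ℝ (Fin l) =>
          (a.1, (0 : EuclideanSpace ℝ (Fin l)))) (𝓝 0) (𝓝 0) := by
        have hc : Continuous fun a : EuclideanSpace ℝ (Fin k) × EuclideanSpace ℝ (Fin l) =>
          (a.1, (0 : EuclideanSpace ℝ (Fin l))) := by fun_prop
        exact hc.tendsto' _ _ rfl
      exact hjc.comp this
    filter_upwards [hjc.eventually hconst, hpr.eventually hconst] with a h1 h2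
    rw [hΦ]
    exact h1.trans h2.symm

end Straightening

/-! ### Linear algebra of the fibres of a foliation along a bi-submersion -/

section FiberData

variable {E F G : Type*} [NormedAddCommGroup E] [NormedSpace ℝ E]
  [NormedAddCommGroup F] [NormedSpace ℝ F] [NormedAddCommGroup G] [NormedSpace ℝ G]

/-- `f` is smooth on a neighbourhood of `x`. -/
def SmoothNear (f : E → F) (x : E) : Prop := ∀ᶠ y in 𝓝 x, ContDiffAt ℝ ∞ f y

theorem SmoothNear.const (c : F) (x : E) : SmoothNear (fun _ => c) x :=
  Filter.Eventually.of_forall fun _ => contDiffAt_const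

theorem SmoothNear.sub {f g : E → F} {x : E} (hf : SmoothNear f x) (hg : SmoothNear g x) :
    SmoothNear (fun y => f y - g y) x := by
  filter_upwards [hf, hg] with y h1 h2 using h1.sub h2

theorem SmoothNear.smul {f : E → ℝ} {g : E → F} {x : E} (hf : SmoothNear f x)
    (hg : SmoothNear g x) : SmoothNear (fun y => f y • g y) x := by
  filter_upwards [hf, hg] with y h1 h2 using h1.smul h2

theorem SmoothNear.mul {f g : E → ℝ} {x : E} (hf : SmoothNear f x)
    (hg : SmoothNear g x) : SmoothNear (fun y => f y * g y) x := by
  filter_upwards [hf, hg] with y h1 h2 using h1.mul h2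

theorem SmoothNear.sum {ι : Type*} [Finite ι] {s : Finset ι} {f : ι → E → F} {x : E}
    (hf : ∀ i, SmoothNear (f i) x) : SmoothNear (fun y => ∑ i ∈ s, f i y) x := by
  filter_upwards [Filter.eventually_all.2 hf] with y h using ContDiffAt.sum fun i _ => h i

theorem SmoothNear.clm_apply {f : E → F →L[ℝ] G} {g : E → F} {x : E} (hf : SmoothNear f x)
    (hg : SmoothNear g x) : SmoothNear (fun y => f y (g y)) x := by
  filter_upwards [hf, hg] with y h1 h2 using h1.clm_apply h2

theorem SmoothNear.fderiv {f : E → F} {x : E} (hf : SmoothNear f x) :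
    SmoothNear (fderiv ℝ f) x := by
  filter_upwards [hf] with y h using h.fderiv_right (m := ∞) (by simp)

theorem SmoothNear.clm_comp_left {f : E → F} {x : E} (L : F →L[ℝ] G) (hf : SmoothNear f x) :
    SmoothNear (fun y => L (f y)) x := by
  filter_upwards [hf] with y h using L.contDiff.contDiffAt.comp y h

/-- A submersion has a smooth family of right inverses of its differential. -/
theorem exists_smooth_rightInverse_fderiv [FiniteDimensional ℝ G] {Q : E → G} {x₀ : E} (hQ : SmoothNear Q x₀)
    (hQs : Function.Surjective (fderiv ℝ Q x₀)) :
    ∃ R : E → G →L[ℝ] E, SmoothNear R x₀ ∧ ∀ᶠ y in 𝓝 x₀, ∀ v, fderiv ℝ Q y (R y v) = v := by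
  obtain ⟨R₀, hR₀⟩ := (fderiv ℝ Q x₀).toLinearMap.exists_rightInverse_of_surjective
    (LinearMap.range_eq_top.2 hQs)
  let R₁ : G →L[ℝ] E := LinearMap.toContinuousLinearMap R₀
  let A : E → G →L[ℝ] G := fun y => fderiv ℝ Q y ∘L R₁
  have hA : SmoothNear A x₀ := by
    filter_upwards [hQ.fderiv] with y h using h.clm_comp contDiffAt_const
  have hA₀ : A x₀ = 1 := by
    ext v
    exact LinearMap.congr_fun hR₀ v
  have hunit : ∀ᶠ y in 𝓝 x₀, IsUnit (A y) := by
    have hc : ContinuousAt A x₀ := hA.self_of_nhds.continuousAt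
    exact hc.eventually_mem (Units.isOpen.mem_nhds (by rw [hA₀]; exact isUnit_one))
  refine ⟨fun y => R₁ ∘L Ring.inverse (A y), ?_, ?_⟩
  · filter_upwards [hA, hunit] with y h1 ⟨u, hu⟩
    have h2 : ContDiffAt ℝ ∞ (Ring.inverse : (G →L[ℝ] G) → G →L[ℝ] G) (A y) := by
      rw [← hu]; exact contDiffAt_ringInverse ℝ u
    exact contDiffAt_const.clm_comp (h2.comp y h1)
  · filter_upwards [hunit] with y hu v
    exact DFunLike.congr_fun (Ring.mul_inverse_cancel _ hu) v

/-- The family `X` of vectors along `P` has the properties of the pull-back along `P` of a minimal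
family of generators of the left singular foliation of a bi-submersion `(P, Q)` near `x₀`. -/
structure FiberData (P : E → F) (Q : E → G) (x₀ : E) {r : ℕ} (X : Fin r → E → F) : Prop where
  lift : ∀ i, ∃ ζ : E → E, SmoothNear ζ x₀ ∧ (∀ᶠ y in 𝓝 x₀, fderiv ℝ Q y (ζ y) = 0) ∧
    ∀ᶠ y in 𝓝 x₀, fderiv ℝ P y (ζ y) = X i y
  gen : ∀ ζ : E → E, SmoothNear ζ x₀ → (∀ᶠ y in 𝓝 x₀, fderiv ℝ Q y (ζ y) = 0) →
    ∃ h : Fin r → E → ℝ, (∀ i, SmoothNear (h i) x₀) ∧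
      ∀ᶠ y in 𝓝 x₀, fderiv ℝ P y (ζ y) = ∑ i, h i y • X i y
  indep : ∀ b : Fin r → E → ℝ, (∀ i, SmoothNear (b i) x₀) →
    (∀ᶠ y in 𝓝 x₀, ∑ i, b i y • X i y = 0) → ∀ i, b i x₀ = 0

variable {P : E → F} {Q : E → G} {x₀ : E} {r : ℕ} {X : Fin r → E → F}

/-- Smooth fields spanning the kernel of the differential of a submersion. -/
theorem exists_kernel_fields [FiniteDimensional ℝ G] (hQ : SmoothNear Q x₀)
    (hQs : Function.Surjective (fderiv ℝ Q x₀)) :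
    ∃ p : E → E →L[ℝ] E, SmoothNear p x₀ ∧ (∀ᶠ y in 𝓝 x₀, ∀ v, fderiv ℝ Q y (p y v) = 0) ∧
      ∀ᶠ y in 𝓝 x₀, ∀ v, fderiv ℝ Q y v = 0 → p y v = v := by
  obtain ⟨R, hR, hR'⟩ := exists_smooth_rightInverse_fderiv hQ hQs
  refine ⟨fun y => ContinuousLinearMap.id ℝ E - R y ∘L fderiv ℝ Q y, ?_, ?_, ?_⟩
  · filter_upwards [hR, hQ.fderiv] with y h1 h2 using contDiffAt_const.sub (h1.clm_comp h2)
  · filter_upwards [hR'] with y h v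
    simp [h]
  · exact Filter.Eventually.of_forall fun y v hv => by simp [hv]

namespace FiberData

variable [FiniteDimensional ℝ E]

/-- The coefficients of the image of a field tangent to the fibres of `Q` only depend on the value
of the field. -/
theorem exists_functionals [FiniteDimensional ℝ G] (D : FiberData P Q x₀ X) (hQ : SmoothNear Q x₀)
    (hQs : Function.Surjective (fderiv ℝ Q x₀)) :
    ∃ H : Fin r → E →ₗ[ℝ] ℝ, ∀ (ζ : E → E) (b : Fin r → E → ℝ), SmoothNear ζ x₀ →
      (∀ i, SmoothNear (b i) x₀) → (∀ᶠ y in 𝓝 x₀, fderiv ℝ Q y (ζ y) = 0) →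
      (∀ᶠ y in 𝓝 x₀, fderiv ℝ P y (ζ y) = ∑ i, b i y • X i y) → ∀ i, H i (ζ x₀) = b i x₀ := by
  obtain ⟨p, hp, hp0, hp1⟩ := exists_kernel_fields hQ hQs
  let e := Module.finBasis ℝ E
  choose h hh hgen using fun j => D.gen (fun y => p y (e j)) (hp.clm_apply (SmoothNear.const _ _))
    (hp0.mono fun y hy => hy _)
  let c : ∀ _ : Fin (Module.finrank ℝ E), E →L[ℝ] ℝ := fun j =>
    LinearMap.toContinuousLinearMap (e.coord j)
  refine ⟨fun i => ∑ j, h j i x₀ • e.coord j, fun ζ b hζ hb hQζ hPζ i => ?_⟩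
  -- Expanding ζ in the projected basis fields `p y (e j)` gives a second family of coefficients for
  -- its image. The difference of the two families is a relation, so by `indep` they agree at x₀,
  -- where the second one depends on `ζ x₀` alone.
  have key := D.indep (fun i y => b i y - ∑ j, h j i y * c j (ζ y))
    (fun i => (hb i).sub (SmoothNear.sum fun j => (hh j i).mul (hζ.clm_comp_left (c j)))) ?_ i
  · simp only [LinearMap.sum_apply, LinearMap.smul_apply, smul_eq_mul]
    exact (sub_eq_zero.1 key).symm
  · filter_upwards [hQζ, hPζ, hp1, Filter.eventually_all.2 hgen] with y h1 h2 h3 h4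
    have h5 : ζ y = ∑ j, c j (ζ y) • p y (e j) := by
      calc ζ y = p y (ζ y) := (h3 _ h1).symm
        _ = p y (∑ j, e.repr (ζ y) j • e j) := by rw [e.sum_repr]
        _ = ∑ j, c j (ζ y) • p y (e j) := by rw [map_sum]; simp only [map_smul]; rfl
    have h6 : fderiv ℝ P y (ζ y) = ∑ i, (∑ j, h j i y * c j (ζ y)) • X i y := by
      rw [h5, map_sum]
      simp only [map_smul, h4, Finset.smul_sum, Finset.sum_smul, smul_smul]
      rw [Finset.sum_comm]
      refine Finset.sum_congr rfl fun i _ => Finset.sum_congr rfl fun j _ => ?_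
      rw [← h5, mul_comm]
    simp only [sub_smul, Finset.sum_sub_distrib]
    rw [← h2, h6, sub_self]

theorem finrank_ker_fderiv (hQs : Function.Surjective (fderiv ℝ Q x₀)) :
    Module.finrank ℝ (LinearMap.ker (fderiv ℝ Q x₀).toLinearMap) + Module.finrank ℝ G =
      Module.finrank ℝ E := by
  rw [← LinearMap.finrank_range_add_finrank_ker (fderiv ℝ Q x₀).toLinearMap, add_comm,
    LinearMap.range_eq_top.2 hQs, finrank_top]

/-- The functionals of `exists_functionals` are dual to the values at x₀ of the lifts of the X i.
These values are therefore r independent vectors in the kernel of the differential of Q. -/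
theorem card_add_finrank_le [FiniteDimensional ℝ G] (D : FiberData P Q x₀ X) (hQ : SmoothNear Q x₀)
    (hQs : Function.Surjective (fderiv ℝ Q x₀)) :
    r + Module.finrank ℝ G ≤ Module.finrank ℝ E := by
  obtain ⟨H, hH⟩ := D.exists_functionals hQ hQs
  choose ζ hζ hQζ hPζ using D.lift
  have hHζ : ∀ i j, H j (ζ i x₀) = if i = j then 1 else 0 := fun i j =>
    hH (ζ i) (fun j _ => if i = j then 1 else 0) (hζ i) (fun j => SmoothNear.const _ _) (hQζ i)
      (by filter_upwards [hPζ i] with y hy; simp [hy]) j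
  have hmem : ∀ i, ζ i x₀ ∈ LinearMap.ker (fderiv ℝ Q x₀).toLinearMap := fun i =>
    (hQζ i).self_of_nhds
  have hli : LinearIndependent ℝ fun i =>
      (⟨ζ i x₀, hmem i⟩ : LinearMap.ker (fderiv ℝ Q x₀).toLinearMap) := by
    refine Fintype.linearIndependent_iff.2 fun g hg j => ?_
    have h1 : ∑ i, g i • ζ i x₀ = 0 := by simpa using congrArg Subtype.val hg
    have h2 := congrArg (H j) h1
    simpa [hHζ] using h2
  have := hli.fintype_card_le_finrank
  rw [Fintype.card_fin] at this
  have := finrank_ker_fderiv hQs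
  omega

/-- With K the space of values at x₀ of fields killed by both differentials, r + dim K is the
dimension of ker TQ and s + dim K that of ker TP. The inequality is proved without computing dim K,
by an injection of ker TP × ℝʳ into ker TQ × ℝˢ. -/
theorem card_add_finrank_le_card_add_finrank [FiniteDimensional ℝ F] [FiniteDimensional ℝ G]
    {s : ℕ} {Y : Fin s → E → G}
    (D : FiberData P Q x₀ X) (D' : FiberData Q P x₀ Y) (hP : SmoothNear P x₀)
    (hQ : SmoothNear Q x₀) (hPs : Function.Surjective (fderiv ℝ P x₀))
    (hQs : Function.Surjective (fderiv ℝ Q x₀)) :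
    r + Module.finrank ℝ G ≤ s + Module.finrank ℝ F := by
  obtain ⟨H, hH⟩ := D.exists_functionals hQ hQs
  choose ζ hζ hQζ hPζ using D.lift
  have hHζ : ∀ i j, H j (ζ i x₀) = if i = j then 1 else 0 := fun i j =>
    hH (ζ i) (fun j _ => if i = j then 1 else 0) (hζ i) (fun j => SmoothNear.const _ _) (hQζ i)
      (by filter_upwards [hPζ i] with y hy; simp [hy]) j
  obtain ⟨H', hH'⟩ := D'.exists_functionals hP hPs
  choose ζ' hζ' hPζ' hQζ' using D'.lift
  obtain ⟨p, hp, hp0, hp1⟩ := exists_kernel_fields hP hPs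
  -- a vector tangent to the fibres of `P` whose image in the fibre of the right foliation vanishes
  -- and which is tangent to the fibres of `Q` extends to a field tangent to the fibres of `P`, `Q`
  have key : ∀ a, fderiv ℝ P x₀ a = 0 → (∀ i, H' i a = 0) → ∀ j, H j a = 0 := by
    intro a ha ha' j
    obtain ⟨h, hh, hgen⟩ := D'.gen (fun y => p y a) (hp.clm_apply (SmoothNear.const _ _))
      (hp0.mono fun y hy => hy _)
    have hpa : p x₀ a = a := hp1.self_of_nhds a ha
    have hh0 : ∀ i, h i x₀ = 0 := fun i => by
      rw [← ha' i, ← hH' (fun y => p y a) h (hp.clm_apply (SmoothNear.const _ _)) hh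
        (hp0.mono fun y hy => hy _) hgen i, hpa]
    have := hH (fun y => p y a - ∑ i, h i y • ζ' i y) (fun _ _ => 0)
      ((hp.clm_apply (SmoothNear.const _ _)).sub (SmoothNear.sum fun i => (hh i).smul (hζ' i)))
      (fun _ => SmoothNear.const _ _) ?_ ?_ j
    · simpa [hh0, hpa] using this
    · filter_upwards [hgen, Filter.eventually_all.2 hQζ'] with y h1 h2
      simp [map_sub, h1, map_sum, map_smul, h2]
    · filter_upwards [hp0, Filter.eventually_all.2 hPζ'] with y h1 h2
      simp [map_sub, h1, map_sum, map_smul, h2]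
  let kP := LinearMap.ker (fderiv ℝ P x₀).toLinearMap
  let kQ := LinearMap.ker (fderiv ℝ Q x₀).toLinearMap
  -- Subtracting ∑ H'ᵢ(a) ζ'ᵢ from a vector a of ker TP cancels its image under TQ, so the result
  -- lies in both kernels. The coordinates H'ᵢ(a) that are lost here are kept in the second factor
  -- of T.
  let T₀ : (kP × (Fin r → ℝ)) →ₗ[ℝ] E :=
    (kP.subtype - ∑ i, (H' i ∘ₗ kP.subtype).smulRight (ζ' i x₀)).coprod
      (Fintype.linearCombination ℝ fun i => ζ i x₀)
  have hT₀a : ∀ a c, T₀ (a, c) = ((a : E) - ∑ i, H' i a • ζ' i x₀) + ∑ i, c i • ζ i x₀ :=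
    fun a c => by simp [T₀, Fintype.linearCombination_apply]
  have hT₀ : ∀ ac, T₀ ac ∈ kQ := by
    rintro ⟨a, c⟩
    rw [hT₀a]
    refine kQ.add_mem ?_ (kQ.sum_mem fun i _ => kQ.smul_mem _ (hQζ i).self_of_nhds)
    obtain ⟨h, hh, hgen⟩ := D'.gen (fun y => p y (a : E)) (hp.clm_apply (SmoothNear.const _ _))
      (hp0.mono fun y hy => hy _)
    have hpa : p x₀ a = a := hp1.self_of_nhds a a.2
    have hh0 : ∀ i, H' i a = h i x₀ := fun i => by
      rw [← hH' (fun y => p y (a : E)) h (hp.clm_apply (SmoothNear.const _ _)) hh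
        (hp0.mono fun y hy => hy _) hgen i, hpa]
    have h1 := hgen.self_of_nhds
    rw [hpa] at h1
    have h2 : ∀ i, fderiv ℝ Q x₀ (ζ' i x₀) = Y i x₀ := fun i => (hQζ' i).self_of_nhds
    change fderiv ℝ Q x₀ _ = 0
    simp [map_sub, h1, h2, hh0]
  let T : (kP × (Fin r → ℝ)) →ₗ[ℝ] kQ × (Fin s → ℝ) :=
    (T₀.codRestrict kQ hT₀).prod (LinearMap.pi fun i => H' i ∘ₗ kP.subtype ∘ₗ LinearMap.fst ℝ _ _)
  have hT : Function.Injective T := by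
    refine (injective_iff_map_eq_zero T).2 ?_
    rintro ⟨a, c⟩ h
    have h1 : T₀ (a, c) = 0 := congrArg (fun x => (x.1 : E)) h
    have h2 : ∀ i, H' i a = 0 := fun i => congrFun (congrArg Prod.snd h) i
    rw [hT₀a] at h1
    simp only [h2, zero_smul, Finset.sum_const_zero, sub_zero] at h1
    have h3 : c = 0 := by
      ext j
      have h4 := congrArg (H j) h1
      simpa [key a a.2 h2, hHζ] using h4
    subst h3
    have h5 : (a : E) = 0 := by simpa using h1
    exact Prod.ext (Subtype.ext h5) rfl
  have h1 := LinearMap.finrank_le_finrank_of_injective hT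
  rw [Module.finrank_prod, Module.finrank_prod, Module.finrank_fin_fun, Module.finrank_fin_fun] at h1
  have h2 := finrank_ker_fderiv hPs
  have h3 := finrank_ker_fderiv hQs
  change Module.finrank ℝ kP + _ = _ at h2
  change Module.finrank ℝ kQ + _ = _ at h3
  omega

/-- Correcting a spanning family of fields in ker TQ by combinations of the r lifts yields fields
killed by both differentials. Together with the lifts their values span ker TQ at x₀, so they span a
space of dimension at least dim ker TQ - r, which is at least l. -/
theorem exists_independent_fields [FiniteDimensional ℝ G] (D : FiberData P Q x₀ X) (hQ : SmoothNear Q x₀)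
    (hQs : Function.Surjective (fderiv ℝ Q x₀)) {l : ℕ}
    (hl : r + Module.finrank ℝ G + l ≤ Module.finrank ℝ E) :
    ∃ z : Fin l → E → E, (∀ c, SmoothNear (z c) x₀) ∧ LinearIndependent ℝ (fun c => z c x₀) ∧
      (∀ c, ∀ᶠ y in 𝓝 x₀, fderiv ℝ P y (z c y) = 0) ∧
      ∀ c, ∀ᶠ y in 𝓝 x₀, fderiv ℝ Q y (z c y) = 0 := by
  obtain ⟨p, hp, hp0, hp1⟩ := exists_kernel_fields hQ hQs
  choose ζ hζ hQζ hPζ using D.lift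
  let e := Module.finBasis ℝ E
  choose h hh hgen using fun j => D.gen (fun y => p y (e j)) (hp.clm_apply (SmoothNear.const _ _))
    (hp0.mono fun y hy => hy _)
  let z : Fin (Module.finrank ℝ E) → E → E := fun j y => p y (e j) - ∑ i, h j i y • ζ i y
  have hzs : ∀ j, SmoothNear (z j) x₀ := fun j =>
    (hp.clm_apply (SmoothNear.const _ _)).sub (SmoothNear.sum fun i => (hh j i).smul (hζ i))
  have hzP : ∀ j, ∀ᶠ y in 𝓝 x₀, fderiv ℝ P y (z j y) = 0 := fun j => by
    filter_upwards [hgen j, Filter.eventually_all.2 hPζ] with y h1 h2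
    simp [z, map_sub, h1, map_sum, map_smul, h2]
  have hzQ : ∀ j, ∀ᶠ y in 𝓝 x₀, fderiv ℝ Q y (z j y) = 0 := fun j => by
    filter_upwards [hp0, Filter.eventually_all.2 hQζ] with y h1 h2
    simp [z, map_sub, h1, map_sum, map_smul, h2]
  let A := Submodule.span ℝ (Set.range fun j => z j x₀)
  let B := Submodule.span ℝ (Set.range fun i => ζ i x₀)
  have hle : LinearMap.ker (fderiv ℝ Q x₀).toLinearMap ≤ A ⊔ B := by
    intro v hv
    have hpv : p x₀ v = v := hp1.self_of_nhds v hv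
    rw [← hpv, ← e.sum_repr v, map_sum]
    refine Submodule.sum_mem _ fun j _ => ?_
    rw [map_smul]
    refine Submodule.smul_mem _ _ ?_
    have : p x₀ (e j) = z j x₀ + ∑ i, h j i x₀ • ζ i x₀ := by simp [z]
    rw [this]
    exact Submodule.add_mem_sup (Submodule.subset_span ⟨j, rfl⟩)
      (Submodule.sum_mem _ fun i _ => Submodule.smul_mem _ _ (Submodule.subset_span ⟨i, rfl⟩))
  have h1 : l ≤ Module.finrank ℝ A := by
    have h2 := Submodule.finrank_mono hle
    have h3 := Submodule.finrank_add_le_finrank_add_finrank A B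
    have h4 : Module.finrank ℝ B ≤ r := by
      have := finrank_range_le_card (R := ℝ) fun i => ζ i x₀
      rwa [Fintype.card_fin] at this
    have h5 := finrank_ker_fderiv hQs
    omega
  obtain ⟨f, hf, -, hfi⟩ := Submodule.exists_fun_fin_finrank_span_eq ℝ (Set.range fun j => z j x₀)
  choose g hg using hf
  refine ⟨fun c => z (g (Fin.castLE h1 c)), fun c => hzs _, ?_, fun c => hzP _, fun c => hzQ _⟩
  have := hfi.comp (Fin.castLE h1) (Fin.castLE_injective h1)
  have hfg : (fun c => z (g (Fin.castLE h1 c)) x₀) = f ∘ Fin.castLE h1 := funext fun c => hg _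
  rw [hfg]
  exact this

end FiberData

end FiberData

/-! ### Local diffeomorphisms and push-forward of vector fields -/

section PushField

variable {E F H K : Type*} [NormedAddCommGroup E] [NormedSpace ℝ E] [NormedAddCommGroup F]
  [NormedSpace ℝ F] [TopologicalSpace H] [TopologicalSpace K]
  {I : ModelWithCorners ℝ E H} {J : ModelWithCorners ℝ F K}
  {A B : Type*} [TopologicalSpace A] [ChartedSpace H A] [TopologicalSpace B] [ChartedSpace K B]

/-- The local homeomorphism `Φ` is smooth together with its inverse. -/
structure IsSmoothHomeo (I : ModelWithCorners ℝ E H) (J : ModelWithCorners ℝ F K)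
    (Φ : OpenPartialHomeomorph A B) : Prop where
  contMDiffOn : ContMDiffOn I J ∞ Φ Φ.source
  contMDiffOn_symm : ContMDiffOn J I ∞ Φ.symm Φ.target

namespace IsSmoothHomeo

variable {Φ : OpenPartialHomeomorph A B}

theorem symm (hΦ : IsSmoothHomeo I J Φ) : IsSmoothHomeo J I Φ.symm :=
  ⟨hΦ.contMDiffOn_symm, hΦ.contMDiffOn⟩

theorem contMDiffAt (hΦ : IsSmoothHomeo I J Φ) {x : A} (hx : x ∈ Φ.source) :
    ContMDiffAt I J ∞ Φ x :=
  hΦ.contMDiffOn.contMDiffAt (Φ.open_source.mem_nhds hx)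

theorem mdifferentiableAt (hΦ : IsSmoothHomeo I J Φ) {x : A} (hx : x ∈ Φ.source) :
    MDifferentiableAt I J Φ x :=
  (hΦ.contMDiffAt hx).mdifferentiableAt (by simp)

theorem mfderiv_symm_mfderiv (hΦ : IsSmoothHomeo I J Φ) {x : A} (hx : x ∈ Φ.source) (v : E) :
    mfderiv J I Φ.symm (Φ x) (mfderiv I J Φ x v : F) = v := by
  have h1 := hΦ.mdifferentiableAt hx
  have h2 : MDifferentiableAt J I Φ.symm (Φ x) := hΦ.symm.mdifferentiableAt (Φ.map_source hx)
  have h3 := mfderiv_comp x h2 h1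
  have h4 : (Φ.symm ∘ Φ : A → A) =ᶠ[𝓝 x] id := by
    filter_upwards [Φ.open_source.mem_nhds hx] with y hy using Φ.left_inv hy
  rw [h4.mfderiv_eq, mfderiv_id] at h3
  exact (DFunLike.congr_fun h3 v).symm

theorem mfderiv_mfderiv_symm (hΦ : IsSmoothHomeo I J Φ) {y : B} (hy : y ∈ Φ.target) (v : F) :
    mfderiv I J Φ (Φ.symm y) (mfderiv J I Φ.symm y v : E) = v :=
  hΦ.symm.mfderiv_symm_mfderiv (Φ := Φ.symm) hy v

theorem mfderiv_injective (hΦ : IsSmoothHomeo I J Φ) {x : A} (hx : x ∈ Φ.source) :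
    Function.Injective (mfderiv I J Φ x) := fun v w h => by
  rw [← hΦ.mfderiv_symm_mfderiv hx v, ← hΦ.mfderiv_symm_mfderiv hx w]
  exact congrArg (mfderiv J I Φ.symm (Φ x)) h

theorem mfderiv_surjective (hΦ : IsSmoothHomeo I J Φ) {x : A} (hx : x ∈ Φ.source) :
    Function.Surjective (mfderiv I J Φ x) := fun v => by
  refine ⟨mfderiv J I Φ.symm (Φ x) v, ?_⟩
  have := hΦ.mfderiv_mfderiv_symm (Φ.map_source hx) v
  rwa [Φ.left_inv hx] at this

end IsSmoothHomeo

/-- The push-forward of a vector field by a local diffeomorphism. -/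
noncomputable def pushField (I : ModelWithCorners ℝ E H) (J : ModelWithCorners ℝ F K)
    (Φ : OpenPartialHomeomorph A B) (Z : ∀ a : A, TangentSpace I a) (b : B) : TangentSpace J b :=
  (mfderiv I J Φ (Φ.symm b) (Z (Φ.symm b)) : F)

variable [IsManifold I ∞ A] [IsManifold J ∞ B]

theorem ContMDiffAt.tangentMap_section {f : A → B} {Z : ∀ a : A, TangentSpace I a}
    {x : A} (hf : ∀ᶠ y in 𝓝 x, ContMDiffAt I J ∞ f y)
    (hZ : ContMDiffAt I I.tangent ∞ (fun a => (⟨a, Z a⟩ : TangentBundle I A)) x) :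
    ContMDiffAt I J.tangent ∞
      (fun a => (⟨f a, mfderiv I J f a (Z a)⟩ : TangentBundle J B)) x := by
  obtain ⟨U, hU, hUo, hxU⟩ := eventually_nhds_iff.1 hf
  have h1 : ContMDiffOn I J ∞ f U := fun y hy => (hU y hy).contMDiffWithinAt
  have h2 := h1.contMDiffOn_tangentMapWithin (m := ∞) (by simp) hUo.uniqueMDiffOn
  have hopen : IsOpen (Bundle.TotalSpace.proj ⁻¹' U : Set (TangentBundle I A)) :=
    hUo.preimage (FiberBundle.continuous_proj E (TangentSpace I))
  have h3 : ContMDiffAt I.tangent J.tangent ∞ (tangentMapWithin I J f U)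
      (⟨x, Z x⟩ : TangentBundle I A) := h2.contMDiffAt (hopen.mem_nhds hxU)
  have h4 := h3.comp x hZ
  refine h4.congr_of_eventuallyEq ?_
  filter_upwards [hUo.mem_nhds hxU] with y hy
  simp only [Function.comp_apply, tangentMapWithin, mfderivWithin_of_isOpen hUo hy]

theorem contMDiffAt_pushField {Φ : OpenPartialHomeomorph A B} (hΦ : IsSmoothHomeo I J Φ)
    {Z : ∀ a : A, TangentSpace I a} {b : B} (hb : b ∈ Φ.target)
    (hZ : ContMDiffAt I I.tangent ∞ (fun a => (⟨a, Z a⟩ : TangentBundle I A)) (Φ.symm b)) :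
    ContMDiffAt J J.tangent ∞ (fun b => (⟨b, pushField I J Φ Z b⟩ : TangentBundle J B)) b := by
  have h1 := ContMDiffAt.tangentMap_section (I := I) (J := J) (f := Φ) (Z := Z)
    (Filter.eventually_of_mem (Φ.open_source.mem_nhds (Φ.map_target hb))
      fun y hy => hΦ.contMDiffAt hy) hZ
  have h2 := h1.comp b (hΦ.symm.contMDiffAt hb)
  refine h2.congr_of_eventuallyEq ?_
  filter_upwards [Φ.open_target.mem_nhds hb] with y hy
  have : Φ (Φ.symm y) = y := Φ.right_inv hy
  exact Bundle.TotalSpace.ext this.symm HEq.rfl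

end PushField

theorem isSmoothHomeo_chartAt {d : ℕ} {W : Type*} [TopologicalSpace W]
    [ChartedSpace (EuclideanSpace ℝ (Fin d)) W] [IsManifold (𝓡 d) ∞ W] (w : W) :
    IsSmoothHomeo (𝓡 d) (𝓡 d) (chartAt (EuclideanSpace ℝ (Fin d)) w) :=
  ⟨contMDiffOn_chart, contMDiffOn_chart_symm⟩

theorem exists_opens_of_eventually {X : Type*} [TopologicalSpace X] {x : X} {p : X → Prop}
    (h : ∀ᶠ y in 𝓝 x, p y) : ∃ O : Opens X, x ∈ O ∧ ∀ y ∈ O, p y := by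
  obtain ⟨U, hU, hUo, hxU⟩ := eventually_nhds_iff.1 h
  exact ⟨⟨U, hUo⟩, hxU, hU⟩

/-! ### Maps and vector fields in preferred charts -/

section Coordinates

variable {d m : ℕ} {W : Type*} [TopologicalSpace W] [ChartedSpace (EuclideanSpace ℝ (Fin d)) W]
  {M : Type*} [TopologicalSpace M] [ChartedSpace (EuclideanSpace ℝ (Fin m)) M]

theorem tendsto_chartAt_symm (w : W) : Filter.Tendsto (chartAt (EuclideanSpace ℝ (Fin d)) w).symm
    (𝓝 (chartAt (EuclideanSpace ℝ (Fin d)) w w)) (𝓝 w) := by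
  have := (chartAt (EuclideanSpace ℝ (Fin d)) w).symm.continuousAt
    ((chartAt (EuclideanSpace ℝ (Fin d)) w).map_source (mem_chart_source _ w))
  rwa [ContinuousAt, (chartAt (EuclideanSpace ℝ (Fin d)) w).left_inv (mem_chart_source _ w)] at this

theorem tendsto_chartAt (w : W) : Filter.Tendsto (chartAt (EuclideanSpace ℝ (Fin d)) w)
    (𝓝 w) (𝓝 (chartAt (EuclideanSpace ℝ (Fin d)) w w)) :=
  (chartAt (EuclideanSpace ℝ (Fin d)) w).continuousAt (mem_chart_source _ w)

theorem eventually_mem_chartAt_target (w : W) :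
    ∀ᶠ y in 𝓝 (chartAt (EuclideanSpace ℝ (Fin d)) w w),
      y ∈ (chartAt (EuclideanSpace ℝ (Fin d)) w).target :=
  (chartAt (EuclideanSpace ℝ (Fin d)) w).open_target.mem_nhds
    ((chartAt (EuclideanSpace ℝ (Fin d)) w).map_source (mem_chart_source _ w))

theorem eventually_mem_chartAt_source (w : W) :
    ∀ᶠ y in 𝓝 w, y ∈ (chartAt (EuclideanSpace ℝ (Fin d)) w).source :=
  chart_source_mem_nhds _ w

theorem eventually_coordMap_mem {p : W → M} {w : W} (hp : Continuous p) :
    ∀ᶠ y in 𝓝 (chartAt (EuclideanSpace ℝ (Fin d)) w w),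
      p ((chartAt (EuclideanSpace ℝ (Fin d)) w).symm y) ∈
        (chartAt (EuclideanSpace ℝ (Fin m)) (p w)).source :=
  (tendsto_chartAt_symm (d := d) w).eventually
    (hp.continuousAt.eventually (eventually_mem_chartAt_source (d := m) (p w)))

variable [IsManifold (𝓡 d) ∞ W] [IsManifold (𝓡 m) ∞ M]

/-- The expression of `p` in the preferred charts at `w` and `p w`. -/
noncomputable def coordMap (p : W → M) (w : W) (y : EuclideanSpace ℝ (Fin d)) :
    EuclideanSpace ℝ (Fin m) :=
  chartAt (EuclideanSpace ℝ (Fin m)) (p w) (p ((chartAt (EuclideanSpace ℝ (Fin d)) w).symm y))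

/-- The expression of a vector field in the preferred chart at `w`. -/
noncomputable def coordField (Z : VField d W) (w : W) :
    EuclideanSpace ℝ (Fin d) → EuclideanSpace ℝ (Fin d) :=
  pushField (𝓡 d) (𝓡 d) (chartAt (EuclideanSpace ℝ (Fin d)) w) Z

/-- The vector field with a given expression in the preferred chart at `w`. -/
noncomputable def fieldOfCoord (ζ : EuclideanSpace ℝ (Fin d) → EuclideanSpace ℝ (Fin d)) (w : W) :
    VField d W :=
  pushField (𝓡 d) (𝓡 d) (chartAt (EuclideanSpace ℝ (Fin d)) w).symm ζ

theorem smoothNear_comp_chartAt_symm {F : Type*} [NormedAddCommGroup F] [NormedSpace ℝ F]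
    {g : W → F} {w : W} (hg : ∀ᶠ y in 𝓝 w, ContMDiffAt (𝓡 d) 𝓘(ℝ, F) ∞ g y) :
    SmoothNear (fun y => g ((chartAt (EuclideanSpace ℝ (Fin d)) w).symm y))
      (chartAt (EuclideanSpace ℝ (Fin d)) w w) := by
  filter_upwards [eventually_mem_chartAt_target (d := d) w, (tendsto_chartAt_symm (d := d) w).eventually hg]
    with y h1 h2
  exact (h2.comp y ((isSmoothHomeo_chartAt (d := d) w).symm.contMDiffAt h1)).contDiffAt

theorem smoothNear_coordMap {p : W → M} (hp : ContMDiff (𝓡 d) (𝓡 m) ∞ p) (w : W) :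
    SmoothNear (coordMap (m := m) p w) (chartAt (EuclideanSpace ℝ (Fin d)) w w) := by
  refine smoothNear_comp_chartAt_symm
    (g := fun y => chartAt (EuclideanSpace ℝ (Fin m)) (p w) (p y)) ?_
  filter_upwards [hp.continuous.continuousAt.eventually (eventually_mem_chartAt_source (d := m) (p w))]
    with y hy
  exact ((isSmoothHomeo_chartAt (d := m) (p w)).contMDiffAt hy).comp y hp.contMDiffAt

theorem eventually_fderiv_coordMap {p : W → M} (hp : ContMDiff (𝓡 d) (𝓡 m) ∞ p) (w : W) :
    ∀ᶠ y in 𝓝 (chartAt (EuclideanSpace ℝ (Fin d)) w w), ∀ v : EuclideanSpace ℝ (Fin d),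
      fderiv ℝ (coordMap (m := m) p w) y v =
        (mfderiv (𝓡 m) (𝓡 m) (chartAt (EuclideanSpace ℝ (Fin m)) (p w))
          (p ((chartAt (EuclideanSpace ℝ (Fin d)) w).symm y))
          (mfderiv (𝓡 d) (𝓡 m) p ((chartAt (EuclideanSpace ℝ (Fin d)) w).symm y)
            (mfderiv (𝓡 d) (𝓡 d) (chartAt (EuclideanSpace ℝ (Fin d)) w).symm y v)) :
              EuclideanSpace ℝ (Fin m)) := by
  filter_upwards [eventually_mem_chartAt_target (d := d) w, eventually_coordMap_mem (m := m) hp.continuous]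
    with y h1 h2 v
  have e1 := (isSmoothHomeo_chartAt (d := d) w).symm.mdifferentiableAt h1
  have e2 : MDifferentiableAt (𝓡 d) (𝓡 m) p ((chartAt (EuclideanSpace ℝ (Fin d)) w).symm y) :=
    hp.mdifferentiable (by simp) _
  have e3 := (isSmoothHomeo_chartAt (d := m) (p w)).mdifferentiableAt h2
  rw [← mfderiv_eq_fderiv]
  have h3 := mfderiv_comp y e3 (e2.comp y e1)
  have h4 := mfderiv_comp y e2 e1
  rw [h4] at h3
  exact DFunLike.congr_fun h3 v

theorem smoothNear_coordField {Z : VField d W} {w : W} {O : Opens W} (hw : w ∈ O)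
    (hZ : Z.SmoothOn O) :
    SmoothNear (coordField Z w) (chartAt (EuclideanSpace ℝ (Fin d)) w w) := by
  filter_upwards [eventually_mem_chartAt_target (d := d) w,
    (tendsto_chartAt_symm (d := d) w).eventually (O.isOpen.mem_nhds hw)] with y h1 h2
  exact contMDiffAt_vectorSpace_iff_contDiffAt.1 (contMDiffAt_pushField (isSmoothHomeo_chartAt (d := d) w) h1
    (ContMDiffOn.contMDiffAt hZ (O.isOpen.mem_nhds h2)))

theorem contMDiffAt_fieldOfCoord {ζ : EuclideanSpace ℝ (Fin d) → EuclideanSpace ℝ (Fin d)} {w : W}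
    (hζ : SmoothNear ζ (chartAt (EuclideanSpace ℝ (Fin d)) w w)) :
    ∀ᶠ y in 𝓝 w, ContMDiffAt (𝓡 d) (𝓡 d).tangent ∞
      (fun y => (⟨y, fieldOfCoord ζ w y⟩ : TangentBundle (𝓡 d) W)) y := by
  filter_upwards [eventually_mem_chartAt_source (d := d) w, (tendsto_chartAt (d := d) w).eventually hζ] with y h1 h2
  exact contMDiffAt_pushField (isSmoothHomeo_chartAt (d := d) w).symm h1
    (contMDiffAt_vectorSpace_iff_contDiffAt.2 h2)

theorem eventually_fderiv_coordMap_coordField {p : W → M} (hp : ContMDiff (𝓡 d) (𝓡 m) ∞ p) (w : W)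
    (Z : VField d W) :
    ∀ᶠ y in 𝓝 (chartAt (EuclideanSpace ℝ (Fin d)) w w),
      fderiv ℝ (coordMap (m := m) p w) y (coordField Z w y) =
        (mfderiv (𝓡 m) (𝓡 m) (chartAt (EuclideanSpace ℝ (Fin m)) (p w))
          (p ((chartAt (EuclideanSpace ℝ (Fin d)) w).symm y))
          (mfderiv (𝓡 d) (𝓡 m) p ((chartAt (EuclideanSpace ℝ (Fin d)) w).symm y)
            (Z ((chartAt (EuclideanSpace ℝ (Fin d)) w).symm y))) : EuclideanSpace ℝ (Fin m)) := by
  filter_upwards [eventually_mem_chartAt_target (d := d) w, eventually_fderiv_coordMap hp w] with y h1 h2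
  rw [h2]
  have h3 := (isSmoothHomeo_chartAt (d := d) w).mfderiv_symm_mfderiv
    ((chartAt (EuclideanSpace ℝ (Fin d)) w).map_target h1)
    (Z ((chartAt (EuclideanSpace ℝ (Fin d)) w).symm y))
  rw [(chartAt (EuclideanSpace ℝ (Fin d)) w).right_inv h1] at h3
  exact congrArg _ (congrArg _ h3)

theorem eventually_mfderiv_fieldOfCoord {p : W → M} (hp : ContMDiff (𝓡 d) (𝓡 m) ∞ p) (w : W)
    (ζ : EuclideanSpace ℝ (Fin d) → EuclideanSpace ℝ (Fin d)) :
    ∀ᶠ y in 𝓝 w, (mfderiv (𝓡 m) (𝓡 m) (chartAt (EuclideanSpace ℝ (Fin m)) (p w)) (p y)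
        (mfderiv (𝓡 d) (𝓡 m) p y (fieldOfCoord ζ w y)) : EuclideanSpace ℝ (Fin m)) =
      fderiv ℝ (coordMap (m := m) p w) (chartAt (EuclideanSpace ℝ (Fin d)) w y)
        (ζ (chartAt (EuclideanSpace ℝ (Fin d)) w y)) := by
  filter_upwards [eventually_mem_chartAt_source (d := d) w,
    (tendsto_chartAt (d := d) w).eventually (eventually_fderiv_coordMap hp w)] with y h1 h2
  rw [h2, (chartAt (EuclideanSpace ℝ (Fin d)) w).left_inv h1]
  rfl

end Coordinates

/-! ### Minimal families of generators -/

section Rank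

variable {m : ℕ} {M : Type*} [TopologicalSpace M] [ChartedSpace (EuclideanSpace ℝ (Fin m)) M]
  [IsManifold (𝓡 m) ∞ M] (F : SingularFoliation m M)

theorem SingularFoliation.exists_generatesOn_rkAt (x : M) :
    ∃ U : Opens M, x ∈ U ∧ ∃ X : Fin (F.rkAt x) → VField m M, GeneratesOn F.sec U X := by
  have hne : {r | ∃ U : Opens M, x ∈ U ∧ ∃ X : Fin r → VField m M, GeneratesOn F.sec U X}.Nonempty := by
    obtain ⟨U, hx, r, X, hX⟩ := F.locally_fg x
    exact ⟨r, U, hx, X, hX⟩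
  exact Nat.sInf_mem hne

variable {F}

theorem SingularFoliation.rkAt_le {x : M} {r : ℕ} {U : Opens M} (hx : x ∈ U)
    {X : Fin r → VField m M} (hX : GeneratesOn F.sec U X) : F.rkAt x ≤ r :=
  Nat.sInf_le ⟨U, hx, X, hX⟩

/-- A generator that occurs with an invertible coefficient in a relation is superfluous. -/
theorem SingularFoliation.rkAt_le_of_relation {x : M} {r : ℕ} {U : Opens M} (hx : x ∈ U)
    {X : Fin (r + 1) → VField m M} (hX : GeneratesOn F.sec U X) {O : Opens M} (hxO : x ∈ O)
    {c : Fin (r + 1) → M → ℝ} (hc : ∀ i, SmoothFunOn m (c i) O)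
    (hrel : ∀ y ∈ O, ∑ i, c i y • X i y = 0) {i₀ : Fin (r + 1)} (hi₀ : c i₀ x ≠ 0) :
    F.rkAt x ≤ r := by
  have hne : ∀ᶠ y in 𝓝 x, y ∈ U ∧ y ∈ O ∧ c i₀ y ≠ 0 := by
    have hcont : ContinuousAt (c i₀) x := ((hc i₀).contMDiffAt (O.isOpen.mem_nhds hxO)).continuousAt
    filter_upwards [U.isOpen.mem_nhds hx, O.isOpen.mem_nhds hxO, hcont.eventually_ne hi₀] with y
      e1 e2 e3 using ⟨e1, e2, e3⟩
  obtain ⟨V, hxV, hV⟩ := exists_opens_of_eventually hne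
  have hVU : V ≤ U := fun y hy => (hV y hy).1
  refine F.rkAt_le hxV (X := fun j => X (i₀.succAbove j)) ⟨fun j => F.restrict U V hVU (hX.1 _), ?_⟩
  intro V' hV' Y hY
  obtain ⟨f, hf, hYf⟩ := hX.2 V' (hV'.trans hVU) Y hY
  refine ⟨fun j y => f (i₀.succAbove j) y - f i₀ y * ((c i₀ y)⁻¹ * c (i₀.succAbove j) y), ?_, ?_⟩
  · intro j y hy
    have h1 : ∀ i, ContMDiffAt (𝓡 m) 𝓘(ℝ, ℝ) ∞ (c i) y := fun i =>
      (hc i).contMDiffAt (O.isOpen.mem_nhds (hV y (hV' hy)).2.1)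
    have h2 : ∀ i, ContMDiffAt (𝓡 m) 𝓘(ℝ, ℝ) ∞ (f i) y := fun i =>
      (hf i).contMDiffAt (V'.isOpen.mem_nhds hy)
    have h3 : ContMDiffAt (𝓡 m) 𝓘(ℝ, ℝ) ∞ (fun y => (c i₀ y)⁻¹) y :=
      (contDiffAt_inv ℝ (hV y (hV' hy)).2.2).contMDiffAt.comp y (h1 i₀)
    exact ((h2 _).sub ((h2 _).mul (h3.mul (h1 _)))).contMDiffWithinAt
  · intro y hy
    have h0 := (hV y (hV' hy)).2.2
    have hr := hrel y (hV y (hV' hy)).2.1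
    rw [Fin.sum_univ_succAbove _ i₀] at hr
    have h1 : X i₀ y = -∑ j, ((c i₀ y)⁻¹ * c (i₀.succAbove j) y) • X (i₀.succAbove j) y := by
      have h2 := congrArg (fun v => (c i₀ y)⁻¹ • v) (eq_neg_of_add_eq_zero_left hr)
      simp only [smul_smul, inv_mul_cancel₀ h0, one_smul, smul_neg, Finset.smul_sum] at h2
      exact h2
    rw [hYf y hy, Fin.sum_univ_succAbove _ i₀, h1, smul_neg, Finset.smul_sum]
    simp only [sub_smul, Finset.sum_sub_distrib, smul_smul]
    abel

/-- A coefficient that is nonzero at x would make its generator superfluous near x, against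
minimality. This is the Nakayama-type independence that becomes `FiberData.indep`. -/
theorem SingularFoliation.coeff_eq_zero_of_relation {x : M} {U : Opens M} (hx : x ∈ U)
    {X : Fin (F.rkAt x) → VField m M} (hX : GeneratesOn F.sec U X) {O : Opens M} (hxO : x ∈ O)
    {c : Fin (F.rkAt x) → M → ℝ} (hc : ∀ i, SmoothFunOn m (c i) O)
    (hrel : ∀ y ∈ O, ∑ i, c i y • X i y = 0) (i : Fin (F.rkAt x)) : c i x = 0 := by
  by_contra hi
  -- The number of generators is replaced by a variable r, because X and c are indexed by `Fin
  -- (F.rkAt x)` and the index type cannot be split into zero and successor in place.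
  have key : ∀ (r : ℕ) (_ : F.rkAt x = r) (X : Fin r → VField m M) (_ : GeneratesOn F.sec U X)
      (c : Fin r → M → ℝ) (_ : ∀ i, SmoothFunOn m (c i) O)
      (_ : ∀ y ∈ O, ∑ i, c i y • X i y = 0) (i : Fin r), c i x ≠ 0 → False := by
    intro r hr X hX c hc hrel i hi
    cases r with
    | zero => exact i.elim0
    | succ r =>
      have := F.rkAt_le_of_relation hx hX hxO hc hrel hi
      omega
  exact key _ rfl X hX c hc hrel i hi

end Rank

/-! ### Local sections of submersions -/

section LocalSection

variable {E F : Type*} [NormedAddCommGroup E] [NormedSpace ℝ E]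
  [NormedAddCommGroup F] [NormedSpace ℝ F] [FiniteDimensional ℝ F]

/-- Smooth local sections of a submersion. -/
theorem exists_local_section {P : E → F} {x₀ : E} (hP : SmoothNear P x₀)
    (hPs : Function.Surjective (fderiv ℝ P x₀)) :
    ∃ σ : F → E, SmoothNear σ (P x₀) ∧ σ (P x₀) = x₀ ∧ ∀ᶠ c in 𝓝 (P x₀), P (σ c) = c := by
  have : CompleteSpace F := FiniteDimensional.complete ℝ F
  obtain ⟨R₀, hR₀⟩ := (fderiv ℝ P x₀).toLinearMap.exists_rightInverse_of_surjective
    (LinearMap.range_eq_top.2 hPs)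
  let R : F →L[ℝ] E := LinearMap.toContinuousLinearMap R₀
  let j : F → E := fun c => x₀ + R c
  have hj : ContDiff ℝ ∞ j := contDiff_const.add R.contDiff
  have hj₀ : j 0 = x₀ := by simp [j]
  have hjt : Filter.Tendsto j (𝓝 0) (𝓝 x₀) := hj.continuous.tendsto' _ _ hj₀
  have hg : ∀ᶠ c in 𝓝 0, ContDiffAt ℝ ∞ (fun c => P (j c)) c :=
    (hjt.eventually hP).mono fun c hc => hc.comp c hj.contDiffAt
  have hg' : HasFDerivAt (fun c => P (j c)) ((ContinuousLinearEquiv.refl ℝ F : F ≃L[ℝ] F) : F →L[ℝ] F)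
      0 := by
    have h1 : HasFDerivAt P (fderiv ℝ P x₀) (j 0) := by
      rw [hj₀]; exact (hP.self_of_nhds.differentiableAt (by simp)).hasFDerivAt
    refine (h1.comp 0 (R.hasFDerivAt.const_add x₀)).congr_fderiv ?_
    ext v
    exact LinearMap.congr_fun hR₀ v
  obtain ⟨Φ, h0, -, hΦ, -, hΦs⟩ := exists_openPartialHomeomorph_of_smooth hg hg' Filter.univ_mem
  have hΦ0 : Φ 0 = P x₀ := by rw [hΦ]; simp only [hj₀]
  have htar : P x₀ ∈ Φ.target := by rw [← hΦ0]; exact Φ.map_source h0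
  have hev := Φ.open_target.mem_nhds htar
  refine ⟨fun c => j (Φ.symm c), ?_, ?_, ?_⟩
  · filter_upwards [hev] with c hc using hj.contDiffAt.comp c (hΦs c hc)
  · simp only [← hΦ0, Φ.left_inv h0, hj₀]
  · filter_upwards [hev] with c hc
    have := Φ.right_inv hc
    rw [hΦ] at this
    exact this

end LocalSection

/-! ### Pointwise ranks of the two foliations of a bi-submersion -/

section Extraction

set_option linter.unusedSectionVars false

variable {d m n : ℕ} {W : Type*} [TopologicalSpace W] [ChartedSpace (EuclideanSpace ℝ (Fin d)) W]
  [IsManifold (𝓡 d) ∞ W] {M : Type*} [TopologicalSpace M]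
  [ChartedSpace (EuclideanSpace ℝ (Fin m)) M] [IsManifold (𝓡 m) ∞ M]
  {N : Type*} [TopologicalSpace N] [ChartedSpace (EuclideanSpace ℝ (Fin n)) N]
  [IsManifold (𝓡 n) ∞ N]
  {FM : SingularFoliation m M} {FN : SingularFoliation n N} {p : W → M} {q : W → N}

theorem kerSumSec_swap (O : Opens W) :
    kerSumSec (d := d) m n p q O = kerSumSec (d := d) n m q p O := by
  ext Z
  constructor <;> rintro ⟨ξ, ζ, h1, h2, h3, h4, h5⟩ <;>
    exact ⟨ζ, ξ, h2, h1, h4, h3, fun y hy => by rw [h5 y hy, add_comm]⟩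

theorem IsPureBiSubmersion.swap (h : IsPureBiSubmersion (d := d) FM FN p q) :
    IsPureBiSubmersion (d := d) FN FM q p where
  smooth_left := h.smooth_right
  smooth_right := h.smooth_left
  submersion_left := h.submersion_right
  submersion_right := h.submersion_left
  pullback_eq O := (h.pullback_eq O).symm
  pullback_eq_kerSum O := by
    rw [← h.pullback_eq, h.pullback_eq_kerSum, kerSumSec_swap]

theorem surjective_fderiv_coordMap (hp : ContMDiff (𝓡 d) (𝓡 m) ∞ p) {w : W}
    (hs : Function.Surjective (mfderiv (𝓡 d) (𝓡 m) p w)) :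
    Function.Surjective (fderiv ℝ (coordMap (m := m) p w)
      (chartAt (EuclideanSpace ℝ (Fin d)) w w)) := by
  intro v
  have h1 := (eventually_fderiv_coordMap hp w).self_of_nhds
  have hw := mem_chart_source (EuclideanSpace ℝ (Fin d)) w
  rw [(chartAt (EuclideanSpace ℝ (Fin d)) w).left_inv hw] at h1
  obtain ⟨a, ha⟩ := (isSmoothHomeo_chartAt (d := m) (p w)).mfderiv_surjective
    (mem_chart_source _ (p w)) v
  obtain ⟨b, hb⟩ := hs a
  obtain ⟨c, hc⟩ := (isSmoothHomeo_chartAt (d := d) w).symm.mfderiv_surjective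
    ((chartAt (EuclideanSpace ℝ (Fin d)) w).map_source hw) b
  refine ⟨c, (h1 c).trans ?_⟩
  rw [← ha, ← hb]
  exact congrArg _ (congrArg _ hc)

/-- The images under `Tp` of vector fields tangent to the fibres of `q` generate the pull-back of
`F_M`, in the coordinates at `w`. -/
theorem IsPureBiSubmersion.exists_fiberData (h : IsPureBiSubmersion (d := d) FM FN p q) (w : W) :
    ∃ X : Fin (FM.rkAt (p w)) → EuclideanSpace ℝ (Fin d) → EuclideanSpace ℝ (Fin m),
      FiberData (coordMap (m := m) p w) (coordMap (m := n) q w)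
        (chartAt (EuclideanSpace ℝ (Fin d)) w w) X := by
  obtain ⟨U₀, hU₀, X, hX⟩ := FM.exists_generatesOn_rkAt (p w)
  let φ := chartAt (EuclideanSpace ℝ (Fin d)) w
  let ψ := chartAt (EuclideanSpace ℝ (Fin m)) (p w)
  let χ := chartAt (EuclideanSpace ℝ (Fin n)) (q w)
  have hp := h.smooth_left
  have hq := h.smooth_right
  have hpc : Filter.Tendsto p (𝓝 w) (𝓝 (p w)) := hp.continuous.continuousAt
  let X' : Fin (FM.rkAt (p w)) → EuclideanSpace ℝ (Fin d) → EuclideanSpace ℝ (Fin m) :=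
    fun i y => (mfderiv (𝓡 m) (𝓡 m) ψ (p (φ.symm y)) (X i (p (φ.symm y))) :
      EuclideanSpace ℝ (Fin m))
  have hPs := surjective_fderiv_coordMap hp (h.submersion_left w)
  have hP := smoothNear_coordMap hp w
  have hP₀ : coordMap (m := m) p w (φ w) = ψ (p w) := by
    simp only [coordMap, φ, φ.left_inv (mem_chart_source _ w)]
    rfl
  have hφw : φ.symm (φ w) = w := φ.left_inv (mem_chart_source _ w)
  have hinjM : ∀ᶠ x in 𝓝 (p w), Function.Injective (mfderiv (𝓡 m) (𝓡 m) ψ x) :=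
    (eventually_mem_chartAt_source (d := m) (p w)).mono fun x hx =>
      (isSmoothHomeo_chartAt (d := m) (p w)).mfderiv_injective hx
  have hinjN : ∀ᶠ x in 𝓝 (q w), Function.Injective (mfderiv (𝓡 n) (𝓡 n) χ x) :=
    (eventually_mem_chartAt_source (d := n) (q w)).mono fun x hx =>
      (isSmoothHomeo_chartAt (d := n) (q w)).mfderiv_injective hx
  have hX' : ∀ i, SmoothNear (X' i) (φ w) := by
    intro i
    have h1 : SmoothNear (coordField (X i) (p w)) (ψ (p w)) :=
      smoothNear_coordField hU₀ (FM.smooth _ _ (hX.1 i))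
    have hPt : Filter.Tendsto (coordMap (m := m) p w) (𝓝 (φ w)) (𝓝 (ψ (p w))) := by
      rw [← hP₀]; exact hP.self_of_nhds.continuousAt
    have h2 : SmoothNear (fun y => coordField (X i) (p w) (coordMap (m := m) p w y)) (φ w) := by
      filter_upwards [hP, hPt.eventually h1] with y e1 e2 using e2.comp y e1
    filter_upwards [h2.eventually_nhds, (eventually_coordMap_mem (m := m) (w := w)
      hp.continuous).eventually_nhds] with y e1 e2
    refine e1.self_of_nhds.congr_of_eventuallyEq ?_
    filter_upwards [e2] with y' e3
    simp only [X', coordField, pushField, coordMap]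
    rw [(chartAt (EuclideanSpace ℝ (Fin m)) (p w)).left_inv e3]
    rfl
  refine ⟨X', ?_, ?_, ?_⟩
  · intro i
    -- A right inverse of Tp first lifts X i ∘ p to some field Z of p⁻¹(F_M), which need not be
    -- tangent to the fibres of q.
    obtain ⟨R, hR, hR'⟩ := exists_smooth_rightInverse_fderiv hP hPs
    have hl : SmoothNear (fun y => R y (X' i y)) (φ w) := hR.clm_apply (hX' i)
    let Z : VField d W := fieldOfCoord (fun y => R y (X' i y)) w
    have hZp : ∀ᶠ y in 𝓝 w, mfderiv (𝓡 d) (𝓡 m) p y (Z y) = X i (p y) := by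
      filter_upwards [eventually_mfderiv_fieldOfCoord hp w (fun y => R y (X' i y)),
        (tendsto_chartAt (d := d) w).eventually hR', hpc.eventually hinjM,
        eventually_mem_chartAt_source (d := d) w] with y e1 e2 e3 e4
      apply e3
      refine e1.trans ((e2 _).trans ?_)
      simp only [X']
      rw [φ.left_inv e4]
    obtain ⟨O, hwO, hO⟩ := exists_opens_of_eventually
      (hZp.and ((contMDiffAt_fieldOfCoord hl).and (hpc.eventually (U₀.isOpen.mem_nhds hU₀))))
    have hmem : Z ∈ pullbackSec (d := d) FM p O := by
      refine ⟨fun y hy => (hO y hy).2.1.contMDiffWithinAt, fun y hy => ⟨O, hy, le_rfl, U₀,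
        fun y hy => (hO y hy).2.2, 1, fun _ => X i, fun _ _ => 1, fun _ => hX.1 i,
        fun _ => contMDiffOn_const, fun y hy => ?_⟩⟩
      rw [(hO y hy).1]
      simp
    -- Decompose Z = ξ + ζ with ξ in ker Tp and ζ in ker Tq. Dropping ξ does not change the image
    -- under Tp, so ζ is the required lift.
    rw [h.pullback_eq_kerSum] at hmem
    obtain ⟨ξ, ζ, hξ, hζ, hξp, hζq, hsum⟩ := hmem
    refine ⟨coordField ζ w, smoothNear_coordField hwO hζ, ?_, ?_⟩
    · filter_upwards [eventually_fderiv_coordMap_coordField hq w ζ,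
        (tendsto_chartAt_symm (d := d) w).eventually (O.isOpen.mem_nhds hwO)] with y e1 e2
      rw [e1, hζq _ e2]
      exact map_zero _
    · filter_upwards [eventually_fderiv_coordMap_coordField hp w ζ,
        (tendsto_chartAt_symm (d := d) w).eventually (O.isOpen.mem_nhds hwO)] with y e1 e2
      rw [e1]
      have e3 := (hO _ e2).1
      rw [hsum _ e2, map_add, hξp _ e2, zero_add] at e3
      rw [e3]
  · intro ζ' hζ' hQζ'
    let ζ : VField d W := fieldOfCoord ζ' w
    have hζq : ∀ᶠ y in 𝓝 w, mfderiv (𝓡 d) (𝓡 n) q y (ζ y) = 0 := by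
      filter_upwards [eventually_mfderiv_fieldOfCoord hq w ζ',
        (tendsto_chartAt (d := d) w).eventually hQζ',
        hq.continuous.continuousAt.eventually hinjN] with y e1 e2 e3
      apply e3
      rw [map_zero]
      exact e1.trans e2
    obtain ⟨O, hwO, hO⟩ := exists_opens_of_eventually (hζq.and (contMDiffAt_fieldOfCoord hζ'))
    -- A field tangent to the fibres of q belongs to the sum of the kernels, hence to p⁻¹(F_M); its
    -- image under Tp can then be rewritten in the chosen generators.
    have hmem : ζ ∈ kerSumSec (d := d) m n p q O := by
      refine ⟨fun _ => 0, ζ, ?_, fun y hy => (hO y hy).2.contMDiffWithinAt, fun y hy => map_zero _,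
        fun y hy => (hO y hy).1, fun y hy => (zero_add _).symm⟩
      exact ((Bundle.contMDiff_zeroSection ℝ (TangentSpace (𝓡 d) (M := W))).contMDiffOn)
    rw [← h.pullback_eq_kerSum] at hmem
    obtain ⟨O', hwO', hO'O, U, hU, r, Y, f, hY, hf, hsum⟩ := hmem.2 w hwO
    choose g hg hYg using fun i => hX.2 (U ⊓ U₀) inf_le_right (Y i)
      (FM.restrict U _ inf_le_left (hY i))
    have hpw : p w ∈ U ⊓ U₀ := ⟨hU w hwO', hU₀⟩
    refine ⟨fun j y => ∑ i, f i (φ.symm y) * g i j (p (φ.symm y)), fun j => ?_, ?_⟩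
    · refine SmoothNear.sum fun i => SmoothNear.mul ?_ ?_
      · refine smoothNear_comp_chartAt_symm (g := f i) ?_
        filter_upwards [O'.isOpen.mem_nhds hwO'] with y hy
        exact (hf i).contMDiffAt (O'.isOpen.mem_nhds hy)
      · refine smoothNear_comp_chartAt_symm (g := fun y => g i j (p y)) ?_
        filter_upwards [hpc.eventually ((U ⊓ U₀).isOpen.mem_nhds hpw)] with y hy
        exact ((hg i j).contMDiffAt ((U ⊓ U₀).isOpen.mem_nhds hy)).comp y hp.contMDiffAt
    · have hall : ∀ᶠ y in 𝓝 w, mfderiv (𝓡 d) (𝓡 m) p y (ζ y) =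
          ∑ j, (∑ i, f i y * g i j (p y)) • X j (p y) := by
        filter_upwards [O'.isOpen.mem_nhds hwO',
          hpc.eventually ((U ⊓ U₀).isOpen.mem_nhds hpw)] with y e1 e2
        rw [hsum y e1]
        simp only [hYg _ _ e2, Finset.smul_sum, Finset.sum_smul, smul_smul]
        exact Finset.sum_comm
      filter_upwards [eventually_mem_chartAt_target (d := d) w,
        (tendsto_chartAt_symm (d := d) w).eventually hall,
        (tendsto_chartAt_symm (d := d) w).eventually
          (eventually_mfderiv_fieldOfCoord hp w ζ')] with y e1 e2 e3
      rw [(chartAt (EuclideanSpace ℝ (Fin d)) w).right_inv e1] at e3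
      rw [← e3]
      refine (congrArg _ e2).trans ?_
      rw [map_sum]
      simp only [map_smul]
      rfl
  · intro b hb hrel i
    -- Restricted to a local section of p through w, a relation between the X i ∘ p becomes a
    -- relation between the generators on M, to which minimality applies.
    obtain ⟨σ, hσ, hσ₀, hPσ⟩ := exists_local_section hP hPs
    rw [hP₀] at hσ hσ₀ hPσ
    have hσt : Filter.Tendsto (fun x => σ (ψ x)) (𝓝 (p w)) (𝓝 (φ w)) := by
      have h1 : Filter.Tendsto σ (𝓝 (ψ (p w))) (𝓝 (φ w)) := by
        have := hσ.self_of_nhds.continuousAt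
        rwa [ContinuousAt, hσ₀] at this
      exact h1.comp (tendsto_chartAt (d := m) (p w))
    have hpσ : ∀ᶠ x in 𝓝 (p w), p (φ.symm (σ (ψ x))) = x := by
      filter_upwards [(tendsto_chartAt (d := m) (p w)).eventually hPσ,
        eventually_mem_chartAt_source (d := m) (p w),
        hσt.eventually (eventually_coordMap_mem (m := m) (w := w) hp.continuous)] with x e1 e2 e3
      exact ψ.injOn e3 e2 e1
    have hsm : ∀ᶠ x in 𝓝 (p w), ∀ i, ContMDiffAt (𝓡 m) 𝓘(ℝ, ℝ) ∞ (fun x => b i (σ (ψ x))) x := by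
      filter_upwards [(tendsto_chartAt (d := m) (p w)).eventually hσ,
        eventually_mem_chartAt_source (d := m) (p w),
        hσt.eventually (Filter.eventually_all.2 hb)] with x e1 e2 e3 i
      exact ((e3 i).contMDiffAt.comp _ e1.contMDiffAt).comp x
        ((isSmoothHomeo_chartAt (d := m) (p w)).contMDiffAt e2)
    have hrel' : ∀ᶠ x in 𝓝 (p w), ∑ i, b i (σ (ψ x)) • X i x = 0 := by
      filter_upwards [hpσ, hσt.eventually hrel, hinjM] with x e1 e2 e3
      apply e3
      rw [map_sum, map_zero]
      simp only [map_smul]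
      have e4 : ∀ i, X' i (σ (ψ x)) = mfderiv (𝓡 m) (𝓡 m) ψ x (X i x) := by
        intro i
        simp only [X']
        rw [e1]
      simp only [e4] at e2
      exact e2
    obtain ⟨O, hxO, hO⟩ := exists_opens_of_eventually (hsm.and hrel')
    have := FM.coeff_eq_zero_of_relation hU₀ hX hxO (c := fun i x => b i (σ (ψ x)))
      (fun i x hx => ((hO x hx).1 i).contMDiffWithinAt) (fun x hx => (hO x hx).2) i
    rwa [hσ₀] at this

/-- The generators at p(w) lift to independent vectors in ker T_w q, which has dimension d - n. -/
theorem IsPureBiSubmersion.rkAt_add_le (h : IsPureBiSubmersion (d := d) FM FN p q) (w : W) :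
    FM.rkAt (p w) + n ≤ d := by
  obtain ⟨X, hX⟩ := h.exists_fiberData w
  simpa using hX.card_add_finrank_le (smoothNear_coordMap h.smooth_right w)
    (surjective_fderiv_coordMap h.smooth_right (h.submersion_right w))

theorem IsPureBiSubmersion.rkAt_add_le_rkAt_add (h : IsPureBiSubmersion (d := d) FM FN p q) (w : W) :
    FM.rkAt (p w) + n ≤ FN.rkAt (q w) + m := by
  obtain ⟨X, hX⟩ := h.exists_fiberData w
  obtain ⟨Y, hY⟩ := h.swap.exists_fiberData w
  simpa using hX.card_add_finrank_le_card_add_finrank hY (smoothNear_coordMap h.smooth_left w)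
    (smoothNear_coordMap h.smooth_right w)
    (surjective_fderiv_coordMap h.smooth_left (h.submersion_left w))
    (surjective_fderiv_coordMap h.smooth_right (h.submersion_right w))

/-- Both sides equal d minus the dimension of the space of values at w of fields tangent to the
fibres of p and of q. The two inequalities come from one lemma by exchanging the roles of p and q.
-/
theorem IsPureBiSubmersion.rkAt_add_eq (h : IsPureBiSubmersion (d := d) FM FN p q) (w : W) :
    FM.rkAt (p w) + n = FN.rkAt (q w) + m :=
  le_antisymm (h.rkAt_add_le_rkAt_add w) (h.swap.rkAt_add_le_rkAt_add w)

end Extraction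

/-! ### Anchored bundles bound the rank -/

section Anchored

variable {m : ℕ} {M : Type*} [TopologicalSpace M] [ChartedSpace (EuclideanSpace ℝ (Fin m)) M]
  [IsManifold (𝓡 m) ∞ M] {F : SingularFoliation m M} {r : ℕ}

attribute [local instance] AnchoredBundle.topTotal AnchoredBundle.addCommGroup AnchoredBundle.module
  AnchoredBundle.top AnchoredBundle.fiberBundle AnchoredBundle.vectorBundle
  AnchoredBundle.smoothBundle

/-- The images of a local frame of an anchored bundle generate the foliation. -/
theorem AnchoredBundle.rkAt_le (A : AnchoredBundle.{v} F r) (x : M) : F.rkAt x ≤ r := by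
  let e := trivializationAt (EuclideanSpace ℝ (Fin r)) A.E x
  let b := (EuclideanSpace.basisFun (Fin r) ℝ).toBasis
  have : ContMDiffVectorBundle 1 (EuclideanSpace ℝ (Fin r)) A.E (𝓡 m) :=
    ContMDiffVectorBundle.of_le (n := ∞) (by simp)
  let U : Opens M := ⟨e.baseSet, e.open_baseSet⟩
  have hxU : x ∈ U := FiberBundle.mem_baseSet_trivializationAt' x
  refine F.rkAt_le hxU (X := fun i y => A.ρ y (e.localFrame b i y)) ⟨fun i => ?_, fun V hV Y hY => ?_⟩
  · exact (A.image_eq U _).2 ⟨e.localFrame b i, e.contMDiffOn_localFrame_baseSet ∞ b i,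
      fun y _ => rfl⟩
  · obtain ⟨s, hs, hYs⟩ := (A.image_eq V Y).1 hY
    refine ⟨fun i y => e.localFrameCoeff (𝓡 m) b i y (s y), fun i => ?_, fun y hy => ?_⟩
    · exact contMDiffOn_localFrameCoeff b V.isOpen hV hs i
    · rw [hYs y hy]
      conv_lhs => rw [e.eq_sum_localFrameCoeff_smul (I := 𝓡 m) (b := b) (s := s) (hV hy)]
      rw [map_sum]
      simp only [map_smul]

end Anchored

/-! ### Charts in which p and q do not depend on the second factor -/

section Sliced

variable {d m n k l : ℕ} {W : Type*} [TopologicalSpace W] [ChartedSpace (EuclideanSpace ℝ (Fin d)) W]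
  {M N : Type*}

/-- A smooth parametrization of an open subset of `W` by a subset of `ℝᵏ × ℝˡ` such that `p` and `q`
do not depend on the second variable. -/
structure IsSliced (p : W → M) (q : W → N)
    (Ψ : OpenPartialHomeomorph (EuclideanSpace ℝ (Fin k) × EuclideanSpace ℝ (Fin l)) W) : Prop where
  smooth : IsSmoothHomeo 𝓘(ℝ, EuclideanSpace ℝ (Fin k) × EuclideanSpace ℝ (Fin l)) (𝓡 d) Ψ
  left : ∀ s t t', (s, t) ∈ Ψ.source → (s, t') ∈ Ψ.source → p (Ψ (s, t)) = p (Ψ (s, t'))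
  right : ∀ s t t', (s, t) ∈ Ψ.source → (s, t') ∈ Ψ.source → q (Ψ (s, t)) = q (Ψ (s, t'))

variable [IsManifold (𝓡 d) ∞ W] [TopologicalSpace M]
  [ChartedSpace (EuclideanSpace ℝ (Fin m)) M] [IsManifold (𝓡 m) ∞ M]
  [TopologicalSpace N] [ChartedSpace (EuclideanSpace ℝ (Fin n)) N]
  [IsManifold (𝓡 n) ∞ N]
  {FM : SingularFoliation m M} {FN : SingularFoliation n N} {p : W → M} {q : W → N}

/-- The rank bound leaves l = d - k independent fields tangent to both families of fibres, and
straightening them for the pair (p, q) gives the chart. The source is arranged to be a ball so that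
boxes of any smaller radius can be cut out of it. -/
theorem IsPureBiSubmersion.exists_isSliced (h : IsPureBiSubmersion (d := d) FM FN p q) (w : W)
    (hk : FM.rkAt (p w) + n ≤ k) (hd : d = k + l) :
    ∃ (Ψ : OpenPartialHomeomorph (EuclideanSpace ℝ (Fin k) × EuclideanSpace ℝ (Fin l)) W),
      IsSliced (d := d) p q Ψ ∧ (∃ R > 0, Ψ.source = Metric.ball 0 R) ∧ Ψ 0 = w := by
  obtain ⟨X, hX⟩ := h.exists_fiberData w
  have hP := smoothNear_coordMap h.smooth_left w
  have hQ := smoothNear_coordMap h.smooth_right w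
  let φ := chartAt (EuclideanSpace ℝ (Fin d)) w
  obtain ⟨z, hz, hli, hzP, hzQ⟩ := hX.exists_independent_fields (l := l) hQ
    (surjective_fderiv_coordMap h.smooth_right (h.submersion_right w)) (by simp; omega)
  have hf : ∀ᶠ y in 𝓝 (φ w), DifferentiableAt ℝ
      (fun y => (coordMap (m := m) p w y, coordMap (m := n) q w y)) y := by
    filter_upwards [hP, hQ] with y e1 e2
    exact (e1.differentiableAt (by simp)).prodMk (e2.differentiableAt (by simp))
  obtain ⟨Φ, h0, hΦ0, hΦs, hΦs', hconst⟩ := exists_straightening (k := k) (by simp; omega) hz hli hf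
    (fun c => by
      filter_upwards [hzP c, hzQ c, hP, hQ] with y e1 e2 e3 e4
      rw [(e3.differentiableAt (by simp)).fderiv_prodMk (e4.differentiableAt (by simp))]
      simp [e1, e2])
  let Ψ₀ := Φ.trans φ.symm
  have hΨ₀0 : (0 : EuclideanSpace ℝ (Fin k) × EuclideanSpace ℝ (Fin l)) ∈ Ψ₀.source := by
    refine ⟨h0, ?_⟩
    change Φ 0 ∈ φ.target
    rw [hΦ0]
    exact φ.map_source (mem_chart_source _ w)
  have hΨ₀w : Ψ₀ 0 = w := by
    change φ.symm (Φ 0) = w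
    rw [hΦ0]; exact φ.left_inv (mem_chart_source _ w)
  have hΦt : Filter.Tendsto Φ (𝓝 0) (𝓝 (φ w)) := by
    have := Φ.continuousAt h0
    rwa [ContinuousAt, hΦ0] at this
  have hev : ∀ᶠ a in 𝓝 (0 : EuclideanSpace ℝ (Fin k) × EuclideanSpace ℝ (Fin l)), a ∈ Ψ₀.source ∧
      (coordMap (m := m) p w (Φ a), coordMap (m := n) q w (Φ a)) =
        (coordMap (m := m) p w (Φ (a.1, 0)), coordMap (m := n) q w (Φ (a.1, 0))) ∧
      p (φ.symm (Φ a)) ∈ (chartAt (EuclideanSpace ℝ (Fin m)) (p w)).source ∧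
      q (φ.symm (Φ a)) ∈ (chartAt (EuclideanSpace ℝ (Fin n)) (q w)).source :=
    (Ψ₀.open_source.eventually_mem hΨ₀0).and (hconst.and
      ((hΦt.eventually (eventually_coordMap_mem (m := m) h.smooth_left.continuous)).and
        (hΦt.eventually (eventually_coordMap_mem (m := n) h.smooth_right.continuous))))
  obtain ⟨R, hR, hball⟩ := Metric.eventually_nhds_iff_ball.1 hev
  have hsrc : (Ψ₀.restrOpen (Metric.ball 0 R) Metric.isOpen_ball).source = Metric.ball 0 R := by
    rw [OpenPartialHomeomorph.restrOpen_source]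
    exact Set.inter_eq_right.2 fun a ha => (hball a ha).1
  -- Balls for the max norm of the product contain (s, 0) with (s, t), so all points of a fibre can
  -- be compared with the point at height 0.
  have hslice : ∀ s t, (s, t) ∈ Metric.ball
      (0 : EuclideanSpace ℝ (Fin k) × EuclideanSpace ℝ (Fin l)) R → (s, 0) ∈ Metric.ball
      (0 : EuclideanSpace ℝ (Fin k) × EuclideanSpace ℝ (Fin l)) R := by
    intro s t ha
    rw [mem_ball_zero_iff, Prod.norm_def] at ha ⊢
    refine lt_of_le_of_lt ?_ ha
    simp
  have hp0 : ∀ s t, (s, t) ∈ Metric.ball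
      (0 : EuclideanSpace ℝ (Fin k) × EuclideanSpace ℝ (Fin l)) R →
      p (Ψ₀ (s, t)) = p (Ψ₀ (s, 0)) ∧ q (Ψ₀ (s, t)) = q (Ψ₀ (s, 0)) := by
    intro s t ha
    have h1 := hball _ ha
    have h2 := hball _ (hslice s t ha)
    exact ⟨(chartAt (EuclideanSpace ℝ (Fin m)) (p w)).injOn h1.2.2.1 h2.2.2.1 (Prod.ext_iff.1 h1.2.1).1,
      (chartAt (EuclideanSpace ℝ (Fin n)) (q w)).injOn h1.2.2.2 h2.2.2.2 (Prod.ext_iff.1 h1.2.1).2⟩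
  refine ⟨Ψ₀.restrOpen (Metric.ball 0 R) Metric.isOpen_ball, ⟨⟨?_, ?_⟩, ?_, ?_⟩, ⟨R, hR, hsrc⟩, hΨ₀w⟩
  · rw [hsrc]
    intro a ha
    have h1 := (hball a ha).1
    exact (((isSmoothHomeo_chartAt (d := d) w).symm.contMDiffAt h1.2).comp a
      (hΦs a h1.1).contMDiffAt).contMDiffWithinAt
  · intro y hy
    have hy' : y ∈ Ψ₀.target := hy.1
    rw [OpenPartialHomeomorph.trans_target] at hy'
    exact ((hΦs' _ hy'.2).contMDiffAt.comp y
      ((isSmoothHomeo_chartAt (d := d) w).contMDiffAt hy'.1)).contMDiffWithinAt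
  · rw [hsrc]
    intro s t t' h1 h2
    exact (hp0 s t h1).1.trans (hp0 s t' h2).1.symm
  · rw [hsrc]
    intro s t t' h1 h2
    exact (hp0 s t h1).2.trans (hp0 s t' h2).2.symm

end Sliced

/-! ### Small spheres contain no segments of other charts -/

section Thin

variable {A B : Type*} [NormedAddCommGroup A] [InnerProductSpace ℝ A]
  [NormedAddCommGroup B] [NormedSpace ℝ B]

/-- A curve with velocity `v` and acceleration `u` that stays on a sphere of radius `ρ` satisfies
`‖v‖² ≤ ρ ‖u‖`. -/
theorem sq_norm_velocity_le_of_mem_sphere {γ v u : ℝ → A × B} {t₀ ρ : ℝ} {a : A} {b : B}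
    (hγ : ∀ᶠ t in 𝓝 t₀, HasDerivAt γ (v t) t) (hv : HasDerivAt v (u t₀) t₀)
    (h : ∀ᶠ t in 𝓝 t₀, ‖(γ t).1 - a‖ = ρ ∧ (γ t).2 = b) : ‖v t₀‖ ^ 2 ≤ ρ * ‖u t₀‖ := by
  have h2 : (v t₀).2 = 0 := by
    have h3 : HasDerivAt (fun t => (γ t).2) (v t₀).2 t₀ := hγ.self_of_nhds.snd
    refine h3.unique ?_
    exact (hasDerivAt_const t₀ b).congr_of_eventuallyEq (h.mono fun t ht => ht.2)
  have h1 : ∀ᶠ t in 𝓝 t₀, inner ℝ ((γ t).1 - a) (v t).1 = 0 := by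
    filter_upwards [hγ, h.eventually_nhds] with t e1 e2
    have e3 : HasDerivAt (fun t => (γ t).1 - a) (v t).1 t := e1.fst.sub_const a
    have e4 := e3.inner ℝ e3
    have e5 := e4.unique ((hasDerivAt_const t (ρ ^ 2)).congr_of_eventuallyEq (e2.mono fun t ht => by
      simp only [real_inner_self_eq_norm_sq, ht.1]))
    rw [real_inner_comm] at e5
    have e6 := real_inner_comm (v t).1 ((γ t).1 - a)
    linarith
  have h4 : HasDerivAt (fun t => inner ℝ ((γ t).1 - a) (v t).1)
      (inner ℝ ((γ t₀).1 - a) (u t₀).1 + inner ℝ (v t₀).1 (v t₀).1) t₀ := by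
    have h6 : HasDerivAt (fun t => (γ t).1 - a) (v t₀).1 t₀ := hγ.self_of_nhds.fst.sub_const a
    have h7 : HasDerivAt (fun t => (v t).1) (u t₀).1 t₀ := hv.fst
    exact h6.inner ℝ h7
  have h5 := h4.unique ((hasDerivAt_const t₀ (0 : ℝ)).congr_of_eventuallyEq h1)
  rw [real_inner_self_eq_norm_sq] at h5
  have h6 : ‖v t₀‖ = ‖(v t₀).1‖ := by
    rw [Prod.norm_def, h2, norm_zero]
    exact max_eq_left (norm_nonneg _)
  have h7 := abs_le.1 (abs_real_inner_le_norm ((γ t₀).1 - a) (u t₀).1)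
  rw [h.self_of_nhds.1] at h7
  have h8 : ρ * ‖(u t₀).1‖ ≤ ρ * ‖u t₀‖ := by
    refine mul_le_mul_of_nonneg_left (norm_fst_le _) ?_
    rw [← h.self_of_nhds.1]; exact norm_nonneg _
  rw [h6]
  linarith [h7.1]

variable {W : Type*} [TopologicalSpace W] [T2Space W]

/-- Small spheres in slices of one chart contain no segments of another chart. -/
theorem exists_radius_of_thin {Ψ Ψ' : OpenPartialHomeomorph (A × B) W}
    (h : ContDiffOn ℝ ∞ (Ψ.trans Ψ'.symm) (Ψ.trans Ψ'.symm).source)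
    (h' : ContDiffOn ℝ ∞ (Ψ'.trans Ψ.symm) (Ψ'.trans Ψ.symm).source)
    {C C' : Set (A × B)} (hC : IsCompact C) (hCs : C ⊆ Ψ.source) (hC' : IsCompact C')
    (hCs' : C' ⊆ Ψ'.source) {e : B} (he : e ≠ 0) :
    ∃ ρ₀ > 0, ∀ ρ ≤ ρ₀, ∀ (a : A) (b : B) (s : A) (t₀ : ℝ),
      ¬ ∀ᶠ t in 𝓝 t₀, (s, t • e) ∈ C ∧
        ∃ x, ‖x - a‖ = ρ ∧ (x, b) ∈ C' ∧ Ψ (s, t • e) = Ψ' (x, b) := by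
  let Θ : A × B → A × B := fun z => Ψ'.symm (Ψ z)
  let O := (Ψ.trans Ψ'.symm).source
  have hO : IsOpen O := (Ψ.trans Ψ'.symm).open_source
  have hΘ : ContDiffOn ℝ ∞ Θ O := h
  let D : Set (A × B) := C ∩ Ψ ⁻¹' (Ψ' '' C')
  have hD : IsCompact D := by
    refine hC.of_isClosed_subset ?_ Set.inter_subset_left
    exact (Ψ.continuousOn.mono hCs).preimage_isClosed_of_isClosed hC.isClosed
      (hC'.image_of_continuousOn (Ψ'.continuousOn.mono hCs')).isClosed
  have hDO : D ⊆ O := by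
    rintro z ⟨hz, y, hy, hyz⟩
    refine ⟨hCs hz, ?_⟩
    change Ψ z ∈ Ψ'.target
    rw [← hyz]
    exact Ψ'.map_source (hCs' hy)
  let v : A × B → A × B := fun z => fderiv ℝ Θ z (0, e)
  let u : A × B → A × B := fun z => fderiv ℝ v z (0, e)
  have hΘ1 : ContDiffOn ℝ ∞ (fderiv ℝ Θ) O := hΘ.fderiv_of_isOpen hO (by simp)
  have hv : ContDiffOn ℝ ∞ v O := hΘ1.clm_apply contDiffOn_const
  have hv1 : ContDiffOn ℝ ∞ (fderiv ℝ v) O := hv.fderiv_of_isOpen hO (by simp)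
  have hu : ContinuousOn u O := hv1.continuousOn.clm_apply continuousOn_const
  -- The transition map Θ has a differentiable local inverse, so its differential is injective and
  -- the image of a segment in direction e ≠ 0 has nonzero velocity.
  have hv0 : ∀ z ∈ O, v z ≠ 0 := by
    intro z hz hvz
    have h1 : DifferentiableAt ℝ Θ z :=
      (hΘ.contDiffAt (hO.mem_nhds hz)).differentiableAt (by simp)
    have hz2 : Θ z ∈ (Ψ'.trans Ψ.symm).source := by
      refine ⟨Ψ'.map_target hz.2, ?_⟩
      change Ψ' (Ψ'.symm (Ψ z)) ∈ Ψ.target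
      rw [Ψ'.right_inv (show Ψ z ∈ Ψ'.target from hz.2)]
      exact Ψ.map_source hz.1
    have h2 : DifferentiableAt ℝ (Ψ'.trans Ψ.symm) (Θ z) :=
      (h'.contDiffAt ((Ψ'.trans Ψ.symm).open_source.mem_nhds hz2)).differentiableAt (by simp)
    have h3 : (fun y => (Ψ'.trans Ψ.symm) (Θ y)) =ᶠ[𝓝 z] id := by
      filter_upwards [hO.mem_nhds hz] with y hy
      change Ψ.symm (Ψ' (Ψ'.symm (Ψ y))) = y
      rw [Ψ'.right_inv (show Ψ y ∈ Ψ'.target from hy.2), Ψ.left_inv hy.1]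
    have h4 := (h2.hasFDerivAt.comp z h1.hasFDerivAt).unique
      ((hasFDerivAt_id z).congr_of_eventuallyEq h3)
    have h5 := DFunLike.congr_fun h4 ((0, e) : A × B)
    simp only [ContinuousLinearMap.comp_apply] at h5
    have h6 : fderiv ℝ Θ z (0, e) = 0 := hvz
    rw [h6, map_zero] at h5
    exact he (Prod.ext_iff.1 h5.symm).2
  -- ρ₀ is a positive lower bound of ‖v‖² / (‖u‖ + 1) on the compact set D. The summand 1 allows
  -- vanishing acceleration and makes the contradiction strict: ‖v‖² ≤ ρ ‖u‖ ≤ ρ₀ ‖u‖ < ρ₀ (‖u‖ + 1)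
  -- ≤ ‖v‖².
  obtain ⟨ρ₀, hρ₀, hmin⟩ := hD.exists_forall_le' (f := fun z => ‖v z‖ ^ 2 / (‖u z‖ + 1)) (a := 0)
    (((hv.continuousOn.mono hDO).norm.pow 2).div ((hu.mono hDO).norm.add continuousOn_const)
      fun z _ => (add_pos_of_nonneg_of_pos (norm_nonneg (u z)) one_pos).ne')
    (fun z hz => by have := norm_pos_iff.2 (hv0 z (hDO hz)); positivity)
  refine ⟨ρ₀, hρ₀, fun ρ hρ a b s t₀ hev => ?_⟩
  let z : ℝ → A × B := fun t => (s, t • e)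
  have hz : ∀ t, HasDerivAt z (0, e) t := fun t => by
    have := (hasDerivAt_const t s).prodMk ((hasDerivAt_id t).smul_const e)
    simpa using this
  have hzD : ∀ᶠ t in 𝓝 t₀, z t ∈ D := hev.mono fun t ⟨h1, x, _, h2, h3⟩ =>
    ⟨h1, (x, b), h2, h3.symm⟩
  have hz₀ := hzD.self_of_nhds
  have key := sq_norm_velocity_le_of_mem_sphere (γ := fun t => Θ (z t)) (v := fun t => v (z t))
    (u := fun t => u (z t)) (t₀ := t₀) (ρ := ρ) (a := a) (b := b) ?_ ?_ ?_
  · have h1 := hmin _ hz₀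
    rw [le_div_iff₀ (by positivity)] at h1
    have h2 : ρ * ‖u (z t₀)‖ ≤ ρ₀ * ‖u (z t₀)‖ := mul_le_mul_of_nonneg_right hρ (norm_nonneg _)
    nlinarith
  · filter_upwards [hzD] with t ht
    exact ((hΘ.contDiffAt (hO.mem_nhds (hDO ht))).differentiableAt
      (by simp)).hasFDerivAt.comp_hasDerivAt t (hz t)
  · exact ((hv.contDiffAt (hO.mem_nhds (hDO hz₀))).differentiableAt
      (by simp)).hasFDerivAt.comp_hasDerivAt t₀ (hz t₀)
  · filter_upwards [hev] with t ⟨_, x, hx, hxC, hxz⟩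
    have : Θ (z t) = (x, b) := by
      change Ψ'.symm (Ψ (s, t • e)) = _
      rw [hxz, Ψ'.left_inv (hCs' hxC)]
    rw [this]
    exact ⟨hx, rfl⟩

end Thin

/-! ### Finitely many disjoint discs in one chart -/

section Cells

variable {A B : Type*} [NormedAddCommGroup A] [NormedAddCommGroup B]
  {W : Type*} [TopologicalSpace W]

/-- The closed ball with centre `c.1` and radius `c.2.1`, at height `c.2.2` in the chart `Ψ`. -/
def cell (Ψ : OpenPartialHomeomorph (A × B) W) (c : A × ℝ × B) : Set W :=
  Ψ '' (Metric.closedBall c.1 c.2.1 ×ˢ {c.2.2})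

/-- The points of the box of radius `r` in the chart `Ψ` that project to the interior of the cell
`c`. -/
def tube (Ψ : OpenPartialHomeomorph (A × B) W) (r : ℝ) (c : A × ℝ × B) : Set W :=
  Ψ '' ((Metric.ball c.1 c.2.1 ×ˢ Set.univ) ∩ Metric.ball 0 r)

theorem isOpen_tube {Ψ : OpenPartialHomeomorph (A × B) W} {r : ℝ} (hr : Metric.ball 0 r ⊆ Ψ.source)
    (c : A × ℝ × B) : IsOpen (tube Ψ r c) :=
  Ψ.isOpen_image_of_subset_source ((Metric.isOpen_ball.prod isOpen_univ).inter Metric.isOpen_ball)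
    (Set.inter_subset_right.trans hr)

theorem mk_mem_ball_zero {s : A} {b : B} {r : ℝ} :
    (s, b) ∈ Metric.ball (0 : A × B) r ↔ ‖s‖ < r ∧ ‖b‖ < r := by
  rw [mem_ball_zero_iff, Prod.norm_def, max_lt_iff]

/-- Finitely many disjoint cells in one chart that meet the fibres over a compact set, apart from
those which meet `R`, and avoid `K`. -/
theorem exists_cells_avoiding [NormedSpace ℝ B] [Nontrivial B]
    {Ψ : OpenPartialHomeomorph (A × B) W} {T : Set A} (hT : IsCompact T) {r ρ₀ : ℝ} (hρ₀ : 0 < ρ₀)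
    (hr : Metric.ball 0 r ⊆ Ψ.source) {K R : Set W} (hK : IsClosed K) (hR : IsOpen R)
    (h : ∀ s ∈ T, ∃ b, (s, b) ∈ Metric.ball (0 : A × B) r ∧ (Ψ (s, b) ∈ R ∨ Ψ (s, b) ∉ K)) :
    ∃ C : Finset (A × ℝ × B),
      (∀ c ∈ C, 0 < c.2.1 ∧ c.2.1 ≤ ρ₀ ∧
        Metric.closedBall c.1 c.2.1 ×ˢ {c.2.2} ⊆ Metric.ball (0 : A × B) r ∧
        Disjoint (cell Ψ c) K) ∧
      Set.InjOn (fun c : A × ℝ × B => c.2.2) C ∧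
      ∀ s ∈ T, ∃ b, (s, b) ∈ Metric.ball (0 : A × B) r ∧
        (Ψ (s, b) ∈ R ∨ ∃ c ∈ C, s ∈ Metric.ball c.1 c.2.1) := by
  classical
  -- The finite set Λ of forbidden heights makes compact induction possible: for a union of two
  -- sets, the cells of the second are chosen at heights not used by the first.
  suffices H : ∀ Λ : Finset B, ∃ C : Finset (A × ℝ × B),
      (∀ c ∈ C, 0 < c.2.1 ∧ c.2.1 ≤ ρ₀ ∧
        Metric.closedBall c.1 c.2.1 ×ˢ {c.2.2} ⊆ Metric.ball (0 : A × B) r ∧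
        Disjoint (cell Ψ c) K ∧ c.2.2 ∉ Λ) ∧
      Set.InjOn (fun c : A × ℝ × B => c.2.2) C ∧
      ∀ s ∈ T, ∃ b, (s, b) ∈ Metric.ball (0 : A × B) r ∧
        (Ψ (s, b) ∈ R ∨ ∃ c ∈ C, s ∈ Metric.ball c.1 c.2.1) by
    obtain ⟨C, hC, hC'⟩ := H ∅
    exact ⟨C, fun c hc => ⟨(hC c hc).1, (hC c hc).2.1, (hC c hc).2.2.1, (hC c hc).2.2.2.1⟩, hC'⟩
  refine hT.induction_on (p := fun T => ∀ Λ : Finset B, ∃ C : Finset (A × ℝ × B),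
      (∀ c ∈ C, 0 < c.2.1 ∧ c.2.1 ≤ ρ₀ ∧
        Metric.closedBall c.1 c.2.1 ×ˢ {c.2.2} ⊆ Metric.ball (0 : A × B) r ∧
        Disjoint (cell Ψ c) K ∧ c.2.2 ∉ Λ) ∧
      Set.InjOn (fun c : A × ℝ × B => c.2.2) C ∧
      ∀ s ∈ T, ∃ b, (s, b) ∈ Metric.ball (0 : A × B) r ∧
        (Ψ (s, b) ∈ R ∨ ∃ c ∈ C, s ∈ Metric.ball c.1 c.2.1)) ?_ ?_ ?_ ?_
  · exact fun Λ => ⟨∅, by simp⟩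
  · intro S S' hS h' Λ
    obtain ⟨C, h1, h2, h3⟩ := h' Λ
    exact ⟨C, h1, h2, fun s hs => h3 s (hS hs)⟩
  · intro S S' hS hS' Λ
    obtain ⟨C, h1, h2, h3⟩ := hS Λ
    obtain ⟨C', h1', h2', h3'⟩ := hS' (Λ ∪ C.image fun c => c.2.2)
    refine ⟨C ∪ C', ?_, ?_, ?_⟩
    · intro c hc
      rcases Finset.mem_union.1 hc with hc | hc
      · exact h1 c hc
      · obtain ⟨e1, e2, e3, e4, e5⟩ := h1' c hc
        exact ⟨e1, e2, e3, e4, fun h => e5 (Finset.mem_union_left _ h)⟩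
    · have hne : ∀ c ∈ C, ∀ c' ∈ C', c.2.2 ≠ c'.2.2 := fun c hc c' hc' heq =>
        (h1' c' hc').2.2.2.2 (Finset.mem_union_right _ (Finset.mem_image.2 ⟨c, hc, heq⟩))
      intro c hc c' hc' heq
      rcases Finset.mem_union.1 hc with hc | hc <;> rcases Finset.mem_union.1 hc' with hc' | hc'
      · exact h2 hc hc' heq
      · exact absurd heq (hne c hc c' hc')
      · exact absurd heq.symm (hne c' hc' c hc)
      · exact h2' hc hc' heq
    · rintro s (hs | hs)
      · obtain ⟨b, hb, hb'⟩ := h3 s hs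
        exact ⟨b, hb, hb'.imp_right fun ⟨c, hc, hc'⟩ => ⟨c, Finset.mem_union_left _ hc, hc'⟩⟩
      · obtain ⟨b, hb, hb'⟩ := h3' s hs
        exact ⟨b, hb, hb'.imp_right fun ⟨c, hc, hc'⟩ => ⟨c, Finset.mem_union_right _ hc, hc'⟩⟩
  · intro s hs
    obtain ⟨b, hb, hb'⟩ := h s hs
    by_cases hbR : Ψ (s, b) ∈ R
    · have h1 : ∀ᶠ z in 𝓝 (s, b), z ∈ Metric.ball (0 : A × B) r ∧ Ψ z ∈ R :=
        (Metric.isOpen_ball.eventually_mem hb).and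
          ((Ψ.continuousAt (hr hb)).eventually (hR.eventually_mem hbR))
      have h2 : ∀ᶠ x in 𝓝 s, (x, b) ∈ Metric.ball (0 : A × B) r ∧ Ψ (x, b) ∈ R :=
        (Continuous.prodMk_left b).continuousAt.eventually h1
      exact ⟨_, mem_nhdsWithin_of_mem_nhds h2, fun Λ => ⟨∅, by simp, by simp,
        fun x hx => ⟨b, hx.1, Or.inl hx.2⟩⟩⟩
    · have hbK : Ψ (s, b) ∈ Kᶜ := hb'.resolve_left hbR
      have h1 : ∀ᶠ z in 𝓝 (s, b), z ∈ Metric.ball (0 : A × B) r ∧ Ψ z ∈ Kᶜ :=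
        (Metric.isOpen_ball.eventually_mem hb).and
          ((Ψ.continuousAt (hr hb)).eventually (hK.isOpen_compl.eventually_mem hbK))
      obtain ⟨ε, hε, hball⟩ := Metric.eventually_nhds_iff_ball.1 h1
      let ρ := min ρ₀ (ε / 2)
      have hρ : 0 < ρ := lt_min hρ₀ (half_pos hε)
      refine ⟨Metric.ball s ρ, mem_nhdsWithin_of_mem_nhds (Metric.ball_mem_nhds s hρ), fun Λ => ?_⟩
      -- Balls in the nontrivial space B are infinite. This is where a fibre of positive dimension
      -- is needed: there is room to move the cell off the forbidden heights.
      obtain ⟨b', hb'ε, hb'Λ⟩ : ∃ b' ∈ Metric.ball b ε, b' ∉ Λ := by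
        have hinf : (Metric.ball b ε).Infinite := infinite_of_mem_nhds b (Metric.ball_mem_nhds b hε)
        obtain ⟨b', h1, h2⟩ := hinf.exists_notMem_finset Λ
        exact ⟨b', h1, h2⟩
      have hsub : ∀ x ∈ Metric.closedBall s ρ, (x, b') ∈ Metric.ball (s, b) ε := by
        intro x hx
        rw [Metric.mem_ball, Prod.dist_eq]
        refine max_lt ?_ hb'ε
        have := Metric.mem_closedBall.1 hx
        have : ρ ≤ ε / 2 := min_le_right _ _
        simp only
        linarith
      refine ⟨{(s, ρ, b')}, ?_, by simp, ?_⟩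
      · intro c hc
        rw [Finset.mem_singleton] at hc
        subst hc
        refine ⟨hρ, min_le_left _ _, ?_, ?_, hb'Λ⟩
        · rintro ⟨x, y⟩ ⟨hx, hy⟩
          obtain rfl : y = b' := hy
          exact (hball _ (hsub x hx)).1
        · rw [Set.disjoint_left]
          rintro _ ⟨⟨x, y⟩, ⟨hx, hy⟩, rfl⟩
          obtain rfl : y = b' := hy
          exact (hball _ (hsub x hx)).2
      · intro x hx
        refine ⟨b', (hball _ (hsub x (Metric.ball_subset_closedBall hx))).1, Or.inr
          ⟨_, Finset.mem_singleton_self _, hx⟩⟩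

end Cells

/-! ### A locally finite family of disjoint discs whose tubes are reached from every point -/

section ChooseCells

variable {A B : Type} [NormedAddCommGroup A] [InnerProductSpace ℝ A] [FiniteDimensional ℝ A]
  [NormedAddCommGroup B] [NormedSpace ℝ B]
  {W : Type u} [TopologicalSpace W]

theorem isCompact_cell {A B : Type*} [NormedAddCommGroup A] [ProperSpace A] [NormedAddCommGroup B]
    (Ψ : OpenPartialHomeomorph (A × B) W) {c : A × ℝ × B}
    (hc : Metric.closedBall c.1 c.2.1 ×ˢ {c.2.2} ⊆ Ψ.source) : IsCompact (cell Ψ c) :=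
  ((isCompact_closedBall _ _).prod isCompact_singleton).image_of_continuousOn
    (Ψ.continuousOn.mono hc)

theorem OpenPartialHomeomorph.hasBasis_nhds_image_ball {E : Type*} [NormedAddCommGroup E]
    (Ψ : OpenPartialHomeomorph E W) {R : ℝ} (hR : 0 < R) (hΨ : Ψ.source = Metric.ball 0 R) :
    (𝓝 (Ψ 0)).HasBasis (fun r : ℝ => 0 < r ∧ r < R) fun r => Ψ '' Metric.ball 0 r := by
  have h0 : (0 : E) ∈ Ψ.source := by rw [hΨ]; exact Metric.mem_ball_self hR
  rw [← Ψ.map_nhds_eq h0]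
  refine Filter.HasBasis.map _ (Metric.nhds_basis_ball.to_hasBasis (fun r hr => ?_)
    fun r hr => ⟨r, hr.1, le_rfl⟩)
  refine ⟨min r (R / 2), ⟨lt_min hr (half_pos hR), (min_le_right _ _).trans_lt (half_lt_self hR)⟩,
    Metric.ball_subset_ball (min_le_left _ _)⟩

variable [T2Space W]

/-- A segment in one chart cannot be covered by countably many cells with thin boundaries unless it
meets the interior of one of the corresponding tubes. -/
theorem exists_mem_tube_or_notMem {Q : Type*} [Countable Q]
    {Ψ : OpenPartialHomeomorph (A × B) W} {r : ℝ} (hr : Metric.ball 0 r ⊆ Ψ.source)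
    {Ψ' : Q → OpenPartialHomeomorph (A × B) W} {r' : Q → ℝ} {c : Q → A × ℝ × B}
    (hr' : ∀ j, Metric.ball 0 (r' j) ⊆ (Ψ' j).source)
    (hc : ∀ j, Metric.closedBall (c j).1 (c j).2.1 ×ˢ {(c j).2.2} ⊆ Metric.ball 0 (r' j))
    {e : B} (he : ‖e‖ = 1)
    (hthin : ∀ (j : Q) (s : A) (t₀ : ℝ), ¬ ∀ᶠ t in 𝓝 t₀, (s, t • e) ∈ Metric.ball (0 : A × B) r ∧
        ∃ x, ‖x - (c j).1‖ = (c j).2.1 ∧ (x, (c j).2.2) ∈ Metric.ball (0 : A × B) (r' j) ∧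
          Ψ (s, t • e) = Ψ' j (x, (c j).2.2))
    {s : A} (hs : ‖s‖ < r) :
    ∃ b, (s, b) ∈ Metric.ball (0 : A × B) r ∧
      ((∃ j, Ψ (s, b) ∈ tube (Ψ' j) (r' j) (c j)) ∨ ∀ j, Ψ (s, b) ∉ cell (Ψ' j) (c j)) := by
  have : ProperSpace A := FiniteDimensional.proper ℝ A
  by_contra! hcon
  have hr0 : 0 < r := (norm_nonneg s).trans_lt hs
  have hmem : ∀ t : ℝ, |t| < r → (s, t • e) ∈ Metric.ball (0 : A × B) r := fun t ht => by
    rw [mk_mem_ball_zero, norm_smul, he, mul_one]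
    exact ⟨hs, ht⟩
  let S : Set ℝ := Metric.closedBall 0 (r / 2)
  have hS : ∀ t ∈ S, (s, t • e) ∈ Metric.ball (0 : A × B) r := fun t ht => hmem t (by
    have h1 := mem_closedBall_zero_iff.1 ht
    rw [Real.norm_eq_abs] at h1
    linarith)
  have hcont : ContinuousOn (fun t : ℝ => Ψ (s, t • e)) S :=
    Ψ.continuousOn.comp (by fun_prop) fun t ht => hr (hS t ht)
  -- The extra index `none` covers the part of ℝ outside the segment, so that Baire's theorem can be
  -- used on all of ℝ and its conclusion tested in the open segment |t| < r / 2.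
  let I : Option Q → Set ℝ := fun j => j.elim {t | r / 2 ≤ |t|} fun j =>
    S ∩ (fun t : ℝ => Ψ (s, t • e)) ⁻¹' cell (Ψ' j) (c j)
  have hI : ∀ j, IsClosed (I j) := by
    rintro (_ | j)
    · exact isClosed_le continuous_const continuous_abs
    · exact hcont.preimage_isClosed_of_isClosed Metric.isClosed_closedBall
        (isCompact_cell _ ((hc j).trans (hr' j))).isClosed
  have hU : ⋃ j, I j = Set.univ := by
    refine Set.eq_univ_of_forall fun t => Set.mem_iUnion.2 ?_
    rcases le_total (r / 2) |t| with ht | ht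
    · exact ⟨none, ht⟩
    · have htS : t ∈ S := mem_closedBall_zero_iff.2 ht
      obtain ⟨j, hj⟩ := (hcon (t • e) (hS t htS)).2
      exact ⟨some j, htS, hj⟩
  have hd := dense_iUnion_interior_of_closed hI hU
  obtain ⟨t, ht, htI⟩ := hd.exists_mem_open Metric.isOpen_ball
    ⟨0, Metric.mem_ball_self (half_pos hr0)⟩
  obtain ⟨j, hj⟩ := Set.mem_iUnion.1 ht
  rw [mem_ball_zero_iff, Real.norm_eq_abs] at htI
  rcases j with _ | j
  · have h1 : r / 2 ≤ |t| := interior_subset (s := I none) hj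
    linarith
  · refine hthin j s t ?_
    filter_upwards [mem_interior_iff_mem_nhds.1 hj] with t' ht'
    refine ⟨hS t' ht'.1, ?_⟩
    obtain ⟨⟨x, y⟩, ⟨hx, hy⟩, hxy⟩ := ht'.2
    obtain rfl : y = (c j).2.2 := hy
    have hxc : (x, (c j).2.2) ∈ Metric.ball (0 : A × B) (r' j) := hc j ⟨hx, rfl⟩
    -- A point of a closed cell whose first coordinate lies in the open ball is in the tube, which
    -- is excluded by assumption; so on an interval the segment runs in the bounding sphere.
    refine ⟨x, le_antisymm (mem_closedBall_iff_norm.1 hx) (not_lt.1 fun hlt => ?_), hxc, hxy.symm⟩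
    refine (hcon (t' • e) (hS t' ht'.1)).1 j ⟨(x, (c j).2.2), ⟨⟨?_, trivial⟩, hxc⟩, hxy⟩
    exact mem_ball_iff_norm.2 hlt

variable [LocallyCompactSpace W] [SigmaCompactSpace W] [FiniteDimensional ℝ B] [Nontrivial B]

/-- A locally finite family of disjoint cells in charts of a given kind such that each point can be
moved into one of the tubes around these cells along a fibre of such a chart. -/
theorem exists_disjoint_cells (G : Set (OpenPartialHomeomorph (A × B) W))
    (hG : ∀ w, ∃ Ψ ∈ G, (∃ R > 0, Ψ.source = Metric.ball 0 R) ∧ Ψ 0 = w)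
    (hcompat : ∀ Ψ ∈ G, ∀ Ψ' ∈ G, ContDiffOn ℝ ∞ (Ψ.trans Ψ'.symm) (Ψ.trans Ψ'.symm).source) :
    ∃ (J : Type u) (_ : Countable J) (Ψ : J → OpenPartialHomeomorph (A × B) W) (c : J → A × ℝ × B),
      (∀ j, Ψ j ∈ G) ∧ (∀ j, 0 < (c j).2.1) ∧
      (∀ j, Metric.closedBall (c j).1 (c j).2.1 ×ˢ {(c j).2.2} ⊆ (Ψ j).source) ∧
      Pairwise (fun i j => Disjoint (cell (Ψ i) (c i)) (cell (Ψ j) (c j))) ∧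
      LocallyFinite (fun j => cell (Ψ j) (c j)) ∧
      ∀ w, ∃ Ψ' ∈ G, ∃ s b b', (s, b) ∈ Ψ'.source ∧ (s, b') ∈ Ψ'.source ∧ Ψ' (s, b) = w ∧
        ∃ j, ∃ x ∈ Metric.ball (c j).1 (c j).2.1, ∃ y, (x, y) ∈ (Ψ j).source ∧
          Ψ' (s, b') = Ψ j (x, y) := by
  have : ProperSpace A := FiniteDimensional.proper ℝ A
  have : ProperSpace (A × B) := FiniteDimensional.proper ℝ (A × B)
  choose Ψ₀ hΨ₀G hΨ₀ hΨ₀w using hG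
  choose R₀ hR₀ hR₀s using hΨ₀
  have hbasis : ∀ w, (𝓝 w).HasBasis (fun r : ℝ => 0 < r ∧ r < R₀ w)
      fun r => Ψ₀ w '' Metric.ball 0 r := fun w => by
    have := (Ψ₀ w).hasBasis_nhds_image_ball (hR₀ w) (hR₀s w)
    rwa [hΨ₀w] at this
  obtain ⟨ι, x, r, hxr, hcov, hlf⟩ := refinement_of_locallyCompact_sigmaCompact_of_nhds_basis hbasis
  let Ψ : ι → OpenPartialHomeomorph (A × B) W := fun i => Ψ₀ (x i)
  have hclosed : ∀ i, Metric.closedBall 0 (r i) ⊆ (Ψ i).source := fun i => by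
    rw [hR₀s]; exact Metric.closedBall_subset_ball (hxr i).2
  have hopen : ∀ i, Metric.ball 0 (r i) ⊆ (Ψ i).source := fun i =>
    Metric.ball_subset_closedBall.trans (hclosed i)
  have hcpt : ∀ i, IsCompact (Ψ i '' Metric.closedBall 0 (r i)) := fun i =>
    (isCompact_closedBall _ _).image_of_continuousOn ((Ψ i).continuousOn.mono (hclosed i))
  have : Countable ι := by
    have := LocallyFinite.countable_univ hlf fun i =>
      ⟨_, Set.mem_image_of_mem _ (Metric.mem_ball_self (hxr i).1)⟩
    exact Set.countable_univ_iff.1 this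
  -- The open boxes are shrunk to closed sets that still cover W. Their projections T i to A are
  -- compact, so finitely many cells per box suffice.
  obtain ⟨v, hvcov, hvc, hvu⟩ := exists_iUnion_eq_closed_subset
    (fun i => (Ψ i).isOpen_image_of_subset_source Metric.isOpen_ball (hopen i)) hlf.point_finite hcov
  let T : ι → Set A := fun i => Prod.fst '' ((Ψ i).symm '' v i)
  have hvt : ∀ i, v i ⊆ (Ψ i).target := fun i => (hvu i).trans
    (((Set.image_mono (hopen i)).trans (Ψ i).image_source_eq_target.le))
  have hT : ∀ i, IsCompact (T i) := fun i => by
    have h1 : IsCompact (v i) := (hcpt i).of_isClosed_subset (hvc i)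
      ((hvu i).trans (Set.image_mono Metric.ball_subset_closedBall))
    exact (h1.image_of_continuousOn ((Ψ i).continuousOn_symm.mono (hvt i))).image continuous_fst
  have hvs : ∀ i, ∀ w ∈ v i, (Ψ i).symm w ∈ Metric.ball 0 (r i) := by
    intro i w hw
    obtain ⟨z, hz, rfl⟩ := hvu i hw
    rwa [(Ψ i).left_inv (hopen i hz)]
  have hTr : ∀ i, ∀ s ∈ T i, ‖s‖ < r i := by
    rintro i _ ⟨_, ⟨w, hw, rfl⟩, rfl⟩
    exact (mk_mem_ball_zero.1 (hvs i w hw)).1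
  obtain ⟨e, he⟩ := exists_norm_eq B (zero_le_one' ℝ)
  have he0 : e ≠ 0 := fun h => by simp [h] at he
  -- The radii allowed in box j must suit every other box i, including those treated later. Only
  -- finitely many boxes meet the compact closure of box j, and for the others the condition is
  -- vacuous.
  have hthin : ∀ j, ∃ ρ₀ > 0, ∀ i, ∀ ρ ≤ ρ₀, ∀ (a : A) (b : B) (s : A) (t₀ : ℝ),
      ¬ ∀ᶠ t in 𝓝 t₀, (s, t • e) ∈ Metric.ball (0 : A × B) (r i) ∧
        ∃ x, ‖x - a‖ = ρ ∧ (x, b) ∈ Metric.ball (0 : A × B) (r j) ∧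
          Ψ i (s, t • e) = Ψ j (x, b) := by
    intro j
    have hfin := LocallyFinite.finite_nonempty_inter_compact hlf (hcpt j)
    have hpair : ∀ i, ∀ᶠ ρ₀ in 𝓝[>] (0 : ℝ), ∀ ρ ≤ ρ₀, ∀ (a : A) (b : B) (s : A) (t₀ : ℝ),
        ¬ ∀ᶠ t in 𝓝 t₀, (s, t • e) ∈ Metric.closedBall (0 : A × B) (r i) ∧
          ∃ x, ‖x - a‖ = ρ ∧ (x, b) ∈ Metric.closedBall (0 : A × B) (r j) ∧
            Ψ i (s, t • e) = Ψ j (x, b) := by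
      intro i
      obtain ⟨ρ₁, hρ₁, h1⟩ := exists_radius_of_thin (hcompat _ (hΨ₀G (x i)) _ (hΨ₀G (x j)))
        (hcompat _ (hΨ₀G (x j)) _ (hΨ₀G (x i))) (isCompact_closedBall _ _) (hclosed i)
        (isCompact_closedBall _ _) (hclosed j) he0
      filter_upwards [mem_nhdsWithin_of_mem_nhds (Iio_mem_nhds hρ₁)] with ρ₀ hρ₀ ρ hρ
      exact h1 ρ (hρ.trans (le_of_lt hρ₀))
    have hall := (Filter.eventually_all_finite hfin).2 fun i _ => hpair i
    obtain ⟨ρ₀, h1, h2⟩ := (hall.and self_mem_nhdsWithin).exists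
    refine ⟨ρ₀, h2, fun i ρ hρ a b s t₀ hev => ?_⟩
    obtain ⟨h3, y, -, h4, h5⟩ := hev.self_of_nhds
    refine h1 i ⟨_, Set.mem_image_of_mem _ h3, ?_⟩ ρ hρ a b s t₀ (hev.mono ?_)
    · exact ⟨(y, b), Metric.ball_subset_closedBall h4, h5.symm⟩
    · rintro t ⟨e1, y, e2, e3, e4⟩
      exact ⟨Metric.ball_subset_closedBall e1, y, e2, Metric.ball_subset_closedBall e3, e4⟩
  choose ρ₀ hρ₀ hthin using hthin
  let P : ι → Type := fun i => {C : Finset (A × ℝ × B) // ∀ c ∈ C, 0 < c.2.1 ∧ c.2.1 ≤ ρ₀ i ∧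
    Metric.closedBall c.1 c.2.1 ×ˢ {c.2.2} ⊆ Metric.ball (0 : A × B) (r i)}
  have hcell : ∀ i (C : P i), ∀ c ∈ C.1, cell (Ψ i) c ⊆ Ψ i '' Metric.ball 0 (r i) := fun i C c hc =>
    Set.image_mono (C.2 c hc).2.2
  -- One stage of a recursion along a well-order of the boxes, where f records the cells of all
  -- earlier boxes. No assumption is made on the order type.
  have hstep : ∀ i (f : ∀ j, WellOrderingRel j i → P j), ∃ C : P i,
      (∀ c ∈ C.1, ∀ j hj, ∀ c' ∈ (f j hj).1, Disjoint (cell (Ψ i) c) (cell (Ψ j) c')) ∧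
      Set.InjOn (fun c : A × ℝ × B => c.2.2) C.1 ∧
      ∀ s ∈ T i, ∃ b, (s, b) ∈ Metric.ball (0 : A × B) (r i) ∧
        ((∃ j hj, ∃ c ∈ (f j hj).1, Ψ i (s, b) ∈ tube (Ψ j) (r j) c) ∨
          ∃ c ∈ C.1, s ∈ Metric.ball c.1 c.2.1) := by
    intro i f
    let I := {j // WellOrderingRel j i}
    let g : ∀ j : I, P j.1 := fun j => f j.1 j.2
    let K : Set W := ⋃ j : I, ⋃ c ∈ (g j).1, cell (Ψ j.1) c
    let R : Set W := ⋃ j : I, ⋃ c ∈ (g j).1, tube (Ψ j.1) (r j.1) c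
    -- Infinitely many boxes may precede i; local finiteness keeps the union of their cells closed.
    have hK : IsClosed K := by
      refine LocallyFinite.isClosed_iUnion ?_ fun j => ?_
      · refine (hlf.comp_injective (Subtype.val_injective (p := fun j => WellOrderingRel j i))).subset
          fun j => Set.iUnion₂_subset fun c hc => hcell j.1 (g j) c hc
      · exact (g j).1.finite_toSet.isClosed_biUnion fun c hc =>
          (isCompact_cell _ (((g j).2 c hc).2.2.trans (hopen _))).isClosed
    have hR : IsOpen R := isOpen_iUnion fun j => isOpen_biUnion fun c _ => isOpen_tube (hopen _) c
    have hKR : ∀ s ∈ T i, ∃ b, (s, b) ∈ Metric.ball (0 : A × B) (r i) ∧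
        (Ψ i (s, b) ∈ R ∨ Ψ i (s, b) ∉ K) := by
      intro s hs
      -- Countably many boxes with finitely many cells each form a countable family, as Baire's
      -- theorem requires, and their radii are below the bounds that exclude segments.
      obtain ⟨b, hb, hb'⟩ := exists_mem_tube_or_notMem (Q := Σ j : I, (g j).1)
        (Ψ' := fun j => Ψ j.1.1) (r' := fun j => r j.1.1) (c := fun j => j.2.1) (hopen i)
        (fun j => hopen _) (fun j => ((g j.1).2 _ j.2.2).2.2) he
        (fun j s t₀ => hthin j.1.1 i _ ((g j.1).2 _ j.2.2).2.1 _ _ s t₀) (hTr i s hs)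
      refine ⟨b, hb, hb'.imp ?_ ?_⟩
      · rintro ⟨j, hj⟩
        exact Set.mem_iUnion.2 ⟨j.1, Set.mem_iUnion₂.2 ⟨_, j.2.2, hj⟩⟩
      · intro h hmem
        obtain ⟨j, hj⟩ := Set.mem_iUnion.1 hmem
        obtain ⟨c, hc, hj⟩ := Set.mem_iUnion₂.1 hj
        exact h ⟨j, c, hc⟩ hj
    obtain ⟨C, hC1, hC2, hC3⟩ := exists_cells_avoiding (hT i) (hρ₀ i) (hopen i) hK hR hKR
    refine ⟨⟨C, fun c hc => ⟨(hC1 c hc).1, (hC1 c hc).2.1, (hC1 c hc).2.2.1⟩⟩, ?_, hC2, ?_⟩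
    · intro c hc j hj c' hc'
      refine (hC1 c hc).2.2.2.mono_right ?_
      exact fun w hw => Set.mem_iUnion.2 ⟨⟨j, hj⟩, Set.mem_iUnion₂.2 ⟨c', hc', hw⟩⟩
    · intro s hs
      obtain ⟨b, hb, hb'⟩ := hC3 s hs
      refine ⟨b, hb, hb'.imp_left fun hmem => ?_⟩
      obtain ⟨j, hj⟩ := Set.mem_iUnion.1 hmem
      obtain ⟨c, hc, hj⟩ := Set.mem_iUnion₂.1 hj
      exact ⟨j.1, j.2, c, hc, hj⟩
  choose step hstep1 hstep2 hstep3 using hstep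
  have hwf : WellFounded (WellOrderingRel : ι → ι → Prop) := WellOrderingRel.isWellOrder.wf
  let F : ∀ i, P i := hwf.fix step
  have hF : ∀ i, F i = step i fun j _ => F j := fun i => hwf.fix_eq step i
  have hdisj : ∀ i j, WellOrderingRel j i → ∀ c ∈ (F i).1, ∀ c' ∈ (F j).1,
      Disjoint (cell (Ψ i) c) (cell (Ψ j) c') := by
    intro i j hj c hc c' hc'
    rw [hF] at hc
    exact hstep1 i (fun j _ => F j) c hc j hj c' hc'
  refine ⟨Σ i, (F i).1, inferInstance, fun j => Ψ j.1, fun j => j.2.1, fun j => hΨ₀G _,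
    fun j => ((F j.1).2 _ j.2.2).1, fun j => ((F j.1).2 _ j.2.2).2.2.trans (hopen _), ?_, ?_, ?_⟩
  · rintro ⟨i, c, hc⟩ ⟨j, c', hc'⟩ hne
    rcases trichotomous_of WellOrderingRel i j with hij | rfl | hij
    · exact (hdisj j i hij c' hc' c hc).symm
    · have hinj : Set.InjOn (fun c : A × ℝ × B => c.2.2) (F i).1 := by
        rw [hF]; exact hstep2 i _
      -- Cells of the same box sit at different heights of one chart, hence in disjoint slices.
      have hne' : c.2.2 ≠ c'.2.2 := fun h => hne (by
        obtain rfl := hinj hc hc' h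
        rfl)
      rw [Set.disjoint_left]
      rintro _ ⟨z, hz, rfl⟩ ⟨z', hz', heq⟩
      have h1 := (Ψ i).injOn (hopen i (((F i).2 _ hc').2.2 hz')) (hopen i (((F i).2 _ hc).2.2 hz)) heq
      rw [← h1] at hz
      exact hne' (hz.2.symm.trans hz'.2)
    · exact hdisj i j hij c hc c' hc'
  · intro w
    obtain ⟨U, hU, hfin⟩ := hlf w
    refine ⟨U, hU, ?_⟩
    refine (Set.Finite.preimage' (f := Sigma.fst) hfin fun i _ => ?_).subset ?_
    · rw [← Set.range_sigmaMk]
      exact Set.finite_range _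
    · rintro ⟨i, c, hc⟩ ⟨y, hy, hyU⟩
      exact ⟨y, hcell i (F i) c hc hy, hyU⟩
  · intro w
    obtain ⟨i, hi⟩ := Set.mem_iUnion.1 (hvcov.ge (Set.mem_univ w))
    have hw := hvs i w hi
    obtain ⟨b, hb, hb'⟩ := hstep3 i (fun j _ => F j) ((Ψ i).symm w).1
      (Set.mem_image_of_mem _ (Set.mem_image_of_mem _ hi))
    refine ⟨Ψ i, hΨ₀G _, ((Ψ i).symm w).1, ((Ψ i).symm w).2, b, hopen i hw, hopen i hb,
      (Ψ i).right_inv (hvt i hi), ?_⟩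
    rcases hb' with ⟨j, hj, c, hc, z, ⟨⟨hz, -⟩, hz'⟩, hzeq⟩ | ⟨c, hc, hs⟩
    · exact ⟨⟨j, c, hc⟩, z.1, hz, z.2, hopen j hz', hzeq.symm⟩
    · rw [← hF] at hc
      exact ⟨⟨i, c, hc⟩, ((Ψ i).symm w).1, hs, b, hopen i hb, rfl⟩

end ChooseCells

/-! ### Open subsets of ℝᵏ and countable disjoint unions as manifolds -/

/-- A smooth (Hausdorff, second countable) manifold of pure dimension `k`. -/
structure PureManifold (k : ℕ) : Type (u + 1) where
  carrier : Type u
  [top : TopologicalSpace carrier]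
  [charted : ChartedSpace (EuclideanSpace ℝ (Fin k)) carrier]
  [smooth : IsManifold (𝓡 k) ∞ carrier]
  [t2 : T2Space carrier]
  [secondCountable : SecondCountableTopology carrier]

namespace PureManifold

attribute [instance] top charted smooth t2 secondCountable

/-- Open subsets of `ℝᵏ` are manifolds. -/
theorem exists_of_opens {k : ℕ} (O : Opens (EuclideanSpace ℝ (Fin k))) (hO : (O : Set (EuclideanSpace ℝ (Fin k))).Nonempty) :
    ∃ (Y : PureManifold.{u} k) (κ : OpenPartialHomeomorph Y.carrier (EuclideanSpace ℝ (Fin k))),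
      IsSmoothHomeo (𝓡 k) (𝓡 k) κ ∧ κ.source = Set.univ ∧ κ.target = O := by
  have : Nonempty (ULift.{u} O) := ⟨⟨⟨_, hO.some_mem⟩⟩⟩
  have hf : Topology.IsOpenEmbedding fun y : ULift.{u} O => (y.down : EuclideanSpace ℝ (Fin k)) :=
    O.isOpen.isOpenEmbedding_subtypeVal.comp Homeomorph.ulift.isOpenEmbedding
  let _ : ChartedSpace (EuclideanSpace ℝ (Fin k)) (ULift.{u} O) := hf.singletonChartedSpace
  have : IsManifold (𝓡 k) ∞ (ULift.{u} O) := hf.isManifold_singleton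
  have : SecondCountableTopology (ULift.{u} O) :=
    Homeomorph.ulift.isEmbedding.secondCountableTopology
  refine ⟨⟨ULift.{u} O⟩, hf.toOpenPartialHomeomorph _,
    isSmoothHomeo_chartAt (W := ULift.{u} O) ⟨⟨_, hO.some_mem⟩⟩, rfl, ?_⟩
  rw [Topology.IsOpenEmbedding.toOpenPartialHomeomorph_target]
  ext z
  exact ⟨fun ⟨y, hy⟩ => hy ▸ y.down.2, fun hz => ⟨⟨⟨z, hz⟩⟩, rfl⟩⟩

section Sigma

variable {k : ℕ} {I : Type u} {Y : I → Type v} [∀ i, TopologicalSpace (Y i)]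
  [∀ i, ChartedSpace (EuclideanSpace ℝ (Fin k)) (Y i)]

/-- The disjoint union of a family of charted spaces. -/
noncomputable abbrev sigmaChartedSpace : ChartedSpace (EuclideanSpace ℝ (Fin k)) (Σ i, Y i) where
  atlas := ⋃ i, (fun e => e.lift_openEmbedding (Topology.IsOpenEmbedding.sigmaMk (σ := Y) (i := i))) ''
    atlas (EuclideanSpace ℝ (Fin k)) (Y i)
  chartAt x := (chartAt (EuclideanSpace ℝ (Fin k)) x.2).lift_openEmbedding
    (Topology.IsOpenEmbedding.sigmaMk (σ := Y) (i := x.1))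
  mem_chart_source x := ⟨x.2, mem_chart_source _ x.2, rfl⟩
  chart_mem_atlas x := Set.mem_iUnion.2 ⟨x.1, _, chart_mem_atlas _ x.2, rfl⟩

attribute [local instance] sigmaChartedSpace

/-- Charts of different summands have disjoint sources, so only transition maps within one summand
have to be checked. -/
theorem isManifold_sigma [∀ i, IsManifold (𝓡 k) ∞ (Y i)] : IsManifold (𝓡 k) ∞ (Σ i, Y i) where
  compatible := by
    intro e e' he he'
    obtain ⟨i, f, hf, rfl⟩ := Set.mem_iUnion.1 he
    obtain ⟨i', f', hf', rfl⟩ := Set.mem_iUnion.1 he'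
    by_cases h : i = i'
    · subst h
      simp only
      rw [f.lift_openEmbedding_trans f' Topology.IsOpenEmbedding.sigmaMk]
      exact StructureGroupoid.compatible (contDiffGroupoid ∞ (𝓡 k)) hf hf'
    · apply ContDiffGroupoid.mem_of_source_eq_empty
      refine Set.eq_empty_of_forall_notMem ?_
      rintro z ⟨-, y, -, hy⟩
      exact h (congrArg Sigma.fst hy).symm

/-- The components of a disjoint union. -/
theorem exists_sigma_homeo [∀ i, IsManifold (𝓡 k) ∞ (Y i)] (i : I) (hi : Nonempty (Y i)) :
    ∃ φ : OpenPartialHomeomorph (Σ i, Y i) (Y i), IsSmoothHomeo (𝓡 k) (𝓡 k) φ ∧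
      φ.source = Sigma.fst ⁻¹' {i} ∧ φ.target = Set.univ := by
  have : IsManifold (𝓡 k) ∞ (Σ i, Y i) := isManifold_sigma
  let ψ := (Topology.IsOpenEmbedding.sigmaMk (σ := Y) (i := i)).toOpenPartialHomeomorph _
  have hψ : ∀ y, ψ.symm ⟨i, y⟩ = y := fun y =>
    Topology.IsOpenEmbedding.toOpenPartialHomeomorph_left_inv _ Topology.IsOpenEmbedding.sigmaMk
  have hchart : ∀ y : Y i, chartAt (EuclideanSpace ℝ (Fin k)) (⟨i, y⟩ : Σ i, Y i) =
      (chartAt (EuclideanSpace ℝ (Fin k)) y).lift_openEmbedding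
        (Topology.IsOpenEmbedding.sigmaMk (σ := Y) (i := i)) := fun y => rfl
  have hsrc : ψ.symm.source = Sigma.fst ⁻¹' {i} := by
    rw [OpenPartialHomeomorph.symm_source, Topology.IsOpenEmbedding.toOpenPartialHomeomorph_target,
      Set.range_sigmaMk]
  refine ⟨ψ.symm, ⟨?_, ?_⟩, hsrc, rfl⟩
  · rw [hsrc]
    rintro ⟨i', y⟩ rfl
    let e := chartAt (EuclideanSpace ℝ (Fin k)) y
    let E := chartAt (EuclideanSpace ℝ (Fin k)) (⟨i', y⟩ : Σ i, Y i)
    have hE : E ⟨i', y⟩ = e y := by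
      simp only [E, hchart]; exact OpenPartialHomeomorph.lift_openEmbedding_apply _ _
    have h1 : ContMDiffAt (𝓡 k) (𝓡 k) ∞ E (⟨i', y⟩ : Σ i, Y i) :=
      (isSmoothHomeo_chartAt (d := k) _).contMDiffAt (mem_chart_source _ _)
    have h2 : ContMDiffAt (𝓡 k) (𝓡 k) ∞ e.symm (E ⟨i', y⟩) := by
      rw [hE]
      exact (isSmoothHomeo_chartAt (d := k) y).symm.contMDiffAt (e.map_source (mem_chart_source _ y))
    refine ((h2.comp _ h1).congr_of_eventuallyEq ?_).contMDiffWithinAt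
    filter_upwards [E.open_source.mem_nhds (mem_chart_source _ _)]
    rintro _ ⟨y', hy', rfl⟩
    refine (hψ y').trans ?_
    simp only [Function.comp_apply, E, hchart]
    rw [OpenPartialHomeomorph.lift_openEmbedding_apply]
    exact (e.left_inv hy').symm
  · intro y _
    let e := chartAt (EuclideanSpace ℝ (Fin k)) y
    let E := chartAt (EuclideanSpace ℝ (Fin k)) (⟨i, y⟩ : Σ i, Y i)
    have hE : E ⟨i, y⟩ = e y := by
      simp only [E, hchart]; exact OpenPartialHomeomorph.lift_openEmbedding_apply _ _
    have h1 : ContMDiffAt (𝓡 k) (𝓡 k) ∞ e y :=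
      (isSmoothHomeo_chartAt (d := k) _).contMDiffAt (mem_chart_source _ _)
    have h2 : ContMDiffAt (𝓡 k) (𝓡 k) ∞ E.symm (e y) := by
      rw [← hE]
      exact (isSmoothHomeo_chartAt (d := k) (⟨i, y⟩ : Σ i, Y i)).symm.contMDiffAt
        (E.map_source (mem_chart_source _ _))
    refine ((h2.comp _ h1).congr_of_eventuallyEq ?_).contMDiffWithinAt
    filter_upwards [e.open_source.mem_nhds (mem_chart_source _ y)] with y' hy'
    change (⟨i, y'⟩ : Σ i, Y i) = ⟨i, e.symm (e y')⟩
    rw [e.left_inv hy']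

end Sigma

/-- The disjoint union of countably many manifolds. -/
theorem exists_disjointUnion {k : ℕ} {I : Type u} [Countable I] (Y : I → PureManifold.{u} k)
    (hY : ∀ i, Nonempty (Y i).carrier) :
    ∃ (X : PureManifold.{u} k) (idx : X.carrier → I)
      (φ : ∀ i, OpenPartialHomeomorph X.carrier (Y i).carrier),
      ∀ i, IsSmoothHomeo (𝓡 k) (𝓡 k) (φ i) ∧ (φ i).source = idx ⁻¹' {i} ∧
        (φ i).target = Set.univ := by
  let _ : ChartedSpace (EuclideanSpace ℝ (Fin k)) (Σ i, (Y i).carrier) := sigmaChartedSpace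
  have : IsManifold (𝓡 k) ∞ (Σ i, (Y i).carrier) := isManifold_sigma
  choose φ hφ using fun i => exists_sigma_homeo (k := k) (Y := fun i => (Y i).carrier) i (hY i)
  exact ⟨⟨Σ i, (Y i).carrier⟩, Sigma.fst, φ, hφ⟩

/-- A manifold of pure dimension `k`, as a manifold. -/
theorem exists_mixedManifold {k : ℕ} (X : PureManifold.{u} k) (C : PureManifold.{u} k → Prop)
    (hC : C X) : ∃ W : MixedManifold.{u}, W.IsPureOfDim k ∧ C ⟨W.part k⟩ := by
  let empty : ∀ e, PureManifold.{u} e := fun e =>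
    letI : ChartedSpace (EuclideanSpace ℝ (Fin e)) PEmpty.{u + 1} :=
      ChartedSpace.empty (EuclideanSpace ℝ (Fin e)) PEmpty.{u + 1}
    haveI : IsManifold (𝓡 e) ∞ PEmpty.{u + 1} := IsManifold.empty ∞
    ⟨PEmpty.{u + 1}⟩
  -- The part of dimension k equals X only propositionally. Stating the conclusion for an arbitrary
  -- predicate C on bundled manifolds lets one rewrite carry over all the structure at once.
  let Y : ∀ e, PureManifold.{u} e := Function.update empty k X
  refine ⟨⟨fun e => (Y e).carrier⟩, fun e he => ?_, ?_⟩
  · have h1 : Y e = empty e := Function.update_of_ne he _ _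
    change IsEmpty (Y e).carrier
    rw [h1]
    exact inferInstanceAs (IsEmpty PEmpty)
  · have h1 : Y k = X := Function.update_self _ _ _
    change C (Y k)
    rwa [h1]

end PureManifold

/-! ### Submersive retracts of open subsets of a bi-submersion -/

section Retract

set_option linter.unusedSectionVars false

variable {k d m n : ℕ} {X : Type*} [TopologicalSpace X] [ChartedSpace (EuclideanSpace ℝ (Fin k)) X]
  [IsManifold (𝓡 k) ∞ X]
  {W : Type*} [TopologicalSpace W] [ChartedSpace (EuclideanSpace ℝ (Fin d)) W]
  [IsManifold (𝓡 d) ∞ W]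
  {M : Type*} [TopologicalSpace M]
  [ChartedSpace (EuclideanSpace ℝ (Fin m)) M]
  {N : Type*} [TopologicalSpace N] [ChartedSpace (EuclideanSpace ℝ (Fin n)) N]

/-- The open subset `S` of `X` is a retract of the open subset `R` of `W`, by a submersion which is
compatible with the maps to `M` and `N` and along which vector fields can be lifted. -/
structure IsSubmersiveRetract (p' : X → M) (q' : X → N) (p : W → M) (q : W → N) (S : Opens X)
    (R : Opens W) (incl : X → W) (retr : W → X) : Prop where
  incl_smooth : ∀ x ∈ S, ContMDiffAt (𝓡 k) (𝓡 d) ∞ incl x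
  retr_smooth : ∀ w ∈ R, ContMDiffAt (𝓡 d) (𝓡 k) ∞ retr w
  incl_mem : ∀ x ∈ S, incl x ∈ R
  retr_mem : ∀ w ∈ R, retr w ∈ S
  retr_incl : ∀ x ∈ S, retr (incl x) = x
  left : ∀ w ∈ R, p' (retr w) = p w
  right : ∀ w ∈ R, q' (retr w) = q w
  surjective : ∀ w ∈ R, Function.Surjective (mfderiv (𝓡 d) (𝓡 k) retr w)
  lift : ∀ (O : Opens X) (Z : VField k X), Z.SmoothOn O → ∃ Z' : VField d W,
    ∀ w ∈ R, retr w ∈ O →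
      ContMDiffAt (𝓡 d) (𝓡 d).tangent ∞ (fun w => (⟨w, Z' w⟩ : TangentBundle (𝓡 d) W)) w ∧
      mfderiv (𝓡 d) (𝓡 k) retr w (Z' w) = Z (retr w)

namespace IsSubmersiveRetract

variable {p' : X → M} {q' : X → N} {p : W → M} {q : W → N} {S : Opens X} {R : Opens W}
  {incl : X → W} {retr : W → X}

theorem swap (h : IsSubmersiveRetract (k := k) (d := d) p' q' p q S R incl retr) :
    IsSubmersiveRetract (k := k) (d := d) q' p' q p S R incl retr :=
  ⟨h.incl_smooth, h.retr_smooth, h.incl_mem, h.retr_mem, h.retr_incl, h.right, h.left, h.surjective,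
    h.lift⟩

theorem apply_incl (h : IsSubmersiveRetract (k := k) (d := d) p' q' p q S R incl retr) {x : X}
    (hx : x ∈ S) : p (incl x) = p' x := by
  rw [← h.left _ (h.incl_mem x hx), h.retr_incl x hx]

theorem contMDiffAt (h : IsSubmersiveRetract (k := k) (d := d) p' q' p q S R incl retr)
    (hp : ContMDiff (𝓡 d) (𝓡 m) ∞ p) {x : X} (hx : x ∈ S) : ContMDiffAt (𝓡 k) (𝓡 m) ∞ p' x := by
  refine (hp.contMDiffAt.comp x (h.incl_smooth x hx)).congr_of_eventuallyEq ?_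
  filter_upwards [S.isOpen.mem_nhds hx] with y hy
  exact (h.apply_incl hy).symm

theorem mfderiv_left (h : IsSubmersiveRetract (k := k) (d := d) p' q' p q S R incl retr)
    (hp : ContMDiff (𝓡 d) (𝓡 m) ∞ p) {w : W} (hw : w ∈ R) (v : TangentSpace (𝓡 d) w) :
    mfderiv (𝓡 k) (𝓡 m) p' (retr w) (mfderiv (𝓡 d) (𝓡 k) retr w v) =
      (mfderiv (𝓡 d) (𝓡 m) p w v : EuclideanSpace ℝ (Fin m)) := by
  have h1 : p =ᶠ[𝓝 w] p' ∘ retr := by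
    filter_upwards [R.isOpen.mem_nhds hw] with y hy using (h.left y hy).symm
  have h2 := mfderiv_comp w
    ((h.contMDiffAt hp (h.retr_mem w hw)).mdifferentiableAt (by simp))
    ((h.retr_smooth w hw).mdifferentiableAt (by simp))
  rw [h1.mfderiv_eq, h2]
  rfl

theorem surjective_mfderiv (h : IsSubmersiveRetract (k := k) (d := d) p' q' p q S R incl retr)
    (hp : ContMDiff (𝓡 d) (𝓡 m) ∞ p) (hps : ∀ w, Function.Surjective (mfderiv (𝓡 d) (𝓡 m) p w))
    {x : X} (hx : x ∈ S) : Function.Surjective (mfderiv (𝓡 k) (𝓡 m) p' x) := by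
  intro v
  obtain ⟨u, hu⟩ := hps (incl x) v
  have h1 := h.mfderiv_left hp (h.incl_mem x hx) u
  rw [h.retr_incl x hx] at h1
  exact ⟨_, h1.trans hu⟩

theorem injective_mfderiv_incl (h : IsSubmersiveRetract (k := k) (d := d) p' q' p q S R incl retr)
    {x : X} (hx : x ∈ S) : Function.Injective (mfderiv (𝓡 k) (𝓡 d) incl x) := by
  have h1 : retr ∘ incl =ᶠ[𝓝 x] id := by
    filter_upwards [S.isOpen.mem_nhds hx] with y hy using h.retr_incl y hy
  have h2 := mfderiv_comp x
    ((h.retr_smooth _ (h.incl_mem x hx)).mdifferentiableAt (by simp))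
    ((h.incl_smooth x hx).mdifferentiableAt (by simp))
  rw [h1.mfderiv_eq, mfderiv_id] at h2
  intro v v' hv
  have h3 : ∀ v, (mfderiv (𝓡 d) (𝓡 k) retr (incl x) (mfderiv (𝓡 k) (𝓡 d) incl x v) :
    EuclideanSpace ℝ (Fin k)) = v := fun v => (DFunLike.congr_fun h2 v).symm
  rw [← h3 v, ← h3 v', hv]

/-- The push-forward along the retraction of a vector field on `W`, restricted to `X`. -/
noncomputable def _root_.descend (incl : X → W) (retr : W → X) (ξ : VField d W) : VField k X :=
  fun x => (mfderiv (𝓡 d) (𝓡 k) retr (incl x) (ξ (incl x)) : EuclideanSpace ℝ (Fin k))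

theorem contMDiffAt_descend (h : IsSubmersiveRetract (k := k) (d := d) p' q' p q S R incl retr)
    {ξ : VField d W} {x : X} (hx : x ∈ S)
    (hξ : ContMDiffAt (𝓡 d) (𝓡 d).tangent ∞ (fun w => (⟨w, ξ w⟩ : TangentBundle (𝓡 d) W)) (incl x)) :
    ContMDiffAt (𝓡 k) (𝓡 k).tangent ∞
      (fun x => (⟨x, descend (k := k) incl retr ξ x⟩ : TangentBundle (𝓡 k) X)) x := by
  have h1 := ContMDiffAt.tangentMap_section (I := 𝓡 d) (J := 𝓡 k) (f := retr) (Z := ξ)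
    (Filter.eventually_of_mem (R.isOpen.mem_nhds (h.incl_mem x hx)) fun w hw => h.retr_smooth w hw) hξ
  refine (h1.comp x (h.incl_smooth x hx)).congr_of_eventuallyEq ?_
  filter_upwards [S.isOpen.mem_nhds hx] with y hy
  -- All tangent spaces are the model space by definition, so vectors over `retr (incl y)` and over
  -- y can be compared by substituting equal base points. The same device recurs below.
  have key : ∀ (a b : X) (v : EuclideanSpace ℝ (Fin k)), a = b →
      (⟨a, v⟩ : TangentBundle (𝓡 k) X) = ⟨b, v⟩ := by rintro a b v rfl; rfl
  exact key _ _ _ (h.retr_incl y hy).symm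

theorem mfderiv_descend (h : IsSubmersiveRetract (k := k) (d := d) p' q' p q S R incl retr)
    (hp : ContMDiff (𝓡 d) (𝓡 m) ∞ p) (ξ : VField d W) {x : X} (hx : x ∈ S) :
    (mfderiv (𝓡 k) (𝓡 m) p' x (descend (k := k) incl retr ξ x) : EuclideanSpace ℝ (Fin m)) =
      mfderiv (𝓡 d) (𝓡 m) p (incl x) (ξ (incl x)) := by
  have h1 := h.mfderiv_left hp (h.incl_mem x hx) (ξ (incl x))
  rw [← h1]
  have key : ∀ (a b : X) (v : EuclideanSpace ℝ (Fin k)), a = b →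
      (mfderiv (𝓡 k) (𝓡 m) p' a v : EuclideanSpace ℝ (Fin m)) = mfderiv (𝓡 k) (𝓡 m) p' b v := by
    rintro a b v rfl; rfl
  exact key _ _ _ (h.retr_incl x hx).symm

variable [IsManifold (𝓡 m) ∞ M] [IsManifold (𝓡 n) ∞ N]
  {FM : SingularFoliation m M} {FN : SingularFoliation n N}

/-- The open subset of `R` that retracts to `O`. -/
theorem exists_opens (h : IsSubmersiveRetract (k := k) (d := d) p' q' p q S R incl retr)
    (O : Opens X) : ∃ O' : Opens W, ∀ w, w ∈ O' ↔ w ∈ R ∧ retr w ∈ O := by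
  have h1 : ContinuousOn retr R := fun w hw => (h.retr_smooth w hw).continuousAt.continuousWithinAt
  exact ⟨⟨R ∩ retr ⁻¹' O, h1.isOpen_inter_preimage R.isOpen O.isOpen⟩, fun w => Iff.rfl⟩

/-- Compatibility of the retraction with p makes a lift of Z to W belong to p⁻¹(F_M). It therefore
splits into fields of ker Tp and ker Tq, and pushing both summands back along the retraction splits
Z. -/
theorem kerSumSec_of_pullbackSec
    (h : IsSubmersiveRetract (k := k) (d := d) p' q' p q S R incl retr)
    (hW : IsPureBiSubmersion (d := d) FM FN p q) {O : Opens X} (hO : O ≤ S) {Z : VField k X}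
    (hZ : Z ∈ pullbackSec (d := k) FM p' O) : Z ∈ kerSumSec (d := k) m n p' q' O := by
  obtain ⟨Z', hZ'⟩ := h.lift O Z hZ.1
  obtain ⟨O', hO'⟩ := h.exists_opens O
  have hp := hW.smooth_left
  have hmem : Z' ∈ pullbackSec (d := d) FM p O' := by
    refine ⟨fun w hw => (hZ' w ((hO' w).1 hw).1 ((hO' w).1 hw).2).1.contMDiffWithinAt, ?_⟩
    intro w hw
    obtain ⟨hwR, hwO⟩ := (hO' w).1 hw
    obtain ⟨O₁, hwO₁, hO₁O, U, hU, r, Y, f, hY, hf, hsum⟩ := hZ.2 (retr w) hwO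
    obtain ⟨O₁', hO₁'⟩ := h.exists_opens O₁
    refine ⟨O₁', (hO₁' w).2 ⟨hwR, hwO₁⟩, fun y hy => (hO' y).2 ⟨((hO₁' y).1 hy).1,
      hO₁O ((hO₁' y).1 hy).2⟩, U, ?_, r, Y, fun i y => f i (retr y), hY, ?_, ?_⟩
    · intro y hy
      rw [← h.left y ((hO₁' y).1 hy).1]
      exact hU _ ((hO₁' y).1 hy).2
    · intro i y hy
      obtain ⟨hyR, hyO⟩ := (hO₁' y).1 hy
      exact (((hf i).contMDiffAt (O₁.isOpen.mem_nhds hyO)).comp y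
        (h.retr_smooth y hyR)).contMDiffWithinAt
    · intro y hy
      obtain ⟨hyR, hyO⟩ := (hO₁' y).1 hy
      have e1 := h.mfderiv_left hp hyR (Z' y)
      rw [(hZ' y hyR (hO₁O hyO)).2] at e1
      refine e1.symm.trans ((hsum _ hyO).trans ?_)
      have key : ∀ (a b : M), a = b → (∑ i, f i (retr y) • (Y i a : EuclideanSpace ℝ (Fin m))) =
          ∑ i, f i (retr y) • (Y i b : EuclideanSpace ℝ (Fin m)) := by rintro a b rfl; rfl
      exact key _ _ (h.left y hyR)
  rw [hW.pullback_eq_kerSum] at hmem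
  obtain ⟨ξ, ζ, hξ, hζ, hξp, hζq, hsum⟩ := hmem
  have hin : ∀ x ∈ O, incl x ∈ O' := fun x hx => (hO' _).2 ⟨h.incl_mem x (hO hx), by
    rwa [h.retr_incl x (hO hx)]⟩
  refine ⟨descend incl retr ξ, descend incl retr ζ, ?_, ?_, ?_, ?_, ?_⟩
  · intro x hx
    exact (h.contMDiffAt_descend (hO hx)
      (ContMDiffOn.contMDiffAt hξ (O'.isOpen.mem_nhds (hin x hx)))).contMDiffWithinAt
  · intro x hx
    exact (h.contMDiffAt_descend (hO hx)
      (ContMDiffOn.contMDiffAt hζ (O'.isOpen.mem_nhds (hin x hx)))).contMDiffWithinAt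
  · intro x hx
    exact (h.mfderiv_descend hp ξ (hO hx)).trans (hξp _ (hin x hx))
  · intro x hx
    exact (h.swap.mfderiv_descend hW.smooth_right ζ (hO hx)).trans (hζq _ (hin x hx))
  · intro x hx
    have e1 := (hZ' _ (h.incl_mem x (hO hx)) (((hO' _).1 (hin x hx)).2)).2
    rw [hsum _ (hin x hx), map_add] at e1
    have key : ∀ (a b : X), a = b → (Z a : EuclideanSpace ℝ (Fin k)) = Z b := by
      rintro a b rfl; rfl
    exact (key _ _ (h.retr_incl x (hO hx))).symm.trans e1.symm

/-- The two summands are lifted separately and stay in ker Tp and ker Tq. Their sum is then in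
p⁻¹(F_M), and the local expression obtained on W is pulled back along the inclusion. -/
theorem pullbackSec_of_kerSumSec
    (h : IsSubmersiveRetract (k := k) (d := d) p' q' p q S R incl retr)
    (hW : IsPureBiSubmersion (d := d) FM FN p q) {O : Opens X} (hO : O ≤ S) {Z : VField k X}
    (hZs : Z.SmoothOn O)
    (hZ : Z ∈ kerSumSec (d := k) m n p' q' O) : Z ∈ pullbackSec (d := k) FM p' O := by
  obtain ⟨ξ, ζ, hξ, hζ, hξp, hζq, hsum⟩ := hZ
  obtain ⟨ξ', hξ'⟩ := h.lift O ξ hξ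
  obtain ⟨ζ', hζ'⟩ := h.lift O ζ hζ
  obtain ⟨O', hO'⟩ := h.exists_opens O
  have hp := hW.smooth_left
  have hmem : (fun w => ξ' w + ζ' w) ∈ kerSumSec (d := d) m n p q O' := by
    refine ⟨ξ', ζ', fun w hw => (hξ' w ((hO' w).1 hw).1 ((hO' w).1 hw).2).1.contMDiffWithinAt,
      fun w hw => (hζ' w ((hO' w).1 hw).1 ((hO' w).1 hw).2).1.contMDiffWithinAt, ?_, ?_,
      fun w _ => rfl⟩
    · intro w hw
      obtain ⟨hwR, hwO⟩ := (hO' w).1 hw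
      have e1 := h.mfderiv_left hp hwR (ξ' w)
      rw [(hξ' w hwR hwO).2] at e1
      exact e1.symm.trans (hξp _ hwO)
    · intro w hw
      obtain ⟨hwR, hwO⟩ := (hO' w).1 hw
      have e1 := h.swap.mfderiv_left hW.smooth_right hwR (ζ' w)
      rw [(hζ' w hwR hwO).2] at e1
      exact e1.symm.trans (hζq _ hwO)
  rw [← hW.pullback_eq_kerSum] at hmem
  refine ⟨hZs, fun x hx => ?_⟩
  have hin : ∀ x ∈ O, incl x ∈ O' := fun x hx => (hO' _).2 ⟨h.incl_mem x (hO hx), by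
    rwa [h.retr_incl x (hO hx)]⟩
  obtain ⟨O₁, hwO₁, hO₁O, U, hU, r, Y, f, hY, hf, hsum'⟩ := hmem.2 (incl x) (hin x hx)
  obtain ⟨O₂, hxO₂, hO₂⟩ := exists_opens_of_eventually ((O.isOpen.eventually_mem hx).and
    ((h.incl_smooth x (hO hx)).continuousAt.eventually (O₁.isOpen.mem_nhds hwO₁)))
  refine ⟨O₂, hxO₂, fun y hy => (hO₂ y hy).1, U, ?_, r, Y, fun i y => f i (incl y), hY, ?_, ?_⟩
  · intro y hy
    rw [← h.apply_incl (hO (hO₂ y hy).1)]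
    exact hU _ (hO₂ y hy).2
  · intro i y hy
    exact (((hf i).contMDiffAt (O₁.isOpen.mem_nhds (hO₂ y hy).2)).comp y
      (h.incl_smooth y (hO (hO₂ y hy).1))).contMDiffWithinAt
  · intro y hy
    have hyO := (hO₂ y hy).1
    have hyR := h.incl_mem y (hO hyO)
    have hyr : retr (incl y) ∈ O := by rwa [h.retr_incl y (hO hyO)]
    have e1 := h.mfderiv_descend hp (fun w => ξ' w + ζ' w) (hO hyO)
    have e2 : descend (k := k) incl retr (fun w => ξ' w + ζ' w) y = Z y := by
      have e3 : descend (k := k) incl retr (fun w => ξ' w + ζ' w) y =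
          (ξ (retr (incl y)) + ζ (retr (incl y)) : EuclideanSpace ℝ (Fin k)) := by
        refine (map_add (mfderiv (𝓡 d) (𝓡 k) retr (incl y)) (ξ' (incl y)) (ζ' (incl y))).trans ?_
        rw [(hξ' _ hyR hyr).2, (hζ' _ hyR hyr).2]
      rw [e3, hsum y hyO]
      have key : ∀ (a b : X), a = b → (ξ a + ζ a : EuclideanSpace ℝ (Fin k)) = ξ b + ζ b := by
        rintro a b rfl; rfl
      exact key _ _ (h.retr_incl y (hO hyO))
    rw [e2] at e1
    refine e1.trans ((hsum' _ (hO₂ y hy).2).trans ?_)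
    have key : ∀ (a b : M), a = b → (∑ i, f i (incl y) • (Y i a : EuclideanSpace ℝ (Fin m))) =
        ∑ i, f i (incl y) • (Y i b : EuclideanSpace ℝ (Fin m)) := by rintro a b rfl; rfl
    exact key _ _ (h.apply_incl (hO hyO))

end IsSubmersiveRetract

end Retract

/-! ### Assembling a bi-submersion from disjoint open pieces -/

section Glue

set_option linter.unusedSectionVars false

variable {k m n : ℕ} {X : Type*} [TopologicalSpace X] [ChartedSpace (EuclideanSpace ℝ (Fin k)) X]
  [IsManifold (𝓡 k) ∞ X]
  {M : Type*} [TopologicalSpace M]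
  [ChartedSpace (EuclideanSpace ℝ (Fin m)) M] [IsManifold (𝓡 m) ∞ M]
  {N : Type*} [TopologicalSpace N] [ChartedSpace (EuclideanSpace ℝ (Fin n)) N]
  [IsManifold (𝓡 n) ∞ N]
  {FM : SingularFoliation m M} {FN : SingularFoliation n N}

theorem smoothOn_of_mem_kerSumSec {p' : X → M} {q' : X → N} {O : Opens X} {Z : VField k X}
    (hZ : Z ∈ kerSumSec (d := k) m n p' q' O) : Z.SmoothOn O := by
  obtain ⟨ξ, ζ, hξ, hζ, -, -, hsum⟩ := hZ
  refine (ContMDiffOn.add_section hξ hζ).congr fun y hy => ?_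
  rw [hsum y hy]
  rfl

theorem mem_pullbackSec_iff_forall {I : Type*} {idx : X → I} {S : I → Opens X}
    (hS : ∀ i x, x ∈ S i ↔ idx x = i) {p' : X → M} {O : Opens X} {Z : VField k X} :
    Z ∈ pullbackSec (d := k) FM p' O ↔ ∀ x : X, Z ∈ pullbackSec (d := k) FM p' (O ⊓ S (idx x)) := by
  constructor
  · intro h x
    refine ⟨h.1.mono fun y hy => hy.1, fun w hw => ?_⟩
    obtain ⟨O', hwO', hO'O, U, hU, r, Y, f, hY, hf, hsum⟩ := h.2 w hw.1
    exact ⟨O' ⊓ S (idx x), ⟨hwO', hw.2⟩, fun y hy => ⟨hO'O hy.1, hy.2⟩, U, fun y hy => hU y hy.1, r,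
      Y, f, hY, fun i => (hf i).mono fun y hy => hy.1, fun y hy => hsum y hy.1⟩
  · intro h
    have hx : ∀ x, x ∈ S (idx x) := fun x => (hS _ x).2 rfl
    refine ⟨fun x hxO => ?_, fun w hw => ?_⟩
    · exact (ContMDiffOn.contMDiffAt (h x).1
        ((O ⊓ S (idx x)).isOpen.mem_nhds ⟨hxO, hx x⟩)).contMDiffWithinAt
    · obtain ⟨O', hwO', hO'O, h'⟩ := (h w).2 w ⟨hw, hx w⟩
      exact ⟨O', hwO', fun y hy => (hO'O hy).1, h'⟩

/-- The pieces are open and disjoint, so decompositions chosen independently on them glue without a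
partition of unity. -/
theorem mem_kerSumSec_iff_forall {I : Type*} {idx : X → I} {S : I → Opens X}
    (hS : ∀ i x, x ∈ S i ↔ idx x = i) {p' : X → M} {q' : X → N} {O : Opens X} {Z : VField k X} :
    Z ∈ kerSumSec (d := k) m n p' q' O ↔
      ∀ x : X, Z ∈ kerSumSec (d := k) m n p' q' (O ⊓ S (idx x)) := by
  constructor
  · rintro ⟨ξ, ζ, hξ, hζ, hξp, hζq, hsum⟩ x
    exact ⟨ξ, ζ, hξ.mono fun y hy => hy.1, hζ.mono fun y hy => hy.1, fun y hy => hξp y hy.1,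
      fun y hy => hζq y hy.1, fun y hy => hsum y hy.1⟩
  · intro h
    -- Decompositions are chosen once per value of `idx` and not once per point: the choice is then
    -- locally constant, which makes the glued fields smooth.
    have h' : ∀ i : Set.range idx, Z ∈ kerSumSec (d := k) m n p' q' (O ⊓ S i) := by
      rintro ⟨_, x, rfl⟩
      exact h x
    choose ξ ζ hξ hζ hξp hζq hsum using h'
    let j : X → Set.range idx := fun x => ⟨idx x, x, rfl⟩
    have hx : ∀ x ∈ O, x ∈ O ⊓ S (j x) := fun x hxO => ⟨hxO, (hS _ x).2 rfl⟩
    have hglue : ∀ ξ : Set.range idx → VField k X, (∀ i, (ξ i).SmoothOn (O ⊓ S i)) →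
        VField.SmoothOn (fun x => ξ (j x) x) O := by
      intro ξ hξ x hxO
      have h1 := ContMDiffOn.contMDiffAt (hξ (j x)) ((O ⊓ S (j x)).isOpen.mem_nhds (hx x hxO))
      refine (h1.congr_of_eventuallyEq ?_).contMDiffWithinAt
      filter_upwards [(S (j x)).isOpen.mem_nhds (hx x hxO).2] with y hy
      have : j y = j x := Subtype.ext ((hS _ y).1 hy)
      simp only [this]
    exact ⟨fun x => ξ (j x) x, fun x => ζ (j x) x, hglue ξ hξ, hglue ζ hζ,
      fun y hy => hξp (j y) y (hx y hy), fun y hy => hζq (j y) y (hx y hy),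
      fun y hy => hsum (j y) y (hx y hy)⟩

/-- A manifold whose components are submersive retracts of open subsets of a bi-submersion is a
bi-submersion. -/
theorem IsPureBiSubmersion.of_retracts {W : MixedManifold.{u}} {p : W.Pt → M} {q : W.Pt → N}
    (hW : IsBiSubmersion FM FN W p q) {I : Type*} {idx : X → I} {S : I → Opens X}
    (hS : ∀ i x, x ∈ S i ↔ idx x = i) {p' : X → M} {q' : X → N}
    (h : ∀ x : X, ∃ (d : ℕ) (R : Opens (W.part d)) (incl : X → W.part d) (retr : W.part d → X),
      IsSubmersiveRetract (k := k) (d := d) p' q' (fun w => p ⟨d, w⟩) (fun w => q ⟨d, w⟩)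
        (S (idx x)) R incl retr) :
    IsPureBiSubmersion (d := k) FM FN p' q' := by
  choose d R incl retr h using h
  have hx : ∀ x, x ∈ S (idx x) := fun x => (hS _ x).2 rfl
  have hl : ∀ O, pullbackSec (d := k) FM p' O = kerSumSec (d := k) m n p' q' O := by
    intro O
    ext Z
    rw [mem_pullbackSec_iff_forall hS, mem_kerSumSec_iff_forall hS]
    exact forall_congr' fun x => ⟨(h x).kerSumSec_of_pullbackSec (hW (d x)) inf_le_right,
      fun hZ => (h x).pullbackSec_of_kerSumSec (hW (d x)) inf_le_right (smoothOn_of_mem_kerSumSec hZ) hZ⟩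
  have hr : ∀ O, pullbackSec (d := k) FN q' O = kerSumSec (d := k) n m q' p' O := by
    intro O
    ext Z
    rw [mem_pullbackSec_iff_forall hS, mem_kerSumSec_iff_forall hS]
    exact forall_congr' fun x => ⟨(h x).swap.kerSumSec_of_pullbackSec (hW (d x)).swap inf_le_right,
      fun hZ => (h x).swap.pullbackSec_of_kerSumSec (hW (d x)).swap inf_le_right
        (smoothOn_of_mem_kerSumSec hZ) hZ⟩
  exact {
    smooth_left := fun x => (h x).contMDiffAt (hW (d x)).smooth_left (hx x)
    smooth_right := fun x => (h x).swap.contMDiffAt (hW (d x)).smooth_right (hx x)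
    submersion_left := fun x => (h x).surjective_mfderiv (hW (d x)).smooth_left
      (hW (d x)).submersion_left (hx x)
    submersion_right := fun x => (h x).swap.surjective_mfderiv (hW (d x)).smooth_right
      (hW (d x)).submersion_right (hx x)
    pullback_eq := fun O => by rw [hl, hr, kerSumSec_swap]
    pullback_eq_kerSum := hl }

end Glue

section MfderivPush

variable {E F H K A B : Type*} [NormedAddCommGroup E] [NormedSpace ℝ E] [NormedAddCommGroup F]
  [NormedSpace ℝ F] [TopologicalSpace H] [TopologicalSpace K] [TopologicalSpace A]
  [TopologicalSpace B] [ChartedSpace H A] [ChartedSpace K B] {I : ModelWithCorners ℝ E H}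
  {J : ModelWithCorners ℝ F K}

theorem mfderiv_symm_pushField {Φ : OpenPartialHomeomorph A B} (hΦ : IsSmoothHomeo I J Φ)
    (Z : ∀ a : A, TangentSpace I a) {b : B} (hb : b ∈ Φ.target) :
    (mfderiv J I Φ.symm b (pushField I J Φ Z b) : E) = Z (Φ.symm b) := by
  have h1 := hΦ.mfderiv_symm_mfderiv (Φ.map_target hb) (Z (Φ.symm b))
  rw [Φ.right_inv hb] at h1
  exact h1

end MfderivPush

/-! ### Two kinds of retracts: diffeomorphic copies and slices -/

section Constructors

variable {k l d : ℕ} {X : Type*} [TopologicalSpace X] [ChartedSpace (EuclideanSpace ℝ (Fin k)) X]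
  [IsManifold (𝓡 k) ∞ X] {M N : Type*}

theorem IsSubmersiveRetract.of_isSmoothHomeo {W : Type*} [TopologicalSpace W]
    [ChartedSpace (EuclideanSpace ℝ (Fin k)) W] [IsManifold (𝓡 k) ∞ W]
    {p' : X → M} {q' : X → N} {p : W → M} {q : W → N} {φ : OpenPartialHomeomorph X W}
    (hφ : IsSmoothHomeo (𝓡 k) (𝓡 k) φ) (hp : ∀ x ∈ φ.source, p' x = p (φ x))
    (hq : ∀ x ∈ φ.source, q' x = q (φ x)) :
    IsSubmersiveRetract (k := k) (d := k) p' q' p q ⟨φ.source, φ.open_source⟩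
      ⟨φ.target, φ.open_target⟩ φ φ.symm where
  incl_smooth _ hx := hφ.contMDiffAt hx
  retr_smooth _ hw := hφ.symm.contMDiffAt hw
  incl_mem _ hx := φ.map_source hx
  retr_mem _ hw := φ.map_target hw
  retr_incl _ hx := φ.left_inv hx
  left w hw := by rw [hp _ (φ.map_target hw), φ.right_inv hw]
  right w hw := by rw [hq _ (φ.map_target hw), φ.right_inv hw]
  surjective _ hw := hφ.symm.mfderiv_surjective hw
  lift O Z hZ := ⟨pushField (𝓡 k) (𝓡 k) φ Z, fun _ hw hwO =>
    ⟨contMDiffAt_pushField hφ hw (ContMDiffOn.contMDiffAt hZ (O.isOpen.mem_nhds hwO)),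
      mfderiv_symm_pushField hφ Z hw⟩⟩

variable {W : Type*} [TopologicalSpace W] [ChartedSpace (EuclideanSpace ℝ (Fin d)) W]
  [IsManifold (𝓡 d) ∞ W]

/-- The points of a sliced chart over a given open set. -/
def sliceOpens {A B : Type*} [TopologicalSpace A] [TopologicalSpace B]
    (Ψ : OpenPartialHomeomorph (A × B) W) {U : Set A} (hU : IsOpen U) : Opens W :=
  ⟨Ψ.target ∩ Ψ.symm ⁻¹' (Prod.fst ⁻¹' U),
    Ψ.symm.isOpen_inter_preimage (hU.preimage continuous_fst)⟩

/-- In the chart the retraction is (s, t) ↦ s, followed by the inclusion at height b. It respects p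
and q because these do not depend on t, and fields are lifted with zero component along the second
factor. -/
theorem IsSubmersiveRetract.of_isSliced {p' : X → M} {q' : X → N} {p : W → M} {q : W → N}
    {Ψ : OpenPartialHomeomorph (EuclideanSpace ℝ (Fin k) × EuclideanSpace ℝ (Fin l)) W}
    (hΨ : IsSliced (d := d) p q Ψ) {κ : OpenPartialHomeomorph X (EuclideanSpace ℝ (Fin k))}
    (hκ : IsSmoothHomeo (𝓡 k) (𝓡 k) κ) {b : EuclideanSpace ℝ (Fin l)}
    (hb : ∀ s ∈ κ.target, (s, b) ∈ Ψ.source)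
    (hp : ∀ x ∈ κ.source, p' x = p (Ψ (κ x, b))) (hq : ∀ x ∈ κ.source, q' x = q (Ψ (κ x, b))) :
    IsSubmersiveRetract (k := k) (d := d) p' q' p q ⟨κ.source, κ.open_source⟩
      (sliceOpens Ψ κ.open_target) (fun x => Ψ (κ x, b)) (fun w => κ.symm (Ψ.symm w).1) := by
  let A := EuclideanSpace ℝ (Fin k)
  let B := EuclideanSpace ℝ (Fin l)
  have hfst : ∀ z : A × B, ContMDiffAt 𝓘(ℝ, A × B) (𝓡 k) ∞ (Prod.fst : A × B → A) z :=
    fun z => contDiff_fst.contMDiff z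
  have h1 : ∀ w ∈ Ψ.target, ContMDiffAt (𝓡 d) (𝓡 k) ∞ (fun w => (Ψ.symm w).1) w := fun w hw =>
    (hfst _).comp w (hΨ.smooth.symm.contMDiffAt hw)
  have hder : ∀ w ∈ Ψ.target, ∀ v : EuclideanSpace ℝ (Fin d),
      (mfderiv (𝓡 d) (𝓡 k) (fun w => (Ψ.symm w).1) w v : A) =
        (mfderiv (𝓡 d) 𝓘(ℝ, A × B) Ψ.symm w v : A × B).1 := by
    intro w hw v
    have h2 := mfderiv_comp w ((hfst (Ψ.symm w)).mdifferentiableAt (by simp))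
      ((hΨ.smooth.symm.contMDiffAt hw).mdifferentiableAt (by simp))
    have h3 : mfderiv 𝓘(ℝ, A × B) (𝓡 k) (Prod.fst : A × B → A) (Ψ.symm w) =
        (ContinuousLinearMap.fst ℝ A B : A × B →L[ℝ] A) := by
      rw [mfderiv_eq_fderiv, fderiv_fst]
    rw [h3] at h2
    exact DFunLike.congr_fun h2 v
  have hcomp : ∀ w ∈ sliceOpens Ψ κ.open_target, ∀ v : EuclideanSpace ℝ (Fin d),
      (mfderiv (𝓡 d) (𝓡 k) (fun w => κ.symm (Ψ.symm w).1) w v : A) =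
        mfderiv (𝓡 k) (𝓡 k) κ.symm (Ψ.symm w).1
          (mfderiv (𝓡 d) 𝓘(ℝ, A × B) Ψ.symm w v : A × B).1 := by
    intro w hw v
    have h2 := mfderiv_comp w ((hκ.symm.contMDiffAt hw.2).mdifferentiableAt (by simp))
      ((h1 w hw.1).mdifferentiableAt (by simp))
    refine (DFunLike.congr_fun h2 v).trans ?_
    exact congrArg (mfderiv (𝓡 k) (𝓡 k) κ.symm (Ψ.symm w).1) (hder w hw.1 v)
  constructor
  · intro x hx
    have h2 : ContMDiffAt (𝓡 k) 𝓘(ℝ, A × B) ∞ (fun x => (κ x, b)) x := by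
      have h3 : ContDiff ℝ ∞ fun s : A => (s, b) := contDiff_id.prodMk contDiff_const
      exact h3.contMDiff.contMDiffAt.comp x (hκ.contMDiffAt hx)
    exact (hΨ.smooth.contMDiffAt (hb _ (κ.map_source hx))).comp x h2
  · intro w hw
    exact (hκ.symm.contMDiffAt hw.2).comp w (h1 w hw.1)
  · intro x hx
    have h2 := hb _ (κ.map_source hx)
    refine ⟨Ψ.map_source h2, ?_⟩
    simp only [Set.mem_preimage, Ψ.left_inv h2]
    exact κ.map_source hx
  · intro w hw
    exact κ.map_target hw.2
  · intro x hx
    simp only [Ψ.left_inv (hb _ (κ.map_source hx))]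
    exact κ.left_inv hx
  · intro w hw
    rw [hp _ (κ.map_target hw.2), κ.right_inv hw.2,
      hΨ.left (Ψ.symm w).1 b (Ψ.symm w).2 (hb _ hw.2) (Ψ.map_target hw.1), Prod.mk.eta,
      Ψ.right_inv hw.1]
  · intro w hw
    rw [hq _ (κ.map_target hw.2), κ.right_inv hw.2,
      hΨ.right (Ψ.symm w).1 b (Ψ.symm w).2 (hb _ hw.2) (Ψ.map_target hw.1), Prod.mk.eta,
      Ψ.right_inv hw.1]
  · intro w hw v
    obtain ⟨s, hs⟩ := hκ.symm.mfderiv_surjective hw.2 v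
    obtain ⟨u, hu⟩ := hΨ.smooth.symm.mfderiv_surjective hw.1 ((s, 0) : A × B)
    refine ⟨u, (hcomp w hw u).trans ?_⟩
    refine (congrArg (fun z : A × B => (mfderiv (𝓡 k) (𝓡 k) κ.symm (Ψ.symm w).1 z.1 : A)) hu).trans ?_
    exact hs
  · intro O Z hZ
    let Z₁ : A → A := pushField (𝓡 k) (𝓡 k) κ Z
    let Z₂ : A × B → A × B := fun z => (Z₁ z.1, 0)
    refine ⟨pushField 𝓘(ℝ, A × B) (𝓡 d) Ψ Z₂, fun w hw hwO => ⟨?_, ?_⟩⟩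
    · have h2 : ContDiffAt ℝ ∞ Z₁ (Ψ.symm w).1 := contMDiffAt_vectorSpace_iff_contDiffAt.1
        (contMDiffAt_pushField hκ hw.2 (ContMDiffOn.contMDiffAt hZ (O.isOpen.mem_nhds hwO)))
      have h3 : ContDiffAt ℝ ∞ Z₂ (Ψ.symm w) :=
        (ContDiffAt.comp (Ψ.symm w) h2 contDiffAt_fst).prodMk contDiffAt_const
      exact contMDiffAt_pushField hΨ.smooth hw.1 (contMDiffAt_vectorSpace_iff_contDiffAt.2 h3)
    · refine (hcomp w hw _).trans ?_
      have h2 : (mfderiv (𝓡 d) 𝓘(ℝ, A × B) Ψ.symm w (pushField 𝓘(ℝ, A × B) (𝓡 d) Ψ Z₂ w) : A × B) =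
          Z₂ (Ψ.symm w) := mfderiv_symm_pushField hΨ.smooth Z₂ hw.1
      refine (congrArg (fun z : A × B => (mfderiv (𝓡 k) (𝓡 k) κ.symm (Ψ.symm w).1 z.1 : A)) h2).trans ?_
      exact mfderiv_symm_pushField hκ Z hw.2

end Constructors

theorem IsSmoothHomeo.trans {E F G H K L A B C : Type*} [NormedAddCommGroup E] [NormedSpace ℝ E]
    [NormedAddCommGroup F] [NormedSpace ℝ F] [NormedAddCommGroup G] [NormedSpace ℝ G]
    [TopologicalSpace H] [TopologicalSpace K] [TopologicalSpace L] [TopologicalSpace A]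
    [TopologicalSpace B] [TopologicalSpace C] [ChartedSpace H A] [ChartedSpace K B]
    [ChartedSpace L C] {I : ModelWithCorners ℝ E H} {J : ModelWithCorners ℝ F K}
    {J' : ModelWithCorners ℝ G L} {Φ : OpenPartialHomeomorph A B} {Φ' : OpenPartialHomeomorph B C}
    (hΦ : IsSmoothHomeo I J Φ) (hΦ' : IsSmoothHomeo J J' Φ') : IsSmoothHomeo I J' (Φ.trans Φ') where
  contMDiffOn x hx := ((hΦ'.contMDiffAt hx.2).comp x (hΦ.contMDiffAt hx.1)).contMDiffWithinAt
  contMDiffOn_symm x hx :=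
    ((hΦ.symm.contMDiffAt hx.2).comp x (hΦ'.symm.contMDiffAt hx.1)).contMDiffWithinAt

theorem PureManifold.exists_disjointUnion_opens {k : ℕ} {I : Type u} [Countable I]
    (O : I → Opens (EuclideanSpace ℝ (Fin k)))
    (hO : ∀ i, (O i : Set (EuclideanSpace ℝ (Fin k))).Nonempty) :
    ∃ (X : PureManifold.{u} k) (idx : X.carrier → I)
      (κ : I → OpenPartialHomeomorph X.carrier (EuclideanSpace ℝ (Fin k))),
      ∀ i, IsSmoothHomeo (𝓡 k) (𝓡 k) (κ i) ∧ (κ i).source = idx ⁻¹' {i} ∧ (κ i).target = O i := by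
  choose Y κ hκ hκs hκt using fun i => PureManifold.exists_of_opens.{u} (O i) (hO i)
  have hne : ∀ i, Nonempty (Y i).carrier := fun i => ⟨(κ i).symm (hO i).some⟩
  obtain ⟨X, idx, φ, hφ⟩ := PureManifold.exists_disjointUnion Y hne
  refine ⟨X, idx, fun i => (φ i).trans (κ i), fun i => ⟨(hφ i).1.trans (hκ i), ?_, ?_⟩⟩
  · rw [OpenPartialHomeomorph.trans_source, hκs, Set.preimage_univ, Set.inter_univ, (hφ i).2.1]
  · rw [OpenPartialHomeomorph.trans_target, (hφ i).2.2, Set.preimage_univ, Set.inter_univ, hκt]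

/-- Submersions are open. -/
theorem image_mem_nhds_of_surjective_mfderiv {e d : ℕ} {W : Type*} [TopologicalSpace W]
    [ChartedSpace (EuclideanSpace ℝ (Fin d)) W] [IsManifold (𝓡 d) ∞ W]
    {f : EuclideanSpace ℝ (Fin e) → W} {z : EuclideanSpace ℝ (Fin e)}
    (hf : ContMDiffAt (𝓡 e) (𝓡 d) ∞ f z) (hs : Function.Surjective (mfderiv (𝓡 e) (𝓡 d) f z))
    {U : Set (EuclideanSpace ℝ (Fin e))} (hU : U ∈ 𝓝 z) : f '' U ∈ 𝓝 (f z) := by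
  let φ := chartAt (EuclideanSpace ℝ (Fin d)) (f z)
  have hφ := isSmoothHomeo_chartAt (d := d) (f z)
  have hz : f z ∈ φ.source := mem_chart_source _ _
  have h1 : ContMDiffAt (𝓡 e) (𝓡 d) ∞ (φ ∘ f) z := (hφ.contMDiffAt hz).comp z hf
  have h2 : ContDiffAt ℝ ∞ (φ ∘ f) z := h1.contDiffAt
  have h3 := h2.hasStrictFDerivAt (by simp)
  have h4 : fderiv ℝ (φ ∘ f) z = mfderiv (𝓡 e) (𝓡 d) (φ ∘ f) z := mfderiv_eq_fderiv.symm
  have h5 := mfderiv_comp z (hφ.mdifferentiableAt hz) (hf.mdifferentiableAt (by simp))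
  have h6 : Function.Surjective (fderiv ℝ (φ ∘ f) z) := by
    rw [h4, h5]
    exact (hφ.mfderiv_surjective hz).comp hs
  have h7 := h3.map_nhds_eq_of_surj (LinearMap.range_eq_top.2 h6)
  have h8 : Filter.map f (𝓝 z) = 𝓝 (f z) := by
    have h9 : f =ᶠ[𝓝 z] φ.symm ∘ (φ ∘ f) := by
      filter_upwards [hf.continuousAt.eventually (φ.open_source.mem_nhds hz)] with y hy
      exact (φ.left_inv hy).symm
    rw [Filter.map_congr h9, ← Filter.map_map, h7]
    have h10 := φ.symm.map_nhds_eq (φ.map_source hz)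
    rw [φ.left_inv hz] at h10
    exact h10
  rw [← h8]
  exact Filter.image_mem_map hU

/-! ### Equivalence from local correspondences -/

section Correspondence

variable {M N : Type*}

/-- Submersions from an open subset of `ℝᵉ` to `W` and to `W'` that are compatible with the maps to
`M` and `N`. -/
structure Correspondence (W : MixedManifold.{u}) (p : W.Pt → M) (q : W.Pt → N)
    (W' : MixedManifold.{u}) (p' : W'.Pt → M) (q' : W'.Pt → N) (e : ℕ) : Type u where
  dom : Opens (EuclideanSpace ℝ (Fin e))
  d : ℕ
  d' : ℕ
  fst : EuclideanSpace ℝ (Fin e) → W.part d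
  snd : EuclideanSpace ℝ (Fin e) → W'.part d'
  smooth_fst : ∀ z ∈ dom, ContMDiffAt (𝓡 e) (𝓡 d) ∞ fst z
  smooth_snd : ∀ z ∈ dom, ContMDiffAt (𝓡 e) (𝓡 d') ∞ snd z
  surjective_fst : ∀ z ∈ dom, Function.Surjective (mfderiv (𝓡 e) (𝓡 d) fst z)
  surjective_snd : ∀ z ∈ dom, Function.Surjective (mfderiv (𝓡 e) (𝓡 d') snd z)
  left : ∀ z ∈ dom, p ⟨d, fst z⟩ = p' ⟨d', snd z⟩
  right : ∀ z ∈ dom, q ⟨d, fst z⟩ = q' ⟨d', snd z⟩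

/-- Submersions are open, so the images of the domains are neighbourhoods and second countability
extracts a countable subfamily. Countability keeps the union of the domains second countable. The
statement leaves the maps free so as to serve for both legs of a correspondence. -/
theorem MixedManifold.exists_countable_cover {W : MixedManifold.{u}} {C : ℕ → Type u}
    (dom : ∀ e, C e → Opens (EuclideanSpace ℝ (Fin e))) (d : ∀ e, C e → ℕ)
    (f : ∀ e (c : C e), EuclideanSpace ℝ (Fin e) → W.part (d e c))
    (hf : ∀ e c, ∀ z ∈ dom e c, ContMDiffAt (𝓡 e) (𝓡 (d e c)) ∞ (f e c) z)
    (hs : ∀ e c, ∀ z ∈ dom e c, Function.Surjective (mfderiv (𝓡 e) (𝓡 (d e c)) (f e c) z))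
    (hcov : ∀ w : W.Pt, ∃ e c, ∃ z ∈ dom e c, (⟨d e c, f e c z⟩ : W.Pt) = w) :
    ∃ J : Set (Σ e, C e), J.Countable ∧ (∀ j ∈ J, ∃ z, z ∈ dom j.1 j.2) ∧
      ∀ w : W.Pt, ∃ j ∈ J, ∃ z ∈ dom j.1 j.2, (⟨d j.1 j.2, f j.1 j.2 z⟩ : W.Pt) = w := by
  choose e c z hz hzw using hcov
  have hnhds : ∀ w : W.Pt, (fun z => (⟨d (e w) (c w), f (e w) (c w) z⟩ : W.Pt)) ''
      (dom (e w) (c w)) ∈ 𝓝 w := by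
    intro w
    have h1 := image_mem_nhds_of_surjective_mfderiv (hf _ _ _ (hz w)) (hs _ _ _ (hz w))
      ((dom (e w) (c w)).isOpen.mem_nhds (hz w))
    have h2 := (Topology.IsOpenEmbedding.sigmaMk (σ := W.part)).isOpenMap.image_mem_nhds h1
    rw [Set.image_image, hzw] at h2
    exact h2
  obtain ⟨s, hs, hsU⟩ := TopologicalSpace.countable_cover_nhds hnhds
  refine ⟨(fun w => ⟨e w, c w⟩) '' s, hs.image _, ?_, ?_⟩
  · rintro _ ⟨w, -, rfl⟩
    exact ⟨z w, hz w⟩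
  · intro w
    obtain ⟨w', hw', y, hy, hyw⟩ := Set.mem_iUnion₂.1 (hsU.ge (Set.mem_univ w))
    exact ⟨_, Set.mem_image_of_mem _ hw', y, hy, hyw⟩

variable {W : MixedManifold.{u}} {p : W.Pt → M} {q : W.Pt → N}
    {W' : MixedManifold.{u}} {p' : W'.Pt → M} {q' : W'.Pt → N}

/-- Bi-submersions are equivalent if locally they are linked by correspondences. -/
theorem areEquivalent_of_correspondences
    (hfst : ∀ w : W.Pt, ∃ (e : ℕ) (c : Correspondence W p q W' p' q' e), ∃ z ∈ c.dom,
      (⟨c.d, c.fst z⟩ : W.Pt) = w)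
    (hsnd : ∀ w : W'.Pt, ∃ (e : ℕ) (c : Correspondence W p q W' p' q' e), ∃ z ∈ c.dom,
      (⟨c.d', c.snd z⟩ : W'.Pt) = w) :
    AreEquivalent W p q W' p' q' := by
  obtain ⟨J₁, hJ₁, hne₁, hcov₁⟩ := MixedManifold.exists_countable_cover
    (C := Correspondence W p q W' p' q') (fun e c => c.dom) (fun e c => c.d) (fun e c => c.fst)
    (fun e c => c.smooth_fst) (fun e c => c.surjective_fst) hfst
  obtain ⟨J₂, hJ₂, hne₂, hcov₂⟩ := MixedManifold.exists_countable_cover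
    (C := Correspondence W p q W' p' q') (fun e c => c.dom) (fun e c => c.d') (fun e c => c.snd)
    (fun e c => c.smooth_snd) (fun e c => c.surjective_snd) hsnd
  let J := J₁ ∪ J₂
  have hJ : Countable J := (hJ₁.union hJ₂).to_subtype
  -- The manifold V is the disjoint union of the selected domains, sorted by dimension; domains of
  -- different dimensions go to different parts of V.
  let I : ℕ → Type u := fun e => {c : Correspondence W p q W' p' q' e // ⟨e, c⟩ ∈ J}
  have hI : ∀ e, Countable (I e) := fun e =>
    Function.Injective.countable (f := fun c : I e => (⟨⟨e, c.1⟩, c.2⟩ : J)) fun c c' h => by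
      have h1 := congrArg Subtype.val h
      exact Subtype.ext (eq_of_heq (Sigma.mk.inj h1).2)
  choose X idx κ hκ hκs hκt using fun e => PureManifold.exists_disjointUnion_opens.{u}
    (I := I e) (fun c => c.1.dom) fun c => c.2.elim (hne₁ _) (hne₂ _)
  let V : MixedManifold.{u} := ⟨fun e => (X e).carrier⟩
  have hmem : ∀ e (v : (X e).carrier), v ∈ (κ e (idx e v)).source := fun e v => by
    rw [hκs]; rfl
  have hdom : ∀ e (v : (X e).carrier), κ e (idx e v) v ∈ (idx e v).1.dom := fun e v => by
    have h1 := (κ e (idx e v)).map_source (hmem e v)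
    rwa [hκt] at h1
  have hidx : ∀ e (v : (X e).carrier), ∀ᶠ y in 𝓝 v, idx e y = idx e v := fun e v => by
    filter_upwards [(κ e (idx e v)).open_source.mem_nhds (hmem e v)] with y hy
    rwa [hκs] at hy
  have hpre : ∀ e (c : I e) z, z ∈ c.1.dom → ∃ v, idx e v = c ∧ κ e c v = z := by
    intro e c z hz
    have hz' : z ∈ (κ e c).target := by rwa [hκt]
    refine ⟨(κ e c).symm z, ?_, (κ e c).right_inv hz'⟩
    have := (κ e c).map_target hz'
    rwa [hκs] at this
  let δ : V.Pt → W.Pt := fun v => ⟨(idx v.1 v.2).1.d, (idx v.1 v.2).1.fst (κ v.1 (idx v.1 v.2) v.2)⟩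
  let η : V.Pt → W'.Pt := fun v =>
    ⟨(idx v.1 v.2).1.d', (idx v.1 v.2).1.snd (κ v.1 (idx v.1 v.2) v.2)⟩
  refine ⟨V, δ, η, ?_, ?_, ?_, ?_, ?_, ?_⟩
  · intro e v
    have h1 := (hκ e (idx e v)).contMDiffAt (hmem e v)
    have h2 := (idx e v).1.smooth_fst _ (hdom e v)
    refine ⟨_, fun y => (idx e v).1.fst (κ e (idx e v) y), ⟨h2.comp v h1, ?_⟩, ?_⟩
    · filter_upwards [hidx e v] with y hy
      exact congrArg (fun i : I e => (⟨i.1.d, i.1.fst (κ e i y)⟩ : W.Pt)) hy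
    · have h3 := mfderiv_comp v (h2.mdifferentiableAt (by simp)) (h1.mdifferentiableAt (by simp))
      refine Eq.subst (motive := fun L => Function.Surjective L)
        (congrArg DFunLike.coe h3.symm) ?_
      exact ((idx e v).1.surjective_fst _ (hdom e v)).comp ((hκ e (idx e v)).mfderiv_surjective (hmem e v))
  · intro w
    obtain ⟨⟨e, c⟩, hc, z, hz, hzw⟩ := hcov₁ w
    obtain ⟨v, hv, hvz⟩ := hpre e ⟨c, Or.inl hc⟩ z hz
    refine ⟨⟨e, v⟩, (congrArg (fun i : I e => (⟨i.1.d, i.1.fst (κ e i v)⟩ : W.Pt)) hv).trans ?_⟩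
    rw [hvz]
    exact hzw
  · intro e v
    have h1 := (hκ e (idx e v)).contMDiffAt (hmem e v)
    have h2 := (idx e v).1.smooth_snd _ (hdom e v)
    refine ⟨_, fun y => (idx e v).1.snd (κ e (idx e v) y), ⟨h2.comp v h1, ?_⟩, ?_⟩
    · filter_upwards [hidx e v] with y hy
      exact congrArg (fun i : I e => (⟨i.1.d', i.1.snd (κ e i y)⟩ : W'.Pt)) hy
    · have h3 := mfderiv_comp v (h2.mdifferentiableAt (by simp)) (h1.mdifferentiableAt (by simp))
      refine Eq.subst (motive := fun L => Function.Surjective L)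
        (congrArg DFunLike.coe h3.symm) ?_
      exact ((idx e v).1.surjective_snd _ (hdom e v)).comp ((hκ e (idx e v)).mfderiv_surjective (hmem e v))
  · intro w
    obtain ⟨⟨e, c⟩, hc, z, hz, hzw⟩ := hcov₂ w
    obtain ⟨v, hv, hvz⟩ := hpre e ⟨c, Or.inr hc⟩ z hz
    refine ⟨⟨e, v⟩, (congrArg (fun i : I e => (⟨i.1.d', i.1.snd (κ e i v)⟩ : W'.Pt)) hv).trans ?_⟩
    rw [hvz]
    exact hzw
  · funext v
    exact (idx v.1 v.2).1.left _ (hdom v.1 v.2)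
  · funext v
    exact (idx v.1 v.2).1.right _ (hdom v.1 v.2)

end Correspondence

/-- A continuous map with continuous local left inverses is an embedding. -/
theorem isEmbedding_of_local_leftInverse {X Z : Type*} [TopologicalSpace X] [TopologicalSpace Z]
    {f : X → Z} (hf : Continuous f)
    (h : ∀ x, ∃ r : Z → X, ContinuousAt r (f x) ∧ ∀ᶠ z in 𝓝 (f x), ∀ y, f y = z → r z = y) :
    Topology.IsEmbedding f := by
  refine ⟨Topology.isInducing_iff_nhds.2 fun x => le_antisymm hf.continuousAt.le_comap ?_, ?_⟩
  · obtain ⟨r, hr, hr'⟩ := h x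
    intro U hU
    have hrx : r (f x) = x := hr'.self_of_nhds x rfl
    rw [ContinuousAt, hrx] at hr
    refine Filter.mem_comap.2 ⟨_, hr'.and (hr.eventually hU), fun y hy => ?_⟩
    rw [← hy.1 y rfl]
    exact hy.2
  · intro x y hxy
    obtain ⟨r, -, hr⟩ := h x
    rw [← hr.self_of_nhds x rfl, ← hr.self_of_nhds y hxy.symm]

section Empty

variable {k m n : ℕ} {X : Type*} [TopologicalSpace X] [ChartedSpace (EuclideanSpace ℝ (Fin k)) X]
  [IsManifold (𝓡 k) ∞ X] [IsEmpty X]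
  {M : Type*} [TopologicalSpace M]
  [ChartedSpace (EuclideanSpace ℝ (Fin m)) M] [IsManifold (𝓡 m) ∞ M]
  {N : Type*} [TopologicalSpace N] [ChartedSpace (EuclideanSpace ℝ (Fin n)) N]
  [IsManifold (𝓡 n) ∞ N]

theorem IsPureBiSubmersion.of_isEmpty (FM : SingularFoliation m M) (FN : SingularFoliation n N)
    (p : X → M) (q : X → N) : IsPureBiSubmersion (d := k) FM FN p q where
  smooth_left x := isEmptyElim x
  smooth_right x := isEmptyElim x
  submersion_left x := isEmptyElim x
  submersion_right x := isEmptyElim x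
  pullback_eq O := by
    ext Z
    exact ⟨fun _ => ⟨fun x => isEmptyElim x, fun x => isEmptyElim x⟩,
      fun _ => ⟨fun x => isEmptyElim x, fun x => isEmptyElim x⟩⟩
  pullback_eq_kerSum O := by
    ext Z
    exact ⟨fun _ => ⟨Z, Z, fun x => isEmptyElim x, fun x => isEmptyElim x, fun x => isEmptyElim x,
      fun x => isEmptyElim x, fun x => isEmptyElim x⟩,
      fun _ => ⟨fun x => isEmptyElim x, fun x => isEmptyElim x⟩⟩

end Empty

/-! ### From separated retracts to an embedded equivalent bi-submersion -/

section Reduction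

set_option linter.unusedSectionVars false

variable {m n : ℕ} {M : Type*} [TopologicalSpace M]
  [ChartedSpace (EuclideanSpace ℝ (Fin m)) M] [IsManifold (𝓡 m) ∞ M]
  {N : Type*} [TopologicalSpace N] [ChartedSpace (EuclideanSpace ℝ (Fin n)) N]
  [IsManifold (𝓡 n) ∞ N]

/-- A manifold `X` of dimension `k`, divided into open and closed subsets each of which is included
in a part of `W` as a submersive retract, such that the images are separated from each other and each
point of `W` is linked to one of them by a correspondence. -/
structure Reduction {M N : Type*} (W : MixedManifold.{u}) (p : W.Pt → M) (q : W.Pt → N) (k : ℕ)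
    (X : Type u) [TopologicalSpace X] [ChartedSpace (EuclideanSpace ℝ (Fin k)) X]
    [IsManifold (𝓡 k) ∞ X] where
  I : Type u
  idx : X → I
  S : I → Opens X
  mem_S : ∀ i x, x ∈ S i ↔ idx x = i
  dim : I → ℕ
  incl : ∀ i, X → W.part (dim i)
  retr : ∀ i, W.part (dim i) → X
  R : ∀ i, Opens (W.part (dim i))
  isRetract : ∀ i, IsSubmersiveRetract (k := k) (d := dim i)
    (fun x => p ⟨dim (idx x), incl (idx x) x⟩) (fun x => q ⟨dim (idx x), incl (idx x) x⟩)
    (fun w => p ⟨dim i, w⟩) (fun w => q ⟨dim i, w⟩) (S i) (R i) (incl i) (retr i)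
  separated : ∀ x, ∀ᶠ w in 𝓝 (⟨dim (idx x), incl (idx x) x⟩ : W.Pt), ∀ y,
    (⟨dim (idx y), incl (idx y) y⟩ : W.Pt) = w → idx y = idx x
  exists_link : ∀ (D : ℕ) (w : W.part D), ∃ (i : I) (e : ℕ) (dom : Opens (EuclideanSpace ℝ (Fin e)))
    (f : EuclideanSpace ℝ (Fin e) → W.part D) (g : EuclideanSpace ℝ (Fin e) → W.part (dim i)),
    (∀ z ∈ dom, ContMDiffAt (𝓡 e) (𝓡 D) ∞ f z ∧ Function.Surjective (mfderiv (𝓡 e) (𝓡 D) f z) ∧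
      ContMDiffAt (𝓡 e) (𝓡 (dim i)) ∞ g z ∧ Function.Surjective (mfderiv (𝓡 e) (𝓡 (dim i)) g z) ∧
      g z ∈ R i ∧ p ⟨D, f z⟩ = p ⟨dim i, g z⟩ ∧ q ⟨D, f z⟩ = q ⟨dim i, g z⟩) ∧
    ∃ z ∈ dom, f z = w

namespace Reduction

variable {W : MixedManifold.{u}} {p : W.Pt → M} {q : W.Pt → N} {k : ℕ}
  {X : Type u} [TopologicalSpace X] [ChartedSpace (EuclideanSpace ℝ (Fin k)) X]
  [IsManifold (𝓡 k) ∞ X] (h : Reduction W p q k X)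

/-- The inclusion of `X` into `W`. -/
def toPt (x : X) : W.Pt := ⟨h.dim (h.idx x), h.incl (h.idx x) x⟩

theorem mem_S_idx (x : X) : x ∈ h.S (h.idx x) := (h.mem_S _ x).2 rfl

theorem toPt_eventuallyEq (x : X) :
    h.toPt =ᶠ[𝓝 x] fun y => (⟨h.dim (h.idx x), h.incl (h.idx x) y⟩ : W.Pt) := by
  filter_upwards [(h.S (h.idx x)).isOpen.mem_nhds (h.mem_S_idx x)] with y hy
  exact congrArg (fun i => (⟨h.dim i, h.incl i y⟩ : W.Pt)) ((h.mem_S _ y).1 hy)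

/-- The retraction of the piece containing x is a local left inverse. The field `separated` ensures
that near the image of x no other piece occurs, which is needed both for injectivity and for the
topology. -/
theorem isEmbedding_toPt : Topology.IsEmbedding h.toPt := by
  refine isEmbedding_of_local_leftInverse ?_ fun x => ?_
  · refine continuous_iff_continuousAt.2 fun x => ?_
    refine ContinuousAt.congr ?_ (h.toPt_eventuallyEq x).symm
    exact continuous_sigmaMk.continuousAt.comp
      ((h.isRetract _).incl_smooth x (h.mem_S_idx x)).continuousAt
  · let i := h.idx x
    have hr := (h.isRetract i).retr_smooth _ ((h.isRetract i).incl_mem x (h.mem_S_idx x))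
    have hne : Nonempty (W.part (h.dim i)) := ⟨h.incl i x⟩
    let φ := ((Topology.IsOpenEmbedding.sigmaMk (σ := W.part) (i := h.dim i)).toOpenPartialHomeomorph
      _).symm
    have hφ : ∀ w, φ ⟨h.dim i, w⟩ = w := fun w =>
      Topology.IsOpenEmbedding.toOpenPartialHomeomorph_left_inv _ Topology.IsOpenEmbedding.sigmaMk
    have hφx : (⟨h.dim i, h.incl i x⟩ : W.Pt) ∈ φ.source := by
      rw [OpenPartialHomeomorph.symm_source, Topology.IsOpenEmbedding.toOpenPartialHomeomorph_target]
      exact ⟨_, rfl⟩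
    refine ⟨fun w => h.retr i (φ w), ?_, ?_⟩
    · refine ContinuousAt.comp (g := h.retr i) (f := φ) ?_ (φ.continuousAt hφx)
      change ContinuousAt (h.retr i) (φ ⟨h.dim i, h.incl i x⟩)
      rw [hφ]
      exact hr.continuousAt
    · filter_upwards [h.separated x] with w hw y hy
      have hyi : h.idx y = i := hw y hy
      have h1 : h.toPt y = ⟨h.dim i, h.incl i y⟩ :=
        congrArg (fun i => (⟨h.dim i, h.incl i y⟩ : W.Pt)) hyi
      rw [← hy, h1, hφ]
      exact (h.isRetract i).retr_incl y ((h.mem_S i y).2 hyi)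

theorem isPureBiSubmersion {FM : SingularFoliation m M} {FN : SingularFoliation n N}
    (hW : IsBiSubmersion FM FN W p q) :
    IsPureBiSubmersion (d := k) FM FN (fun x => p (h.toPt x)) (fun x => q (h.toPt x)) :=
  IsPureBiSubmersion.of_retracts hW h.mem_S fun x => ⟨_, _, _, _, h.isRetract (h.idx x)⟩

/-- Points of the open set that retracts to a component of `X` are linked to themselves. -/
theorem exists_self_link {i : h.I} {w : W.part (h.dim i)} (hw : w ∈ h.R i) :
    ∃ (dom : Opens (EuclideanSpace ℝ (Fin (h.dim i))))
      (f : EuclideanSpace ℝ (Fin (h.dim i)) → W.part (h.dim i)),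
      (∀ z ∈ dom, ContMDiffAt (𝓡 (h.dim i)) (𝓡 (h.dim i)) ∞ f z ∧
        Function.Surjective (mfderiv (𝓡 (h.dim i)) (𝓡 (h.dim i)) f z) ∧ f z ∈ h.R i) ∧
      ∃ z ∈ dom, f z = w := by
  let φ := chartAt (EuclideanSpace ℝ (Fin (h.dim i))) w
  have hφ := isSmoothHomeo_chartAt (d := h.dim i) w
  have hw' := mem_chart_source (EuclideanSpace ℝ (Fin (h.dim i))) w
  refine ⟨⟨φ.target ∩ φ.symm ⁻¹' h.R i, φ.symm.isOpen_inter_preimage (h.R i).isOpen⟩, φ.symm,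
    fun z hz => ⟨hφ.symm.contMDiffAt hz.1, hφ.symm.mfderiv_surjective hz.1, hz.2⟩, φ w,
    ⟨φ.map_source hw', ?_⟩, φ.left_inv hw'⟩
  simp only [Set.mem_preimage]
  rw [φ.left_inv hw']
  exact hw

end Reduction

/-- Composing the second leg of a link with the retraction onto a piece turns a link within W into a
correspondence from W' to W. The links from the points of W reach all of W, and the self-links of
points of the pieces reach all of W'. -/
theorem Reduction.reducesToDim {FM : SingularFoliation m M} {FN : SingularFoliation n N}
    {W : MixedManifold.{u}} {p : W.Pt → M} {q : W.Pt → N} {k : ℕ}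
    (hW : IsBiSubmersion FM FN W p q) {W' : MixedManifold.{u}} (hW' : W'.IsPureOfDim k)
    (h : Reduction W p q k (W'.part k)) : ReducesToDim FM FN W p q k := by
  have hdim : ∀ z : W'.Pt, z.1 = k := fun z => by
    by_contra hne
    exact (hW' _ hne).false z.2
  let toPart : W'.Pt → W'.part k := fun z => hdim z ▸ z.2
  have htoPart : ∀ x : W'.part k, toPart ⟨k, x⟩ = x := fun x => rfl
  -- All parts of W' except the one of dimension k are empty, so W' is homeomorphic to that part.
  have hmk : ∀ z : W'.Pt, (⟨k, toPart z⟩ : W'.Pt) = z := by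
    rintro ⟨e, x⟩
    obtain rfl : e = k := hdim ⟨e, x⟩
    rfl
  have hcont : Continuous toPart := by
    refine continuous_sigma fun e => ?_
    by_cases he : e = k
    · subst he
      exact continuous_id
    · have := hW' e he
      exact continuous_of_const fun x => isEmptyElim x
  let T : W'.Pt ≃ₜ W'.part k := ⟨⟨toPart, Sigma.mk k, hmk, htoPart⟩, hcont, continuous_sigmaMk⟩
  let ι : W'.Pt → W.Pt := fun z => h.toPt (toPart z)
  have link : ∀ (D : ℕ) (i : h.I) (e : ℕ) (dom : Opens (EuclideanSpace ℝ (Fin e)))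
      (f : EuclideanSpace ℝ (Fin e) → W.part D) (g : EuclideanSpace ℝ (Fin e) → W.part (h.dim i)),
      (∀ z ∈ dom, ContMDiffAt (𝓡 e) (𝓡 D) ∞ f z ∧ Function.Surjective (mfderiv (𝓡 e) (𝓡 D) f z) ∧
        ContMDiffAt (𝓡 e) (𝓡 (h.dim i)) ∞ g z ∧
        Function.Surjective (mfderiv (𝓡 e) (𝓡 (h.dim i)) g z) ∧
        g z ∈ h.R i ∧ p ⟨D, f z⟩ = p ⟨h.dim i, g z⟩ ∧ q ⟨D, f z⟩ = q ⟨h.dim i, g z⟩) →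
      ∃ c : Correspondence W' (p ∘ ι) (q ∘ ι) W p q e, c.dom = dom ∧
        (∀ z, (⟨c.d, c.fst z⟩ : W'.Pt) = ⟨k, h.retr i (g z)⟩) ∧
        ∀ z, (⟨c.d', c.snd z⟩ : W.Pt) = ⟨D, f z⟩ := by
    intro D i e dom f g hfg
    refine ⟨{ dom := dom, d := k, d' := D, fst := fun z => h.retr i (g z), snd := f
              smooth_fst := fun z hz => ?_
              smooth_snd := fun z hz => (hfg z hz).1
              surjective_fst := fun z hz => ?_
              surjective_snd := fun z hz => (hfg z hz).2.1
              left := fun z hz => ?_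
              right := fun z hz => ?_ }, rfl, fun _ => rfl, fun _ => rfl⟩
    · exact ((h.isRetract i).retr_smooth _ (hfg z hz).2.2.2.2.1).comp z (hfg z hz).2.2.1
    · have h1 := mfderiv_comp z
        (((h.isRetract i).retr_smooth _ (hfg z hz).2.2.2.2.1).mdifferentiableAt (by simp))
        ((hfg z hz).2.2.1.mdifferentiableAt (by simp))
      refine Eq.subst (motive := fun L => Function.Surjective L)
        (congrArg DFunLike.coe h1.symm) ?_
      exact ((h.isRetract i).surjective _ (hfg z hz).2.2.2.2.1).comp (hfg z hz).2.2.2.1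
    · exact ((h.isRetract i).left _ (hfg z hz).2.2.2.2.1).trans (hfg z hz).2.2.2.2.2.1.symm
    · exact ((h.isRetract i).right _ (hfg z hz).2.2.2.2.1).trans (hfg z hz).2.2.2.2.2.2.symm
  refine ⟨W', ι, ⟨h.isEmbedding_toPt.comp T.isEmbedding, ?_⟩, hW', ?_, ?_⟩
  · intro e x
    obtain rfl : e = k := hdim ⟨e, x⟩
    exact ⟨_, h.incl (h.idx x), ⟨(h.isRetract _).incl_smooth x (h.mem_S_idx x),
      h.toPt_eventuallyEq x⟩, (h.isRetract _).injective_mfderiv_incl (h.mem_S_idx x)⟩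
  · intro e
    by_cases he : e = k
    · subst he
      exact h.isPureBiSubmersion hW
    · have := hW' e he
      exact IsPureBiSubmersion.of_isEmpty FM FN _ _
  · refine areEquivalent_of_correspondences ?_ ?_
    · rintro ⟨e, x⟩
      obtain rfl : e = k := hdim ⟨e, x⟩
      let i := h.idx x
      obtain ⟨dom, f, hf, z, hz, hzw⟩ := h.exists_self_link
        ((h.isRetract i).incl_mem x (h.mem_S_idx x))
      obtain ⟨c, hc, hfst, -⟩ := link _ i _ dom f f fun z hz => ⟨(hf z hz).1, (hf z hz).2.1,
        (hf z hz).1, (hf z hz).2.1, (hf z hz).2.2, rfl, rfl⟩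
      refine ⟨_, c, z, by rwa [hc], (hfst z).trans ?_⟩
      rw [hzw, (h.isRetract i).retr_incl x (h.mem_S_idx x)]
    · rintro ⟨D, w⟩
      obtain ⟨i, e, dom, f, g, hfg, z, hz, hzw⟩ := h.exists_link D w
      obtain ⟨c, hc, -, hsnd⟩ := link D i e dom f g hfg
      refine ⟨e, c, z, by rwa [hc], (hsnd z).trans ?_⟩
      rw [hzw]

end Reduction

section LinearComp

variable {e d : ℕ} {E : Type*} [NormedAddCommGroup E] [NormedSpace ℝ E] {W : Type*}
  [TopologicalSpace W] [ChartedSpace (EuclideanSpace ℝ (Fin d)) W]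

theorem IsSmoothHomeo.submersion_comp_linear {Ψ : OpenPartialHomeomorph E W}
    (hΨ : IsSmoothHomeo 𝓘(ℝ, E) (𝓡 d) Ψ) (A : EuclideanSpace ℝ (Fin e) →L[ℝ] E)
    (hA : Function.Surjective A) {z : EuclideanSpace ℝ (Fin e)} (hz : A z ∈ Ψ.source) :
    ContMDiffAt (𝓡 e) (𝓡 d) ∞ (fun z => Ψ (A z)) z ∧
      Function.Surjective (mfderiv (𝓡 e) (𝓡 d) (fun z => Ψ (A z)) z) := by
  have h1 : ContMDiffAt (𝓡 e) 𝓘(ℝ, E) ∞ A z := A.contDiff.contMDiff.contMDiffAt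
  refine ⟨(hΨ.contMDiffAt hz).comp z h1, ?_⟩
  have h2 := mfderiv_comp z (hΨ.mdifferentiableAt hz) (h1.mdifferentiableAt (by simp))
  refine Eq.subst (motive := fun L => Function.Surjective L) (congrArg DFunLike.coe h2.symm) ?_
  refine (hΨ.mfderiv_surjective hz).comp ?_
  rw [mfderiv_eq_fderiv, ContinuousLinearMap.fderiv]
  exact hA

end LinearComp

/-! ### Links and discs in a part of dimension greater than k -/

section Build

variable {m n : ℕ} {M : Type*} [TopologicalSpace M]
  [ChartedSpace (EuclideanSpace ℝ (Fin m)) M] [IsManifold (𝓡 m) ∞ M]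
  {N : Type*} [TopologicalSpace N] [ChartedSpace (EuclideanSpace ℝ (Fin n)) N]
  [IsManifold (𝓡 n) ∞ N]
  {FM : SingularFoliation m M} {FN : SingularFoliation n N} {k : ℕ}

/-- Two points on a fibre of a sliced chart are linked by a correspondence. -/
theorem IsSliced.exists_link {d l : ℕ} {W : Type*} [TopologicalSpace W]
    [ChartedSpace (EuclideanSpace ℝ (Fin d)) W] {M N : Type*} {p : W → M} {q : W → N}
    {Ψ : OpenPartialHomeomorph (EuclideanSpace ℝ (Fin k) × EuclideanSpace ℝ (Fin l)) W}
    (hΨ : IsSliced (d := d) p q Ψ) (R : Opens W) {s : EuclideanSpace ℝ (Fin k)}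
    {b b' : EuclideanSpace ℝ (Fin l)} (hb : (s, b) ∈ Ψ.source) (hb' : (s, b') ∈ Ψ.source)
    (hR : Ψ (s, b') ∈ R) :
    ∃ (e : ℕ) (dom : Opens (EuclideanSpace ℝ (Fin e))) (f g : EuclideanSpace ℝ (Fin e) → W),
      (∀ z ∈ dom, ContMDiffAt (𝓡 e) (𝓡 d) ∞ f z ∧ Function.Surjective (mfderiv (𝓡 e) (𝓡 d) f z) ∧
        ContMDiffAt (𝓡 e) (𝓡 d) ∞ g z ∧ Function.Surjective (mfderiv (𝓡 e) (𝓡 d) g z) ∧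
        g z ∈ R ∧ p (f z) = p (g z) ∧ q (f z) = q (g z)) ∧
      ∃ z ∈ dom, f z = Ψ (s, b) := by
  let A := EuclideanSpace ℝ (Fin k)
  let B := EuclideanSpace ℝ (Fin l)
  -- The correspondence is the fibre product of the chart with itself over A: the points (s, b, b')
  -- are sent to (s, b) and to (s, b').
  let L : EuclideanSpace ℝ (Fin (k + (l + l))) ≃L[ℝ] A × (B × B) :=
    ContinuousLinearEquiv.ofFinrankEq (by simp [A, B])
  let A₁ : EuclideanSpace ℝ (Fin (k + (l + l))) →L[ℝ] A × B :=
    ((ContinuousLinearMap.fst ℝ A (B × B)).prod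
      ((ContinuousLinearMap.fst ℝ B B).comp (ContinuousLinearMap.snd ℝ A (B × B)))).comp
        (L : EuclideanSpace ℝ (Fin (k + (l + l))) →L[ℝ] A × (B × B))
  let A₂ : EuclideanSpace ℝ (Fin (k + (l + l))) →L[ℝ] A × B :=
    ((ContinuousLinearMap.fst ℝ A (B × B)).prod
      ((ContinuousLinearMap.snd ℝ B B).comp (ContinuousLinearMap.snd ℝ A (B × B)))).comp
        (L : EuclideanSpace ℝ (Fin (k + (l + l))) →L[ℝ] A × (B × B))
  have hA₁ : ∀ z, A₁ z = ((L z).1, (L z).2.1) := fun z => rfl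
  have hA₂ : ∀ z, A₂ z = ((L z).1, (L z).2.2) := fun z => rfl
  have hs₁ : Function.Surjective A₁ := fun v => ⟨L.symm (v.1, v.2, 0), by rw [hA₁]; simp⟩
  have hs₂ : Function.Surjective A₂ := fun v => ⟨L.symm (v.1, 0, v.2), by rw [hA₂]; simp⟩
  have hO₁ : IsOpen (A₁ ⁻¹' Ψ.source) := Ψ.open_source.preimage A₁.continuous
  have hO₂ : IsOpen (A₂ ⁻¹' (Ψ.source ∩ Ψ ⁻¹' R)) :=
    (Ψ.isOpen_inter_preimage R.isOpen).preimage A₂.continuous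
  refine ⟨_, ⟨A₁ ⁻¹' Ψ.source ∩ A₂ ⁻¹' (Ψ.source ∩ Ψ ⁻¹' R), hO₁.inter hO₂⟩, fun z => Ψ (A₁ z),
    fun z => Ψ (A₂ z), ?_, L.symm (s, b, b'), ?_, ?_⟩
  · rintro z ⟨h1, h2, h3⟩
    have h4 := hΨ.smooth.submersion_comp_linear A₁ hs₁ h1
    have h5 := hΨ.smooth.submersion_comp_linear A₂ hs₂ h2
    refine ⟨h4.1, h4.2, h5.1, h5.2, h3, ?_, ?_⟩
    · exact hΨ.left _ _ _ h1 h2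
    · exact hΨ.right _ _ _ h1 h2
  · have h1 : A₁ (L.symm (s, b, b')) = (s, b) := by rw [hA₁]; simp
    have h2 : A₂ (L.symm (s, b, b')) = (s, b') := by rw [hA₂]; simp
    refine ⟨?_, ?_, ?_⟩
    · rw [Set.mem_preimage, h1]; exact hb
    · rw [h2]; exact hb'
    · rw [Set.mem_preimage, h2]; exact hR
  · have h1 : A₁ (L.symm (s, b, b')) = (s, b) := by rw [hA₁]; simp
    simp only [h1]

/-- The selection of disjoint cells is applied to the class of all sliced charts. The inequality k <
d makes the second factor nontrivial, as that selection requires. -/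
theorem IsPureBiSubmersion.exists_cells {d : ℕ} {W : Type u} [TopologicalSpace W]
    [ChartedSpace (EuclideanSpace ℝ (Fin d)) W] [IsManifold (𝓡 d) ∞ W] [T2Space W]
    [SecondCountableTopology W] {p : W → M} {q : W → N}
    (h : IsPureBiSubmersion (d := d) FM FN p q) (hk : ∀ w, FM.rkAt (p w) + n ≤ k) (hd : k < d) :
    ∃ (J : Type u) (_ : Countable J)
      (Ψ : J → OpenPartialHomeomorph
        (EuclideanSpace ℝ (Fin k) × EuclideanSpace ℝ (Fin (d - k))) W)
      (c : J → EuclideanSpace ℝ (Fin k) × ℝ × EuclideanSpace ℝ (Fin (d - k))),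
      (∀ j, IsSliced (d := d) p q (Ψ j)) ∧ (∀ j, 0 < (c j).2.1) ∧
      (∀ j, Metric.closedBall (c j).1 (c j).2.1 ×ˢ {(c j).2.2} ⊆ (Ψ j).source) ∧
      Pairwise (fun i j => Disjoint (cell (Ψ i) (c i)) (cell (Ψ j) (c j))) ∧
      LocallyFinite (fun j => cell (Ψ j) (c j)) ∧
      ∀ w, ∃ Ψ' : OpenPartialHomeomorph
          (EuclideanSpace ℝ (Fin k) × EuclideanSpace ℝ (Fin (d - k))) W,
        IsSliced (d := d) p q Ψ' ∧ ∃ s b b', (s, b) ∈ Ψ'.source ∧ (s, b') ∈ Ψ'.source ∧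
          Ψ' (s, b) = w ∧ ∃ j, Ψ' (s, b') ∈ sliceOpens (Ψ j) (Metric.isOpen_ball (x := (c j).1)
            (ε := (c j).2.1)) := by
  have : LocallyCompactSpace W := Manifold.locallyCompact_of_finiteDimensional (𝓡 d)
  have : Nonempty (Fin (d - k)) := ⟨⟨0, by omega⟩⟩
  have : Nontrivial (EuclideanSpace ℝ (Fin (d - k))) := inferInstance
  obtain ⟨J, hJ, Ψ, c, h1, h2, h3, h4, h5, h6⟩ := exists_disjoint_cells
    {Ψ : OpenPartialHomeomorph
      (EuclideanSpace ℝ (Fin k) × EuclideanSpace ℝ (Fin (d - k))) W | IsSliced (d := d) p q Ψ}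
    (fun w => h.exists_isSliced w (hk w) (by omega))
    (fun Ψ hΨ Ψ' hΨ' => contMDiffOn_iff_contDiffOn.1 (hΨ.smooth.trans hΨ'.smooth.symm).contMDiffOn)
  refine ⟨J, hJ, Ψ, c, h1, h2, h3, h4, h5, fun w => ?_⟩
  obtain ⟨Ψ', hΨ', s, b, b', hb, hb', hw, j, x, hx, y, hxy, heq⟩ := h6 w
  refine ⟨Ψ', hΨ', s, b, b', hb, hb', hw, j, ?_⟩
  rw [heq]
  refine ⟨(Ψ j).map_source hxy, ?_⟩
  simp only [Set.mem_preimage, (Ψ j).left_inv hxy]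
  exact hx

end Build

/-! ### Construction of the submanifold -/

section ExistsReduction

variable {m n k : ℕ} {M : Type*} [TopologicalSpace M]
  [ChartedSpace (EuclideanSpace ℝ (Fin m)) M] [IsManifold (𝓡 m) ∞ M]
  {N : Type*} [TopologicalSpace N] [ChartedSpace (EuclideanSpace ℝ (Fin n)) N]
  [IsManifold (𝓡 n) ∞ N] {FM : SingularFoliation m M} {FN : SingularFoliation n N}

/-- A point of one member of a disjoint locally finite family of closed sets has a neighbourhood
that meets no other member. -/
theorem LocallyFinite.eventually_eq_of_mem {J W : Type*} [TopologicalSpace W] {C : J → Set W}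
    (hC : LocallyFinite C) (hcl : ∀ j, IsClosed (C j))
    (hdis : Pairwise fun i j => Disjoint (C i) (C j)) {j : J} {z : W} (hz : z ∈ C j) :
    ∀ᶠ w in 𝓝 z, ∀ j', w ∈ C j' → j' = j := by
  have h1 : IsClosed (⋃ i : {i // i ≠ j}, C i) :=
    (hC.comp_injective Subtype.val_injective).isClosed_iUnion fun i => hcl i
  have h2 : z ∉ ⋃ i : {i // i ≠ j}, C i := by
    simp only [Set.mem_iUnion, not_exists]
    exact fun i hi => Set.disjoint_left.1 (hdis i.2) hi hz
  filter_upwards [h1.isOpen_compl.mem_nhds h2] with w hw j' hj'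
  by_contra hne
  exact hw (Set.mem_iUnion.2 ⟨⟨j', hne⟩, hj'⟩)

/-- The part of W of dimension k is kept whole, and each part of larger dimension contributes the
open discs inside its cells. The closed cells, being disjoint and locally finite, separate the
pieces. -/
theorem IsBiSubmersion.exists_reduction {W : MixedManifold.{u}} {p : W.Pt → M} {q : W.Pt → N}
    (hW : IsBiSubmersion FM FN W p q) (hk : ∀ d (w : W.part d), FM.rkAt (p ⟨d, w⟩) + n ≤ k)
    (hd : W.DimAtLeast k) : ∃ X : PureManifold.{u} k, Nonempty (Reduction W p q k X.carrier) := by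
  choose J hJ Ψ c hΨ hc0 hcs hdis hlf hlink using
    fun D : {d // k < d} => (hW D.1).exists_cells (hk D.1) D.2
  have hcl : ∀ D j, IsClosed (cell (Ψ D j) (c D j)) := fun D j =>
    (isCompact_cell _ (hcs D j)).isClosed
  let Cl := Σ D : {d // k < d}, J D
  choose Yc κ hκ hκs hκt using fun j : Cl => PureManifold.exists_of_opens.{u}
    ⟨Metric.ball (c j.1 j.2).1 (c j.1 j.2).2.1, Metric.isOpen_ball⟩
    ⟨_, Metric.mem_ball_self (hc0 j.1 j.2)⟩
  -- The index `none` stands for the part of dimension k itself, and `some j` for the open disc of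
  -- the cell j.
  let Y : Option Cl → PureManifold.{u} k := fun o => match o with
    | none => ⟨W.part k⟩
    | some j => Yc j
  let dimOf : Option Cl → ℕ := fun o => match o with
    | none => k
    | some j => j.1.1
  let ROf : ∀ o, Opens (W.part (dimOf o)) := fun o => match o with
    | none => (⊤ : Opens (W.part k))
    | some j => (sliceOpens (Ψ j.1 j.2)
        (Metric.isOpen_ball (x := (c j.1 j.2).1) (ε := (c j.1 j.2).2.1)) : Opens (W.part j.1.1))
  -- Closed sets containing the pieces. Separation is proved for these larger sets, because local
  -- finiteness is useful only for closed families.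
  let KPt : Option Cl → Set W.Pt := fun o => match o with
    | none => Sigma.fst ⁻¹' {k}
    | some j => Sigma.mk j.1.1 '' cell (Ψ j.1 j.2) (c j.1 j.2)
  have hsep : ∀ o, ∀ z ∈ KPt o, ∀ᶠ w in 𝓝 z, ∀ o', w ∈ KPt o' → o' = o := by
    have hfst : ∀ z : W.Pt, ∀ᶠ w in 𝓝 z, w.1 = z.1 := fun z =>
      ((isOpen_discrete {z.1}).preimage (continuous_sigma fun _ => continuous_const : Continuous
        (Sigma.fst : W.Pt → ℕ))).mem_nhds rfl
    rintro (_ | ⟨D, j⟩) z hz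
    · have hz' : z.1 = k := hz
      filter_upwards [hfst z] with w hw o' ho'
      rcases o' with _ | ⟨D', j'⟩
      · rfl
      · obtain ⟨x, -, rfl⟩ := ho'
        exact absurd (hw.trans hz') D'.2.ne'
    · obtain ⟨x, hx, rfl⟩ := hz
      have h1 := (isOpenMap_sigmaMk (σ := W.part) (i := D.1)).image_mem_nhds
        ((hlf D).eventually_eq_of_mem (hcl D) (hdis D) hx)
      filter_upwards [h1] with w hw o' ho'
      obtain ⟨y, hy, rfl⟩ := hw
      rcases o' with _ | ⟨D', j'⟩
      · exact absurd ho' D.2.ne'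
      · obtain ⟨y', hy', heq⟩ := ho'
        obtain rfl : D' = D := Subtype.ext (congrArg Sigma.fst heq)
        obtain rfl : y' = y := by simpa using heq
        obtain rfl := hy j' hy'
        rfl
  -- Disjoint unions were formed from nonempty pieces only, and the part of dimension k may be
  -- empty.
  let I := {o : Option Cl // Nonempty (Y o).carrier}
  obtain ⟨X, idx, φ, hφ⟩ := PureManifold.exists_disjointUnion (fun i : I => Y i.1) fun i => i.2
  let S : I → Opens X.carrier := fun i => ⟨(φ i).source, (φ i).open_source⟩
  have hmem : ∀ i x, x ∈ S i ↔ idx x = i := fun i x => by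
    change x ∈ (φ i).source ↔ _
    rw [(hφ i).2.1]; rfl
  have hretr : ∀ i : I, ∃ (incl : X.carrier → W.part (dimOf i.1))
      (retr : W.part (dimOf i.1) → X.carrier),
      (∀ (p' : X.carrier → M) (q' : X.carrier → N),
        (∀ x, idx x = i → p' x = p ⟨dimOf i.1, incl x⟩) →
        (∀ x, idx x = i → q' x = q ⟨dimOf i.1, incl x⟩) →
        IsSubmersiveRetract (k := k) (d := dimOf i.1) p' q' (fun w => p ⟨dimOf i.1, w⟩)
          (fun w => q ⟨dimOf i.1, w⟩) (S i) (ROf i.1) incl retr) ∧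
      ∀ x, idx x = i → (⟨dimOf i.1, incl x⟩ : W.Pt) ∈ KPt i.1 := by
    rintro ⟨_ | j, hi⟩
    · let i : I := ⟨none, hi⟩
      let φ' : OpenPartialHomeomorph X.carrier (W.part k) := φ i
      have hφ' : IsSmoothHomeo (𝓡 k) (𝓡 k) φ' := (hφ i).1
      refine ⟨φ', φ'.symm, fun p' q' hp hq => ?_, fun x _ => rfl⟩
      have h1 := IsSubmersiveRetract.of_isSmoothHomeo (p' := p') (q' := q')
        (p := fun w => p ⟨k, w⟩) (q := fun w => q ⟨k, w⟩) hφ'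
        (fun x hx => hp x ((hmem i x).1 hx)) (fun x hx => hq x ((hmem i x).1 hx))
      have h2 : (⟨φ'.target, φ'.open_target⟩ : Opens (W.part k)) = ⊤ := Opens.ext (hφ i).2.2
      rw [h2] at h1
      exact h1
    · let i : I := ⟨some j, hi⟩
      let φ' : OpenPartialHomeomorph X.carrier (Yc j).carrier := φ i
      let κ' : OpenPartialHomeomorph X.carrier (EuclideanSpace ℝ (Fin k)) := φ'.trans (κ j)
      have hφ' : IsSmoothHomeo (𝓡 k) (𝓡 k) φ' := (hφ i).1
      have hκ' : IsSmoothHomeo (𝓡 k) (𝓡 k) κ' := hφ'.trans (hκ j)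
      have hs : κ'.source = φ'.source := by
        rw [OpenPartialHomeomorph.trans_source, hκs, Set.preimage_univ, Set.inter_univ]
      have ht : κ'.target = Metric.ball (c j.1 j.2).1 (c j.1 j.2).2.1 := by
        have h3 : φ'.target = Set.univ := (hφ i).2.2
        rw [OpenPartialHomeomorph.trans_target, h3, Set.preimage_univ, Set.inter_univ, hκt]
        rfl
      have hb : ∀ s ∈ κ'.target, (s, (c j.1 j.2).2.2) ∈ Metric.closedBall (c j.1 j.2).1
          (c j.1 j.2).2.1 ×ˢ {(c j.1 j.2).2.2} := fun s hs =>
        ⟨Metric.ball_subset_closedBall (ht ▸ hs), rfl⟩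
      refine ⟨fun x => Ψ j.1 j.2 (κ' x, (c j.1 j.2).2.2),
        fun w => κ'.symm ((Ψ j.1 j.2).symm w).1, fun p' q' hp hq => ?_, fun x hx => ?_⟩
      · have h1 := IsSubmersiveRetract.of_isSliced (p' := p') (q' := q') (hΨ j.1 j.2) hκ'
          (fun s hs => hcs _ _ (hb s hs)) (fun x hx => hp x ((hmem i x).1 (hs.le hx)))
          (fun x hx => hq x ((hmem i x).1 (hs.le hx)))
        have h2 : sliceOpens (Ψ j.1 j.2) κ'.open_target = ROf (some j) :=
          Opens.ext (by simp only [sliceOpens, ROf, ht])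
        have h3 : (⟨κ'.source, κ'.open_source⟩ : Opens X.carrier) = S i := Opens.ext hs
        rw [h2, h3] at h1
        exact h1
      · exact Set.mem_image_of_mem _ (Set.mem_image_of_mem _
          (hb _ (κ'.map_source (hs.ge ((hmem i x).2 hx)))))
  choose incl retr hret hK using hretr
  have hval : ∀ (i : I) (x : X.carrier), idx x = i →
      (⟨dimOf (idx x).1, incl (idx x) x⟩ : W.Pt) = ⟨dimOf i.1, incl i x⟩ := by
    rintro i x rfl
    rfl
  refine ⟨X, ⟨{
    I := I, idx := idx, S := S, mem_S := hmem, dim := fun i => dimOf i.1, incl := incl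
    retr := retr, R := fun i => ROf i.1
    isRetract := fun i => hret i _ _ (fun x hx => congrArg p (hval i x hx))
      fun x hx => congrArg q (hval i x hx)
    separated := fun x => ?_
    exists_link := fun D w => ?_ }⟩⟩
  · filter_upwards [hsep _ _ (hK _ x rfl)] with w hw y hy
    exact Subtype.ext (hw _ (hy ▸ hK _ y rfl))
  · rcases lt_trichotomy D k with hD | rfl | hD
    · exact ((hd D hD).false w).elim
    · let χ := chartAt (EuclideanSpace ℝ (Fin D)) w
      have hχ := isSmoothHomeo_chartAt (d := D) w
      refine ⟨⟨none, ⟨w⟩⟩, D, ⟨χ.target, χ.open_target⟩, χ.symm, χ.symm, fun z hz => ?_, χ w,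
        χ.map_source (mem_chart_source _ w), χ.left_inv (mem_chart_source _ w)⟩
      exact ⟨hχ.symm.contMDiffAt hz, hχ.symm.mfderiv_surjective hz, hχ.symm.contMDiffAt hz,
        hχ.symm.mfderiv_surjective hz, trivial, rfl, rfl⟩
    · obtain ⟨Ψ', hΨ', s, b, b', hb, hb', rfl, j, hj⟩ := hlink ⟨D, hD⟩ w
      let o : Cl := ⟨⟨D, hD⟩, j⟩
      have hne : Nonempty (Yc o).carrier := ⟨(κ o).symm (c ⟨D, hD⟩ j).1⟩
      obtain ⟨e, dom, f, g, h1, h2⟩ := hΨ'.exists_link (ROf (some o)) hb hb' hj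
      exact ⟨⟨some o, hne⟩, e, dom, f, g, h1, h2⟩

/-- If `rk_x F_M + dim N ≤ k` on the image of `p` and all components of `W` have dimension at least
`k`, then `W` reduces to dimension `k`. -/
theorem IsBiSubmersion.reducesToDim {W : MixedManifold.{u}} {p : W.Pt → M} {q : W.Pt → N}
    (hW : IsBiSubmersion FM FN W p q) (hk : ∀ d (w : W.part d), FM.rkAt (p ⟨d, w⟩) + n ≤ k)
    (hd : W.DimAtLeast k) : ReducesToDim FM FN W p q k := by
  obtain ⟨X, hX⟩ := hW.exists_reduction hk hd
  obtain ⟨W', hW', ⟨h⟩⟩ := X.exists_mixedManifold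
    (fun Y => Nonempty (Reduction W p q k Y.carrier)) hX
  exact Reduction.reducesToDim hW hW' h

end ExistsReduction

/-! ### Attained ranks and the theorem -/

theorem SingularFoliation.rkAt_le_rk {m : ℕ} {M : Type*} [TopologicalSpace M]
    [ChartedSpace (EuclideanSpace ℝ (Fin m)) M] [IsManifold (𝓡 m) ∞ M]
    (F : SingularFoliation m M) (x : M) : (F.rkAt x : ℕ∞) ≤ F.rk :=
  le_iSup (fun x => (F.rkAt x : ℕ∞)) x

/-- A finite global rank is attained. -/
theorem SingularFoliation.exists_rkAt_eq_rk {m : ℕ} {M : Type*} [TopologicalSpace M]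
    [ChartedSpace (EuclideanSpace ℝ (Fin m)) M] [IsManifold (𝓡 m) ∞ M] [Nonempty M]
    (F : SingularFoliation m M) (hF : F.rk ≠ ⊤) : ∃ x, (F.rkAt x : ℕ∞) = F.rk :=
  ENat.exists_eq_iSup_of_lt_top hF.lt_top

theorem mainTheorem6 {m n : ℕ}
    {M : Type*} [TopologicalSpace M] [ChartedSpace (EuclideanSpace ℝ (Fin m)) M]
    [IsManifold (𝓡 m) ∞ M] [T2Space M] [SecondCountableTopology M]
    {N : Type*} [TopologicalSpace N] [ChartedSpace (EuclideanSpace ℝ (Fin n)) N]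
    [IsManifold (𝓡 n) ∞ N] [T2Space N] [SecondCountableTopology N]
    (FM : SingularFoliation m M) (FN : SingularFoliation n N)
    (hFM : FM.rk ≠ ⊤) (hFN : FN.rk ≠ ⊤)
    (W : MixedManifold.{u}) (p : W.Pt → M) (q : W.Pt → N)
    (hW : IsBiSubmersion FM FN W p q) :
    -- `(rk F_M + rk F_N + dim M + dim N) / 2` is an integer if `p` and `q` are onto, and then it is
    -- at most the dimension of some component of `W`
    (Nonempty W.Pt → Function.Surjective p → Function.Surjective q →
      ∃ k : ℕ, 2 * (k : ℕ∞) = FM.rk + FN.rk + m + n ∧ ∃ d, k ≤ d ∧ Nonempty (W.part d)) ∧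
    -- reduction to that dimension
    (∀ k : ℕ, 2 * (k : ℕ∞) = FM.rk + FN.rk + m + n → W.DimAtLeast k →
      ReducesToDim FM FN W p q k) ∧
    -- reduction to dimension `rk E + dim N`
    (∀ (r : ℕ) (_E : AnchoredBundle.{v} FM r), W.DimAtLeast (r + n) →
      ReducesToDim FM FN W p q (r + n)) := by
  have heq : ∀ w : W.Pt, FM.rkAt (p w) + n = FN.rkAt (q w) + m := fun w => (hW w.1).rkAt_add_eq w.2
  have hle : ∀ w : W.Pt, FM.rkAt (p w) + n ≤ w.1 := fun w => (hW w.1).rkAt_add_le w.2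
  obtain ⟨a, ha⟩ := ENat.ne_top_iff_exists.1 hFM
  obtain ⟨b, hb⟩ := ENat.ne_top_iff_exists.1 hFN
  have hFMa : ∀ x, FM.rkAt x ≤ a := fun x => by exact_mod_cast ha ▸ FM.rkAt_le_rk x
  have hFNb : ∀ x, FN.rkAt x ≤ b := fun x => by exact_mod_cast hb ▸ FN.rkAt_le_rk x
  refine ⟨fun ⟨w₀⟩ hp hq => ?_, fun k hk hd => ?_, fun r A hd => ?_⟩
  · have : Nonempty M := ⟨p w₀⟩
    have : Nonempty N := ⟨q w₀⟩
    obtain ⟨x, hx⟩ := FM.exists_rkAt_eq_rk hFM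
    obtain ⟨y, hy⟩ := FN.exists_rkAt_eq_rk hFN
    obtain ⟨w, rfl⟩ := hp x
    obtain ⟨w', rfl⟩ := hq y
    have hxa : FM.rkAt (p w) = a := by rw [← ha] at hx; exact_mod_cast hx
    have hyb : FN.rkAt (q w') = b := by rw [← hb] at hy; exact_mod_cast hy
    have h1 := heq w
    have h2 := heq w'
    have h3 := hFMa (p w')
    have h4 := hFNb (q w)
    -- At w the local equality gives a + n ≤ b + m, and at w' it gives b + m ≤ a + n. Hence κ = a +
    -- n, which is at most the dimension of W at w.
    refine ⟨a + n, ?_, w.1, hxa ▸ hle w, ⟨w.2⟩⟩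
    rw [← ha, ← hb]
    have h5 : 2 * (a + n) = a + b + m + n := by omega
    exact_mod_cast h5
  · refine hW.reducesToDim (fun d w => ?_) hd
    rw [← ha, ← hb] at hk
    have hk' : 2 * k = a + b + m + n := by exact_mod_cast hk
    -- The local number is the mean of its two equal expressions, so it is at most (a + n + b + m) /
    -- 2 = k even where p and q are not onto.
    have h1 := heq ⟨d, w⟩
    have h3 := hFMa (p ⟨d, w⟩)
    have h4 := hFNb (q ⟨d, w⟩)
    omega
  · exact hW.reducesToDim (fun d w => Nat.add_le_add_right (A.rkAt_le _) n) hd
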